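/- Let $\Bbbk$ be an algebraically closed field of characteristic zero and let $A$ be an associative commutative $\Bbbk$-algebra with unit. Let $\mathfrak g$ be either $\mathfrak{sl}(n,n)$ with $n\ge 2$, or a finite-dimensional simple Lie superalgebra over $\Bbbk$ not of type $\mathfrak q(n)$. Let $\mathfrak r=\mathfrak g_0$ be the degree-zero part of the standard $\mathbb Z$-grading if $\mathfrak g$ is of Cartan type ($W(n)$, $S(n)$, $\tilde S(n)$, $H(n)$), and $\mathfrak r=\mathfrak g_{\bar 0}$ otherwise. Fix a Cartan subalgebra $\mathfrak h$ of $\mathfrak r$ acting diagonalizably on $\mathfrak g$ with $\mathfrak g=\mathfrak h\oplus\bigoplus_{\alpha\in R}\mathfrak g_\alpha$, $R\subseteq\mathfrak h^*\setminus\{0\}$, and a triangular decomposition $\mathfrak g=\mathfrak n^-\oplus\mathfrak h\oplus\mathfrak n^+$ induced by a regular element of the real form of $\mathfrak h$: there is a real-valued additive evaluation $\mathrm{ev}$ on $\mathfrak h^*$ with $\mathrm{ev}(\alpha)\ne0$ for all $\alpha\in R$, $R^\pm=\{\alpha\in R:\pm\mathrm{ev}(\alpha)>0\}$, and $\mathfrak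 n^\pm=\bigoplus_{\alpha\in R^\pm}\mathfrak g_\alpha$. In particular $\mu\le\nu\iff\nu-\mu\in\sum_{\alpha\in R^+}\mathbb N\alpha$ is a partial order on $\mathfrak h^*$. Assume condition $(\mathfrak C1)$: $\mathfrak n^-\cap\mathfrak g_{\bar0}\subseteq\mathfrak r$. Let $X^+$ be the set of $\lambda\in\mathfrak h^*$ such that the irreducible $\mathfrak g$-module of highest weight $\lambda$ is finite dimensional, and fix $\lambda\in X^+$. All modules are $\mathbb Z_2$-graded and all homomorphisms are even. Let $\mathcal C_A^\lambda$ be the full subcategory of $\mathfrak g\otimes A$-modules $M$ that are sums of finite-dimensional irreducible $\mathfrak r$-modules and satisfy $M^\lambda=M$, where $M^\lambda=M/\sum_{\mu\not\le\lambda}\mathbf U(\mathfrak g\otimes A)M_\mu$ and $M_\mu$ denotes the $\mu$-weight space for $\mathfrak h$. Let $K(\lambda)$ be the $\mathfrak g$-module generated by an even vector $k_\lambda$ with defining relations $\mathfrak n^+k_\lambda=0$, $hk_\lambda=\lambda(h)k_\lambda$, $(x_\alpha^-)^{\lambda(h_\alpha)+1}k_\lambda=0$ for all $h\in\mathfrak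 h$ and all simple roots $\alpha$ of $\mathfrak r$, where $(x_\alpha,x_\alpha^-,h_\alpha)$ is an $\mathfrak{sl}(2)$-triple with $x_\alpha\in\mathfrak r_\alpha$, $x_\alpha^-\in\mathfrak r_{-\alpha}$. Let $W_A(\lambda)=\big(\mathbf U(\mathfrak g\otimes A)\otimes_{\mathbf U(\mathfrak g)}K(\lambda)\big)^\lambda$ be the global Weyl module, $w_\lambda$ the image of $1\otimes k_\lambda$, and $\mathbf A_\lambda=\mathbf U(\mathfrak h\otimes A)/\{u: uw_\lambda=0\}$, a purely even commutative algebra acting on the right of $W_A(\lambda)$ by $(aw_\lambda)u=auw_\lambda$. Let $\mathbf R_A^\lambda M=M_\lambda$, a ($\mathbb Z_2$-graded) $\mathbf A_\lambda$-module, for $M\in\mathcal C_A^\lambda$, and let $\mathbf W_A^\lambda V=W_A(\lambda)\otimes_{\mathbf A_\lambda}V$ for a $\mathbb Z_2$-graded $\mathbf A_\lambda$-module $V$. Let $\mathrm{Ext}^1_{\mathcal C_A^\lambda}(M,N)$ be the group of equivalence classes of short exact sequences $0\to N\to E\to M\to0$ in $\mathcal C_A^\lambda$. **Theorem.** Let $M$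 be an object of $\mathcal C_A^\lambda$. Then $M\cong\mathbf W_A^\lambda\mathbf R_A^\lambda M$ if and only if $$\mathrm{Hom}_{\mathcal C_A^\lambda}(M,N)=0\quad\text{and}\quad\mathrm{Ext}^1_{\mathcal C_A^\lambda}(M,N)=0\qquad\text{for every } N\in\mathcal C_A^\lambda\text{ with }N_\lambda=0.$$ -/

import Mathlib

open scoped TensorProduct

universe u

namespace WeylSuper

noncomputable section

/-! ### Super vector spaces and Lie superalgebras

A `ℤ/2`-grading `V = V₀ ⊕ V₁` on a vector space over a field of characteristic different from two
is recorded by its parity involution `σ`, which is `1` on `V₀` and `-1` on `V₁`; the graded parts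
are its eigenspaces. -/

/-- The homogeneous part of degree `i` of the grading with parity involution `σ`. -/
def superPart {k V : Type*} [Field k] [AddCommGroup V] [Module k V] (σ : V →ₗ[k] V) (i : ZMod 2) :
    Submodule k V :=
  LinearMap.ker (σ - ((-1 : k) ^ i.val) • LinearMap.id)

theorem mem_superPart {k V : Type*} [Field k] [AddCommGroup V] [Module k V] {σ : V →ₗ[k] V}
    {i : ZMod 2} {x : V} : x ∈ superPart σ i ↔ σ x = ((-1 : k) ^ i.val) • x := by
  simp [superPart, sub_eq_zero]

/-- The sign `(-1)^{ij}`. -/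
def superSign (k : Type*) [Field k] (i j : ZMod 2) : k := (-1) ^ (i.val * j.val)

/-- A Lie superalgebra over a field of characteristic zero. -/
class LieSuperalgebra (k : Type*) (L : Type*) [Field k] [AddCommGroup L] [Module k L] where
  /-- the parity involution -/
  parity : L →ₗ[k] L
  /-- the superbracket -/
  sbracket : L →ₗ[k] L →ₗ[k] L
  parity_parity : ∀ x, parity (parity x) = x
  parity_sbracket : ∀ x y, parity (sbracket x y) = sbracket (parity x) (parity y)
  skew : ∀ (i j : ZMod 2) (x y : L), x ∈ superPart parity i → y ∈ superPart parity j →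
    sbracket x y = -(superSign k i j • sbracket y x)
  jacobi : ∀ (i j : ZMod 2) (x y z : L), x ∈ superPart parity i → y ∈ superPart parity j →
    sbracket x (sbracket y z) =
      sbracket (sbracket x y) z + superSign k i j • sbracket y (sbracket x z)

open LieSuperalgebra

/-- The homogeneous part `L_i` of a Lie superalgebra. -/
abbrev part (k L : Type*) [Field k] [AddCommGroup L] [Module k L] [LieSuperalgebra k L]
    (i : ZMod 2) : Submodule k L := superPart (parity (k := k) (L := L)) i

/-! ### The map superalgebra `g ⊗ A` -/

section MapSuperalgebra

variable {k g A : Type*} [Field k] [CharZero k] [AddCommGroup g] [Module k g]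
  [LieSuperalgebra k g] [CommRing A] [Algebra k A]

theorem superPart_rTensor (i : ZMod 2) (t : g ⊗[k] A)
    (ht : t ∈ superPart ((parity (k := k) (L := g)).rTensor A) i) :
    t ∈ Submodule.span k {s : g ⊗[k] A | ∃ x ∈ part k g i, ∃ a : A, s = x ⊗ₜ[k] a} := by
  set S := Submodule.span k {s : g ⊗[k] A | ∃ x ∈ part k g i, ∃ a : A, s = x ⊗ₜ[k] a}
  have key : ∀ s : g ⊗[k] A,
      s + ((-1 : k) ^ i.val) • (parity (k := k) (L := g)).rTensor A s ∈ S := by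
    intro s
    induction s using TensorProduct.induction_on with
    | zero => simp
    | tmul x a =>
      refine Submodule.subset_span ⟨x + ((-1 : k) ^ i.val) • parity (k := k) x, ?_, a, ?_⟩
      · rw [mem_superPart, map_add, map_smul, parity_parity, smul_add, smul_smul, ← pow_add,
          Even.neg_one_pow ⟨i.val, rfl⟩, one_smul, add_comm]
      · simp [TensorProduct.add_tmul, TensorProduct.smul_tmul']
    | add s t hs ht =>
      have := S.add_mem hs ht
      simp only [map_add, smul_add]
      convert this using 1
      abel
  have h := key t
  rw [mem_superPart.1 ht, smul_smul, ← pow_add, Even.neg_one_pow ⟨i.val, rfl⟩, one_smul,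
    ← two_smul k t] at h
  exact (S.smul_mem_iff two_ne_zero).1 h

/-- The Lie superalgebra `g ⊗ A`, with `[x ⊗ a, y ⊗ b] = [x, y] ⊗ ab`. -/
instance mapSuperalgebra : LieSuperalgebra k (g ⊗[k] A) where
  parity := (parity (k := k) (L := g)).rTensor A
  sbracket := TensorProduct.map₂ (sbracket (k := k) (L := g)) (LinearMap.mul k A)
  parity_parity t := by
    induction t using TensorProduct.induction_on with
    | zero => simp
    | tmul x a => simp [parity_parity]
    | add s t hs ht => simp [hs, ht]
  parity_sbracket s t := by
    induction s using TensorProduct.induction_on with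
    | zero => simp
    | add s s' hs hs' => simp [hs, hs']
    | tmul x a =>
      induction t using TensorProduct.induction_on with
      | zero => simp
      | add t t' ht ht' => simp only [map_add, ht, ht']
      | tmul y b => simp [parity_sbracket]
  skew i j s t hs ht := by
    replace hs := superPart_rTensor i s hs
    replace ht := superPart_rTensor j t ht
    induction hs using Submodule.span_induction with
    | zero => simp
    | add s s' _ _ hs hs' => simp [hs, hs', add_comm]
    | smul c s _ hs => simp [hs, smul_comm c]
    | mem s hs =>
      obtain ⟨x, hx, a, rfl⟩ := hs
      induction ht using Submodule.span_induction with
      | zero => simp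
      | add s s' _ _ hs hs' =>
        simp only [map_add, LinearMap.add_apply, smul_add, neg_add, hs, hs']
      | smul c s _ hs =>
        simp only [map_smul, LinearMap.smul_apply, hs, smul_neg, smul_comm c]
      | mem t ht =>
        obtain ⟨y, hy, b, rfl⟩ := ht
        simp [skew i j x y hx hy, mul_comm b a, TensorProduct.neg_tmul, TensorProduct.smul_tmul']
  jacobi i j s t r hs ht := by
    replace hs := superPart_rTensor i s hs
    replace ht := superPart_rTensor j t ht
    induction hs using Submodule.span_induction with
    | zero => simp
    | add s s' _ _ hs hs' => simp only [map_add, LinearMap.add_apply, smul_add, hs, hs']; abel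
    | smul c s _ hs => simp [hs, smul_comm c]
    | mem s hs =>
      obtain ⟨x, hx, a, rfl⟩ := hs
      induction ht using Submodule.span_induction with
      | zero => simp
      | add s s' _ _ hs hs' => simp only [map_add, LinearMap.add_apply, smul_add, hs, hs']; abel
      | smul c s _ hs =>
        simp only [map_smul, LinearMap.smul_apply, hs, smul_add, smul_comm c]
      | mem t ht =>
        obtain ⟨y, hy, b, rfl⟩ := ht
        induction r using TensorProduct.induction_on with
        | zero => simp
        | add s s' hs hs' => simp only [map_add, smul_add, hs, hs']; abel
        | tmul z c =>
          simp [jacobi i j x y z hx hy, TensorProduct.add_tmul, TensorProduct.smul_tmul',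
            mul_assoc, mul_left_comm b a c]

theorem sbracket_tmul (x y : g) (a b : A) :
    sbracket (k := k) (x ⊗ₜ[k] a) (y ⊗ₜ[k] b) = sbracket (k := k) x y ⊗ₜ[k] (a * b) := rfl

theorem parity_tmul (x : g) (a : A) :
    parity (k := k) (x ⊗ₜ[k] a) = parity (k := k) x ⊗ₜ[k] a := rfl

theorem tmul_mem_part {i : ZMod 2} {x : g} (hx : x ∈ part k g i) (a : A) :
    x ⊗ₜ[k] a ∈ part k (g ⊗[k] A) i := by
  rw [mem_superPart, parity_tmul, mem_superPart.1 hx, TensorProduct.smul_tmul']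

end MapSuperalgebra

/-! ### The universal enveloping superalgebra and graded modules -/

section Enveloping

variable (k L : Type*) [Field k] [AddCommGroup L] [Module k L] [LieSuperalgebra k L]

/-- The relations `xy - (-1)^{|x||y|} yx = [x, y]`, for homogeneous `x`, `y`. -/
inductive EnvRel : TensorAlgebra k L → TensorAlgebra k L → Prop
  | comm (i j : ZMod 2) (x y : L) (hx : x ∈ part k L i) (hy : y ∈ part k L j) :
      EnvRel (TensorAlgebra.ι k x * TensorAlgebra.ι k y)
        (superSign k i j • (TensorAlgebra.ι k y * TensorAlgebra.ι k x) +
          TensorAlgebra.ι k (sbracket (k := k) x y))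

/-- The universal enveloping superalgebra `U(L)`. -/
abbrev SuperEnv := RingQuot (EnvRel k L)

variable {L}

/-- The canonical map `L → U(L)`. -/
def envι : L →ₗ[k] SuperEnv k L :=
  (RingQuot.mkAlgHom k (EnvRel k L)).toLinearMap ∘ₗ TensorAlgebra.ι k

theorem envι_mul {i j : ZMod 2} {x y : L} (hx : x ∈ part k L i) (hy : y ∈ part k L j) :
    envι k x * envι k y =
      superSign k i j • (envι k y * envι k x) + envι k (sbracket (k := k) x y) := by
  have h := RingQuot.mkAlgHom_rel k (EnvRel.comm i j x y hx hy)
  simpa [envι] using h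

variable (L)

/-- The parity involution of `U(L)`, the algebra automorphism extending that of `L`. -/
def envParity : SuperEnv k L →ₐ[k] SuperEnv k L :=
  RingQuot.liftAlgHom k ⟨TensorAlgebra.lift k (envι k ∘ₗ parity (k := k) (L := L)), by
    rintro _ _ ⟨i, j, x, y, hx, hy⟩
    have hx' := hx
    have hy' := hy
    rw [mem_superPart] at hx' hy'
    have h := envι_mul k hx hy
    simp only [map_mul, map_add, map_smul, TensorAlgebra.lift_ι_apply, LinearMap.comp_apply,
      parity_sbracket, hx', hy', LinearMap.smul_apply, smul_mul_assoc, mul_smul_comm, h, smul_add]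
    congr 1
    simp only [smul_smul]
    congr 1
    ring⟩

variable {L}

theorem envParity_ι (x : L) : envParity k L (envι k x) = envι k (parity (k := k) x) := by
  simp [envParity, envι]

theorem envParity_envParity (a : SuperEnv k L) : envParity k L (envParity k L a) = a := by
  have h : (envParity k L).comp (envParity k L) = AlgHom.id k _ := by
    apply RingQuot.ringQuot_ext'
    apply TensorAlgebra.hom_ext
    ext x
    change envParity k L (envParity k L (envι k x)) = envι k x
    rw [envParity_ι, envParity_ι, parity_parity]
  exact DFunLike.congr_fun h a

end Enveloping

/-- A module over the Lie superalgebra `L`, that is, a `ℤ/2`-graded left `U(L)`-module. -/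
structure SuperMod (k L : Type u) [Field k] [AddCommGroup L] [Module k L]
    [LieSuperalgebra k L] : Type (u + 1) where
  carrier : Type u
  [addCommGroup : AddCommGroup carrier]
  [moduleField : Module k carrier]
  [moduleEnv : Module (SuperEnv k L) carrier]
  [tower : IsScalarTower k (SuperEnv k L) carrier]
  parity : carrier →ₗ[k] carrier
  parity_parity : ∀ m, parity (parity m) = m
  parity_smul : ∀ (a : SuperEnv k L) (m : carrier), parity (a • m) = envParity k L a • parity m

attribute [instance] SuperMod.addCommGroup SuperMod.moduleField SuperMod.moduleEnv SuperMod.tower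

instance (k L : Type u) [Field k] [AddCommGroup L] [Module k L] [LieSuperalgebra k L] :
    CoeSort (SuperMod k L) (Type u) := ⟨SuperMod.carrier⟩

namespace SuperMod

variable {k L : Type u} [Field k] [AddCommGroup L] [Module k L] [LieSuperalgebra k L]

/-- Homomorphisms of modules are assumed to be even. -/
structure Hom (M N : SuperMod k L) where
  toLin : M →ₗ[SuperEnv k L] N
  map_parity : ∀ m, toLin (M.parity m) = N.parity (toLin m)

/-- (Even) isomorphisms of modules. -/
structure Iso (M N : SuperMod k L) where
  toEquiv : M ≃ₗ[SuperEnv k L] N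
  map_parity : ∀ m, toEquiv (M.parity m) = N.parity (toEquiv m)

/-- The regular module `U(L)`. -/
def regular (k L : Type u) [Field k] [AddCommGroup L] [Module k L] [LieSuperalgebra k L] :
    SuperMod k L where
  carrier := SuperEnv k L
  parity := (envParity k L).toLinearMap
  parity_parity := envParity_envParity k
  parity_smul a m := by simp

/-- The quotient of a module by a graded submodule. -/
def quot (M : SuperMod k L) (S : Submodule (SuperEnv k L) M) (hS : ∀ m ∈ S, M.parity m ∈ S) :
    SuperMod k L where
  carrier := M ⧸ S
  parity := (Submodule.Quotient.restrictScalarsEquiv k S).toLinearMap ∘ₗ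
    Submodule.mapQ (S.restrictScalars k) (S.restrictScalars k) M.parity hS ∘ₗ
    (Submodule.Quotient.restrictScalarsEquiv k S).symm.toLinearMap
  parity_parity := by
    intro m
    obtain ⟨m, rfl⟩ := Submodule.Quotient.mk_surjective _ m
    change (Submodule.Quotient.mk (M.parity (M.parity m)) : M ⧸ S) = _
    rw [M.parity_parity]
  parity_smul := by
    intro a m
    obtain ⟨m, rfl⟩ := Submodule.Quotient.mk_surjective _ m
    change (Submodule.Quotient.mk (M.parity (a • m)) : M ⧸ S) =
      Submodule.Quotient.mk (envParity k L a • M.parity m)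
    rw [M.parity_smul]

theorem quot_parity_mk (M : SuperMod k L) (S : Submodule (SuperEnv k L) M)
    (hS : ∀ m ∈ S, M.parity m ∈ S) (m : M) :
    (M.quot S hS).parity (Submodule.Quotient.mk m : M ⧸ S) =
      (Submodule.Quotient.mk (M.parity m) : M ⧸ S) := rfl

/-- Irreducibility: `M ≠ 0` and `M` has no graded submodules other than `0` and `M`. -/
def IsIrreducible (M : SuperMod k L) : Prop :=
  Nontrivial M ∧ ∀ S : Submodule (SuperEnv k L) M, (∀ m ∈ S, M.parity m ∈ S) → S = ⊥ ∨ S = ⊤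

end SuperMod

/-! ### The Lie superalgebras under consideration and their reductive parts -/

section Classes

/-- `φ` is an injective homomorphism of Lie superalgebras from `g` to the associative superalgebra
`B` (with parity involution `τ`) endowed with the supercommutator. -/
structure IsSuperEmbedding {k g B : Type*} [Field k] [AddCommGroup g] [Module k g]
    [LieSuperalgebra k g] [Ring B] [Algebra k B] (τ : B →ₗ[k] B) (φ : g →ₗ[k] B) : Prop where
  injective : Function.Injective φ
  map_parity : ∀ x, φ (parity (k := k) x) = τ (φ x)
  map_sbracket : ∀ (i j : ZMod 2) (x y : g), x ∈ part k g i → y ∈ part k g j →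
    φ (sbracket (k := k) x y) = φ x * φ y - superSign k i j • (φ y * φ x)

/-- `g` is simple: its bracket is not zero, and it has no graded ideals except `0` and `g`. -/
def IsSimple (k g : Type*) [Field k] [AddCommGroup g] [Module k g] [LieSuperalgebra k g] : Prop :=
  (∃ x y : g, sbracket (k := k) x y ≠ 0) ∧
    ∀ I : Submodule k g, (∀ x ∈ I, parity (k := k) x ∈ I) →
      (∀ x : g, ∀ y ∈ I, sbracket (k := k) x y ∈ I) → I = ⊥ ∨ I = ⊤

/-- The Lie algebra `g₀` is reductive: its adjoint representation is completely reducible, that is,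
every ideal of `g₀` has a complementary ideal. -/
def EvenPartReductive (k g : Type*) [Field k] [AddCommGroup g] [Module k g]
    [LieSuperalgebra k g] : Prop :=
  ∀ I ≤ part k g 0, (∀ x ∈ part k g 0, ∀ y ∈ I, sbracket (k := k) x y ∈ I) →
    ∃ J ≤ part k g 0, (∀ x ∈ part k g 0, ∀ y ∈ J, sbracket (k := k) x y ∈ J) ∧
      I ⊓ J = ⊥ ∧ I ⊔ J = part k g 0

/-- The parity involution on `(n|n) × (n|n)` matrices: block diagonal matrices are even, block
antidiagonal ones are odd. -/
def matrixParity (k : Type*) [Field k] (n : ℕ) :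
    Matrix (Fin n ⊕ Fin n) (Fin n ⊕ Fin n) k →ₗ[k] Matrix (Fin n ⊕ Fin n) (Fin n ⊕ Fin n) k :=
  LinearMap.mulLeft k (Matrix.fromBlocks 1 0 0 (-1)) ∘ₗ
    LinearMap.mulRight k (Matrix.fromBlocks 1 0 0 (-1))

/-- `sl(n, n)`, the matrices of supertrace zero. -/
def slnn (k : Type*) [Field k] (n : ℕ) : Submodule k (Matrix (Fin n ⊕ Fin n) (Fin n ⊕ Fin n) k) where
  carrier := {X | X.toBlocks₁₁.trace = X.toBlocks₂₂.trace}
  zero_mem' := by simp [Matrix.trace, Matrix.toBlocks₁₁, Matrix.toBlocks₂₂]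
  add_mem' {X Y} hX hY := by
    simp only [Set.mem_ofPred_eq, Matrix.trace, Matrix.toBlocks₁₁, Matrix.toBlocks₂₂,
      Matrix.diag_apply, Matrix.of_apply, Matrix.add_apply, Finset.sum_add_distrib] at *
    rw [hX, hY]
  smul_mem' c X hX := by
    simp only [Set.mem_ofPred_eq, Matrix.trace, Matrix.toBlocks₁₁, Matrix.toBlocks₂₂,
      Matrix.diag_apply, Matrix.of_apply, Matrix.smul_apply, ← Finset.smul_sum] at *
    rw [hX]

variable (k : Type*) [Field k] (n : ℕ)

/-- The Grassmann algebra `Λ(n)` on `n` odd generators. -/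
abbrev Grassmann := ExteriorAlgebra k (Fin n → k)

/-- The generator `ξᵢ` of `Λ(n)`. -/
def xi (i : Fin n) : Grassmann k n := ExteriorAlgebra.ι k (Pi.single i 1)

/-- The parity involution of `Λ(n)`, sending each `ξᵢ` to `-ξᵢ`. -/
def grassmannParity : Grassmann k n →ₗ[k] Grassmann k n :=
  (CliffordAlgebra.involute (Q := (0 : QuadraticForm k (Fin n → k)))).toLinearMap

/-- The parity involution on linear endomorphisms of `Λ(n)`. -/
def endParity : Module.End k (Grassmann k n) →ₗ[k] Module.End k (Grassmann k n) :=
  LinearMap.mulLeft k (grassmannParity k n) ∘ₗ LinearMap.mulRight k (grassmannParity k n)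

/-- The homogeneous superderivations of `Λ(n)` of parity `i`. -/
def superDer (i : ZMod 2) : Submodule k (Module.End k (Grassmann k n)) where
  carrier := {D | D ∈ superPart (endParity k n) i ∧
    ∀ (j : ZMod 2) (x y : Grassmann k n), x ∈ superPart (grassmannParity k n) j →
      D (x * y) = D x * y + superSign k i j • (x * D y)}
  zero_mem' := by simp
  add_mem' {D E} hD hE := by
    refine ⟨add_mem hD.1 hE.1, fun j x y hx ↦ ?_⟩
    simp only [LinearMap.add_apply, hD.2 j x y hx, hE.2 j x y hx, add_mul, mul_add, smul_add]
    abel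
  smul_mem' c D hD := by
    refine ⟨Submodule.smul_mem _ c hD.1, fun j x y hx ↦ ?_⟩
    simp only [LinearMap.smul_apply, hD.2 j x y hx, smul_add, smul_mul_assoc, mul_smul_comm,
      smul_comm c]

/-- `W(n)`, the superderivations of `Λ(n)`. -/
def cartanW : Submodule k (Module.End k (Grassmann k n)) := superDer k n 0 ⊔ superDer k n 1

/-- The superderivation `∂ᵢ` of `Λ(n)`, with `∂ᵢ ξⱼ = δᵢⱼ`. -/
def partialD (i : Fin n) : Module.End k (Grassmann k n) :=
  CliffordAlgebra.contractLeft (Q := (0 : QuadraticForm k (Fin n → k))) (LinearMap.proj i)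

/-- The divergence `∑ᵢ ∂ᵢ(D ξᵢ)`. -/
def divergence : Module.End k (Grassmann k n) →ₗ[k] Grassmann k n :=
  ∑ i, partialD k n i ∘ₗ LinearMap.applyₗ (xi k n i)

/-- `S(n)`, the superderivations of divergence zero. -/
def cartanS : Submodule k (Module.End k (Grassmann k n)) :=
  cartanW k n ⊓ LinearMap.ker (divergence k n)

/-- The product `ξ₁ ξ₂ ⋯ ξₙ`. -/
def xiTop : Grassmann k n := (List.ofFn (xi k n)).prod

/-- `S̃(n)`, the superderivations `D` with `(1 + ξ₁⋯ξₙ) div(D) + D(ξ₁⋯ξₙ) = 0`. -/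
def cartanStilde : Submodule k (Module.End k (Grassmann k n)) :=
  cartanW k n ⊓ LinearMap.ker
    (LinearMap.mulLeft k (1 + xiTop k n) ∘ₗ divergence k n + LinearMap.applyₗ (xiTop k n))

/-- `H̃(n)`, the superderivations `D_x = ∑ᵢ ∂ᵢ(x) ∂ᵢ` with `x ∈ Λ(n)`. -/
def cartanHtilde : Submodule k (Module.End k (Grassmann k n)) :=
  LinearMap.range (∑ i, LinearMap.mulRight k (partialD k n i) ∘ₗ
    (LinearMap.mul k (Grassmann k n)) ∘ₗ partialD k n i)

/-- `H(n) = [H̃(n), H̃(n)]`. -/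
def cartanH : Submodule k (Module.End k (Grassmann k n)) :=
  Submodule.span k {E | ∃ (i j : ZMod 2) (D D' : Module.End k (Grassmann k n)),
    D ∈ cartanHtilde k n ⊓ superPart (endParity k n) i ∧
    D' ∈ cartanHtilde k n ⊓ superPart (endParity k n) j ∧
    E = D * D' - superSign k i j • (D' * D)}

/-- The endomorphisms of `Λ(n)` preserving the `ℤ`-grading. -/
def degreeZero : Submodule k (Module.End k (Grassmann k n)) :=
  ⨅ p : ℕ, Submodule.compatibleMaps (⋀[k]^p (Fin n → k)) (⋀[k]^p (Fin n → k))

end Classes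

/-- `g` is one of the Lie superalgebras under consideration, and `r` is its distinguished reductive
subalgebra:
* `g` is a simple Lie superalgebra whose even part is reductive, that is (by Kac's classification),
  `g` is basic classical or strange, and `r = g₀`;
* `g` is isomorphic to `sl(n, n)` with `n ≥ 2`, and `r = g₀`;
* `g` is isomorphic to one of the Lie superalgebras `W(n)`, `S(n)`, `S̃(n)`, `H(n)` of Cartan type,
  and `r` is the degree zero component of its grading.

The simple Lie superalgebras `q(n)` are excluded by `TriangularDecomposition`, since their Cartan
subalgebras are not even. -/
inductive IsReductivePart {k g : Type u} [Field k] [AddCommGroup g] [Module k g]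
    [LieSuperalgebra k g] (r : Submodule k g) : Prop
  | classical : IsSimple k g → EvenPartReductive k g → r = part k g 0 → IsReductivePart r
  | slnn (n : ℕ) (φ : g →ₗ[k] Matrix (Fin n ⊕ Fin n) (Fin n ⊕ Fin n) k) : 2 ≤ n →
      IsSuperEmbedding (matrixParity k n) φ → LinearMap.range φ = slnn k n →
      r = part k g 0 → IsReductivePart r
  | cartanW (n : ℕ) (φ : g →ₗ[k] Module.End k (Grassmann k n)) : 2 ≤ n →
      IsSuperEmbedding (endParity k n) φ → LinearMap.range φ = cartanW k n →
      r = (degreeZero k n).comap φ → IsReductivePart r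
  | cartanS (n : ℕ) (φ : g →ₗ[k] Module.End k (Grassmann k n)) : 3 ≤ n →
      IsSuperEmbedding (endParity k n) φ → LinearMap.range φ = cartanS k n →
      r = (degreeZero k n).comap φ → IsReductivePart r
  | cartanStilde (n : ℕ) (φ : g →ₗ[k] Module.End k (Grassmann k n)) : 4 ≤ n → Even n →
      IsSuperEmbedding (endParity k n) φ → LinearMap.range φ = cartanStilde k n →
      r = (degreeZero k n).comap φ → IsReductivePart r
  | cartanH (n : ℕ) (φ : g →ₗ[k] Module.End k (Grassmann k n)) : 4 ≤ n →
      IsSuperEmbedding (endParity k n) φ → LinearMap.range φ = cartanH k n →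
      r = (degreeZero k n).comap φ → IsReductivePart r

/-! ### Triangular decompositions -/

/-- The root space `g_α = {x | [h, x] = α(h) x for all h ∈ 𝔥}`. -/
def rootSpace {k g : Type*} [Field k] [AddCommGroup g] [Module k g] [LieSuperalgebra k g]
    (h : Submodule k g) (α : Module.Dual k h) : Submodule k g :=
  ⨅ y : h, LinearMap.ker (sbracket (k := k) (y : g) - α y • LinearMap.id)

theorem mem_rootSpace {k g : Type*} [Field k] [AddCommGroup g] [Module k g] [LieSuperalgebra k g]
    {h : Submodule k g} {α : Module.Dual k h} {x : g} :
    x ∈ rootSpace h α ↔ ∀ y : h, sbracket (k := k) (y : g) x = α y • x := by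
  simp [rootSpace, sub_eq_zero]

/-- A triangular decomposition `g = n⁻ ⊕ 𝔥 ⊕ n⁺` induced by a regular element, where `𝔥` is a
Cartan subalgebra of the even subalgebra `r`. The regular element of the real form of `𝔥` is given
through its additive, real-valued evaluation function on `𝔥*`, which does not vanish on roots. -/
structure TriangularDecomposition {k g : Type u} [Field k] [AddCommGroup g] [Module k g]
    [LieSuperalgebra k g] (r : Submodule k g) where
  r_even : r ≤ part k g 0
  /-- the Cartan subalgebra -/
  h : Submodule k g
  h_le : h ≤ r
  rootSpace_zero : rootSpace h 0 = h
  iSup_rootSpace : ⨆ α, rootSpace h α = ⊤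
  /-- evaluation of weights at the regular element -/
  ev : Module.Dual k h →+ ℝ
  regular : ∀ α, α ≠ 0 → rootSpace h α ≠ ⊥ → ev α ≠ 0

namespace TriangularDecomposition

variable {k g : Type u} [Field k] [AddCommGroup g] [Module k g]
  [LieSuperalgebra k g] {r : Submodule k g} (T : TriangularDecomposition r)

/-- The set `R⁺` of positive roots. -/
def posRoots : Set (Module.Dual k T.h) := {α | α ≠ 0 ∧ rootSpace T.h α ≠ ⊥ ∧ 0 < T.ev α}

/-- The set `R⁻` of negative roots. -/
def negRoots : Set (Module.Dual k T.h) := {α | α ≠ 0 ∧ rootSpace T.h α ≠ ⊥ ∧ T.ev α < 0}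

/-- `n⁺`, the sum of the positive root spaces. -/
def nPlus : Submodule k g := ⨆ α ∈ T.posRoots, rootSpace T.h α

/-- `n⁻`, the sum of the negative root spaces. -/
def nMinus : Submodule k g := ⨆ α ∈ T.negRoots, rootSpace T.h α

/-- Condition (C1): the even part of `n⁻` is contained in `r`. -/
def CondC1 : Prop := T.nMinus ⊓ part k g 0 ≤ r

/-- The partial order on `𝔥*`: `μ ≤ ν` if and only if `ν - μ` belongs to `Q⁺ = ∑_{α ∈ R⁺} ℕ α`. -/
def WLe (μ ν : Module.Dual k T.h) : Prop := ν - μ ∈ AddSubmonoid.closure T.posRoots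

/-- The positive roots of `r`. -/
def posRootsR : Set (Module.Dual k T.h) := {α | α ∈ T.posRoots ∧ rootSpace T.h α ⊓ r ≠ ⊥}

/-- The simple roots of `r`: the positive roots that are not the sum of two positive roots. -/
def simpleRootsR : Set (Module.Dual k T.h) :=
  {α | α ∈ T.posRootsR ∧ ∀ β ∈ T.posRootsR, ∀ γ ∈ T.posRootsR, α ≠ β + γ}

/-- `(x, y, h)` is an `sl(2)`-triple in `r` with `x ∈ r_α` and `y ∈ r_{-α}`. -/
structure IsTriple (α : Module.Dual k T.h) (x y : g) (h : T.h) : Prop where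
  h_ne_zero : h ≠ 0
  x_mem : x ∈ rootSpace T.h α ⊓ r
  y_mem : y ∈ rootSpace T.h (-α) ⊓ r
  xy : sbracket (k := k) x y = h
  hx : sbracket (k := k) (h : g) x = (2 : k) • x
  hy : sbracket (k := k) (h : g) y = -((2 : k) • y)

/-- The set `X⁺` of those `ν` for which the irreducible `g`-module of highest weight `ν` is finite
dimensional. -/
def dominant : Set (Module.Dual k T.h) :=
  {ν | ∃ V : SuperMod k g, Module.Finite k V ∧ V.IsIrreducible ∧ ∃ v : V, v ≠ 0 ∧
    (∀ x ∈ T.nPlus, envι k x • v = 0) ∧ ∀ x : T.h, envι k (x : g) • v = ν x • v}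

theorem h_even : T.h ≤ part k g 0 := T.h_le.trans T.r_even

theorem parity_eq_of_even {x : g} (hx : x ∈ part k g 0) : parity (k := k) x = x := by
  simpa using mem_superPart.1 hx

theorem parity_mem_rootSpace {α : Module.Dual k T.h} {x : g} (hx : x ∈ rootSpace T.h α) :
    parity (k := k) x ∈ rootSpace T.h α := by
  rw [mem_rootSpace] at hx ⊢
  intro y
  have h := congrArg (parity (k := k)) (hx y)
  rwa [parity_sbracket, parity_eq_of_even (T.h_even y.2), map_smul] at h

theorem parity_mem_nPlus {x : g} (hx : x ∈ T.nPlus) : parity (k := k) x ∈ T.nPlus := by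
  have : T.nPlus ≤ T.nPlus.comap (parity (k := k) (L := g)) := by
    refine iSup₂_le fun α hα x hx ↦ ?_
    exact (le_iSup₂_of_le (f := fun α (_ : α ∈ T.posRoots) ↦ rootSpace T.h α) α hα le_rfl)
      (T.parity_mem_rootSpace hx)
  exact this hx

theorem sbracket_h {x y : g} (hx : x ∈ T.h) (hy : y ∈ T.h) : sbracket (k := k) x y = 0 := by
  rw [← T.rootSpace_zero, mem_rootSpace] at hy
  simpa using hy ⟨x, hx⟩

theorem ev_nonneg_of_mem {β : Module.Dual k T.h} (h : β ∈ AddSubmonoid.closure T.posRoots) :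
    0 ≤ T.ev β := by
  induction h using AddSubmonoid.closure_induction with
  | mem x hx => exact hx.2.2.le
  | zero => simp
  | add x y _ _ hx hy => rw [map_add]; positivity

theorem not_wLe_add {α : Module.Dual k T.h} (hα : α ∈ T.posRoots) (ν : Module.Dual k T.h) :
    ¬ T.WLe (ν + α) ν := by
  intro h
  have := T.ev_nonneg_of_mem h
  have h2 := hα.2.2
  simp at this
  linarith

end TriangularDecomposition

/-! ### Weights and the categories of modules -/

section Weyl

variable {k g : Type u} [Field k] [CharZero k] [AddCommGroup g] [Module k g]
  [LieSuperalgebra k g] {r : Submodule k g} (T : TriangularDecomposition r)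
  {A : Type u} [CommRing A] [Algebra k A]

variable (k A) in
/-- The element `x ⊗ 1` of `U(g ⊗ A)`, for `x ∈ g`. -/
def envOne : g →ₗ[k] SuperEnv k (g ⊗[k] A) := envι k ∘ₗ (TensorProduct.mk k g A).flip 1

/-- The weight space `M_μ`. -/
def weightSpace (M : SuperMod k (g ⊗[k] A)) (μ : Module.Dual k T.h) : Submodule k M where
  carrier := {m | ∀ x : T.h, envOne k A (x : g) • m = μ x • m}
  zero_mem' x := by rw [smul_zero, smul_zero]
  add_mem' hm hn x := by rw [smul_add, smul_add, hm x, hn x]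
  smul_mem' c m hm x := by rw [smul_comm, hm x, smul_comm]

/-- The submodule `∑_{μ ≰ ν} U(g ⊗ A) M_μ` of `M`. -/
def truncSubmodule (M : SuperMod k (g ⊗[k] A)) (ν : Module.Dual k T.h) :
    Submodule (SuperEnv k (g ⊗[k] A)) M :=
  ⨆ (μ : Module.Dual k T.h) (_ : ¬ T.WLe μ ν),
    Submodule.span (SuperEnv k (g ⊗[k] A)) (weightSpace T M μ : Set M)

theorem parity_mem_weightSpace (M : SuperMod k (g ⊗[k] A)) {μ : Module.Dual k T.h} {m : M}
    (hm : m ∈ weightSpace T M μ) : M.parity m ∈ weightSpace T M μ := by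
  intro x
  have h := congrArg M.parity (hm x)
  rw [M.parity_smul, envOne, LinearMap.comp_apply, envParity_ι, LinearMap.flip_apply,
    TensorProduct.mk_apply, parity_tmul,
    TriangularDecomposition.parity_eq_of_even (T.h_even x.2), map_smul] at h
  exact h

theorem parity_mem_span (M : SuperMod k (g ⊗[k] A)) (s : Set M)
    (hs : ∀ m ∈ s, M.parity m ∈ Submodule.span (SuperEnv k (g ⊗[k] A)) s) :
    ∀ m ∈ Submodule.span (SuperEnv k (g ⊗[k] A)) s,
      M.parity m ∈ Submodule.span (SuperEnv k (g ⊗[k] A)) s := by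
  intro m hm
  induction hm using Submodule.span_induction with
  | mem m hm => exact hs m hm
  | zero => simp
  | add x y _ _ hx hy => rw [map_add]; exact add_mem hx hy
  | smul a x _ hx => rw [M.parity_smul]; exact Submodule.smul_mem _ _ hx

theorem parity_mem_truncSubmodule (M : SuperMod k (g ⊗[k] A)) (ν : Module.Dual k T.h) :
    ∀ m ∈ truncSubmodule T M ν, M.parity m ∈ truncSubmodule T M ν := by
  intro m hm
  simp only [truncSubmodule, ← Submodule.span_iUnion] at hm ⊢
  refine parity_mem_span M _ (fun m hm ↦ Submodule.subset_span ?_) m hm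
  simp only [Set.mem_iUnion] at hm ⊢
  obtain ⟨μ, hμ, hm⟩ := hm
  exact ⟨μ, hμ, parity_mem_weightSpace T M hm⟩

/-- The quotient `M^ν = M / ∑_{μ ≰ ν} U(g ⊗ A) M_μ`. -/
def trunc (M : SuperMod k (g ⊗[k] A)) (ν : Module.Dual k T.h) : SuperMod k (g ⊗[k] A) :=
  M.quot (truncSubmodule T M ν) (parity_mem_truncSubmodule T M ν)

/-- `S` is an `r`-submodule of `M`. -/
def IsStable (r : Submodule k g) {M : SuperMod k (g ⊗[k] A)} (S : Submodule k M) : Prop :=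
  ∀ x ∈ r, ∀ m ∈ S, envOne k A x • m ∈ S

/-- `M` is finitely semisimple over `r`: it is the sum of its finite-dimensional irreducible
`r`-submodules. -/
def FinitelySemisimple (r : Submodule k g) (M : SuperMod k (g ⊗[k] A)) : Prop :=
  sSup {S : Submodule k M | IsStable r S ∧ Module.Finite k S ∧ S ≠ ⊥ ∧
    ∀ S' ≤ S, IsStable r S' → S' = ⊥ ∨ S' = S} = ⊤

variable (A) in
/-- The objects of the category `C_A^ν`: the `g ⊗ A`-modules `M` that are finitely semisimple over
`r` and satisfy `M^ν = M`. It is a full subcategory of the category of `g ⊗ A`-modules. -/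
structure CatObj (ν : Module.Dual k T.h) : Type (u + 1) where
  obj : SuperMod k (g ⊗[k] A)
  finitelySemisimple : FinitelySemisimple r obj
  trunc_eq : truncSubmodule T obj ν = ⊥

/-! ### `Ext¹` in `C_A^ν` -/

/-- A short exact sequence `0 → N → E → M → 0` in `C_A^ν`. -/
structure Extension {ν : Module.Dual k T.h} (M N : CatObj T A ν) where
  mid : CatObj T A ν
  incl : SuperMod.Hom N.obj mid.obj
  proj : SuperMod.Hom mid.obj M.obj
  injective : Function.Injective incl.toLin
  surjective : Function.Surjective proj.toLin
  exact : Function.Exact incl.toLin proj.toLin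

/-- Equivalence of extensions: an isomorphism of the middle terms inducing the identity on the
outer terms. -/
def Extension.Equiv {ν : Module.Dual k T.h} {M N : CatObj T A ν} (E F : Extension T M N) : Prop :=
  ∃ e : SuperMod.Iso E.mid.obj F.mid.obj,
    (∀ n, e.toEquiv (E.incl.toLin n) = F.incl.toLin n) ∧
    ∀ m, F.proj.toLin (e.toEquiv m) = E.proj.toLin m

/-- Equivalence of extensions is an equivalence relation. -/
def extSetoid {ν : Module.Dual k T.h} (M N : CatObj T A ν) : Setoid (Extension T M N) where
  r := Extension.Equiv T
  iseqv :=
    { refl := fun E ↦ ⟨⟨LinearEquiv.refl _ _, fun _ ↦ rfl⟩, fun _ ↦ rfl, fun _ ↦ rfl⟩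
      symm := by
        rintro E F ⟨e, h1, h2⟩
        refine ⟨⟨e.toEquiv.symm, fun m ↦ ?_⟩, fun n ↦ ?_, fun m ↦ ?_⟩
        · rw [LinearEquiv.symm_apply_eq, e.map_parity, LinearEquiv.apply_symm_apply]
        · rw [LinearEquiv.symm_apply_eq, h1]
        · rw [← h2, LinearEquiv.apply_symm_apply]
      trans := by
        rintro E F G ⟨e, h1, h2⟩ ⟨f, h3, h4⟩
        refine ⟨⟨e.toEquiv.trans f.toEquiv, fun m ↦ ?_⟩, fun n ↦ ?_, fun m ↦ ?_⟩
        · simp [e.map_parity, f.map_parity]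
        · simp [h1, h3]
        · simp [h4, h2] }

/-- `Ext¹(M, N)` in `C_A^ν`: the equivalence classes of extensions of `M` by `N`. It contains the
class of the split extension, so that it vanishes exactly when it has at most one element. -/
def Ext1 {ν : Module.Dual k T.h} (M N : CatObj T A ν) : Type (u + 1) := Quotient (extSetoid T M N)

/-! ### Global Weyl modules -/

variable (A) in
/-- The defining relations `n⁺ p = 0`, `h p = ν(h) p`, `(x_α⁻)^{ν(h_α)+1} p = 0`, for `h ∈ 𝔥` and
simple roots `α` of `r`, of the generalized Kac module `K(ν)`, as elements of `U(g ⊗ A)`. -/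
def kacRelations (ν : Module.Dual k T.h) : Set (SuperEnv k (g ⊗[k] A)) :=
  {u | ∃ x ∈ T.nPlus, u = envOne k A x} ∪
  {u | ∃ x : T.h, u = envOne k A (x : g) - algebraMap k _ (ν x)} ∪
  {u | ∃ α ∈ T.simpleRootsR, ∃ (x y : g) (h : T.h) (m : ℕ), T.IsTriple α x y h ∧ ν h = m ∧
    u = envOne k A y ^ (m + 1)}

variable (A) in
/-- The left ideal of `U(g ⊗ A)` generated by the relations of `K(ν)`. -/
def kacIdeal (ν : Module.Dual k T.h) :
    Submodule (SuperEnv k (g ⊗[k] A)) (SuperMod.regular k (g ⊗[k] A)) :=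
  Submodule.span (SuperEnv k (g ⊗[k] A)) (kacRelations T A ν)

theorem envParity_envOne (x : g) :
    envParity k (g ⊗[k] A) (envOne k A x) = envOne k A (parity (k := k) x) := by
  simp [envOne, envParity_ι, parity_tmul]

theorem parity_mem_kacIdeal (ν : Module.Dual k T.h) :
    ∀ u ∈ kacIdeal T A ν, (SuperMod.regular k (g ⊗[k] A)).parity u ∈ kacIdeal T A ν := by
  refine parity_mem_span (SuperMod.regular k (g ⊗[k] A)) (kacRelations T A ν) fun u hu ↦ ?_
  change envParity k (g ⊗[k] A) u ∈ _
  refine Submodule.subset_span ?_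
  rcases hu with (⟨x, hx, rfl⟩ | ⟨x, rfl⟩) | ⟨α, hα, x, y, h, m, ht, hm, rfl⟩
  · exact Or.inl (Or.inl ⟨_, T.parity_mem_nPlus hx, envParity_envOne x⟩)
  · refine Or.inl (Or.inr ⟨x, ?_⟩)
    rw [map_sub, envParity_envOne, AlgHom.commutes,
      TriangularDecomposition.parity_eq_of_even (T.h_even x.2)]
  · refine Or.inr ⟨α, hα, x, y, h, m, ht, hm, ?_⟩
    rw [map_pow, envParity_envOne,
      TriangularDecomposition.parity_eq_of_even (T.r_even ht.y_mem.2)]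

variable (A) in
/-- The `g ⊗ A`-module `P_A(K(ν))` induced from the generalized Kac module `K(ν)`. Since `K(ν)` is
the quotient of `U(g)` by the left ideal generated by its relations, `P_A(K(ν))` is the quotient of
`U(g ⊗ A)` by the left ideal generated by the same relations. -/
def inducedKac (ν : Module.Dual k T.h) : SuperMod k (g ⊗[k] A) :=
  (SuperMod.regular k (g ⊗[k] A)).quot (kacIdeal T A ν) (parity_mem_kacIdeal T ν)

variable (A) in
/-- The global Weyl module `W_A(ν) = P_A(K(ν))^ν`. -/
def globalWeyl (ν : Module.Dual k T.h) : SuperMod k (g ⊗[k] A) := trunc T (inducedKac T A ν) ν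

variable (A) in
/-- The generator `p_ν` of `P_A(K(ν))`. -/
def inducedKacGen (ν : Module.Dual k T.h) : inducedKac T A ν :=
  (kacIdeal T A ν).mkQ (1 : SuperEnv k (g ⊗[k] A))

variable (A) in
/-- The generator `w_ν` of `W_A(ν)`. -/
def weylGen (ν : Module.Dual k T.h) : globalWeyl T A ν :=
  (truncSubmodule T (inducedKac T A ν) ν).mkQ (inducedKacGen T A ν)

/-! ### The algebra `𝐀_ν` and its modules -/

variable (A) in
/-- `U(𝔥 ⊗ A)`, identified with the subalgebra of `U(g ⊗ A)` generated by `𝔥 ⊗ A`. -/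
abbrev cartanEnv : Subalgebra k (SuperEnv k (g ⊗[k] A)) :=
  Algebra.adjoin k {u | ∃ x ∈ T.h, ∃ a : A, u = envι k (x ⊗ₜ[k] a)}

theorem envι_comm {x y : g} (hx : x ∈ T.h) (hy : y ∈ T.h) (a b : A) :
    envι k (x ⊗ₜ[k] a) * envι k (y ⊗ₜ[k] b) = envι k (y ⊗ₜ[k] b) * envι k (x ⊗ₜ[k] a) := by
  rw [envι_mul k (tmul_mem_part (T.h_even hx) a) (tmul_mem_part (T.h_even hy) b),
    sbracket_tmul, T.sbracket_h hx hy]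
  simp [superSign]

theorem cartanEnv_mul_comm (u v : cartanEnv T A) : u * v = v * u := by
  have := Algebra.isMulCommutative_adjoin k
    (s := {u : SuperEnv k (g ⊗[k] A) | ∃ x ∈ T.h, ∃ a : A, u = envι k (x ⊗ₜ[k] a)}) (by
      rintro _ ⟨x, hx, a, rfl⟩ _ ⟨y, hy, b, rfl⟩
      exact envι_comm T hx hy a b)
  exact this.is_comm.comm u v

instance cartanEnvCommRing : CommRing (cartanEnv T A) :=
  { (inferInstance : Ring (cartanEnv T A)) with mul_comm := cartanEnv_mul_comm T }

variable (A) in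
/-- The annihilator of `w_ν` in `U(𝔥 ⊗ A)`. -/
def cartanAnn (ν : Module.Dual k T.h) : Ideal (cartanEnv T A) where
  carrier := {u | (u : SuperEnv k (g ⊗[k] A)) • weylGen T A ν = 0}
  zero_mem' := by simp
  add_mem' {u v} hu hv := by
    simp only [Set.mem_ofPred_eq] at *
    change ((u : SuperEnv k (g ⊗[k] A)) + (v : SuperEnv k (g ⊗[k] A))) • weylGen T A ν = 0
    rw [add_smul, hu, hv, add_zero]
  smul_mem' c u hu := by
    simp only [Set.mem_ofPred_eq] at *
    change ((c : SuperEnv k (g ⊗[k] A)) * (u : SuperEnv k (g ⊗[k] A))) • weylGen T A ν = 0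
    rw [mul_smul, hu, smul_zero]

variable (A) in
/-- The commutative algebra `𝐀_ν = U(𝔥 ⊗ A) / Ann(w_ν)`. -/
abbrev weylAlg (ν : Module.Dual k T.h) : Type u := cartanEnv T A ⧸ cartanAnn T A ν

variable (A) in
/-- A `ℤ/2`-graded module over the (purely even) algebra `𝐀_ν`. -/
structure AMod (ν : Module.Dual k T.h) : Type (u + 1) where
  carrier : Type u
  [addCommGroup : AddCommGroup carrier]
  [moduleField : Module k carrier]
  [moduleAlg : Module (weylAlg T A ν) carrier]
  [tower : IsScalarTower k (weylAlg T A ν) carrier]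
  parity : carrier →ₗ[k] carrier
  parity_parity : ∀ m, parity (parity m) = m
  parity_smul : ∀ (a : weylAlg T A ν) (m : carrier), parity (a • m) = a • parity m

attribute [instance] AMod.addCommGroup AMod.moduleField AMod.moduleAlg AMod.tower

/-! ### The universal property of `w_ν` and the functor `𝐑` -/

theorem envOne_mul_envOne {x y : g} (hx : x ∈ part k g 0) (hy : y ∈ part k g 0) :
    envOne k A x * envOne k A y - envOne k A y * envOne k A x =
      envOne k A (sbracket (k := k) x y) := by
  have h := envι_mul k (tmul_mem_part hx (1 : A)) (tmul_mem_part hy (1 : A))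
  rw [sbracket_tmul, mul_one] at h
  simp only [envOne, LinearMap.comp_apply, LinearMap.flip_apply, TensorProduct.mk_apply]
  rw [h]
  simp [superSign]

theorem exists_finite_stable {M : SuperMod k (g ⊗[k] A)} (hM : FinitelySemisimple r M) (m : M) :
    ∃ S : Submodule k M, IsStable r S ∧ Module.Finite k S ∧ m ∈ S := by
  have hm : m ∈ (⊤ : Submodule k M) := trivial
  rw [← hM, sSup_eq_iSup'] at hm
  refine Submodule.iSup_induction _
    (motive := fun m ↦ ∃ S : Submodule k M, IsStable r S ∧ Module.Finite k S ∧ m ∈ S) hm ?_ ?_ ?_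
  · exact fun S m hm ↦ ⟨S, S.2.1, S.2.2.1, hm⟩
  · exact ⟨⊥, fun x _ m hm ↦ by simp [(Submodule.mem_bot k).1 hm], inferInstance, by simp⟩
  · rintro m n ⟨S, hS, hf, hm⟩ ⟨S', hS', hf', hn⟩
    refine ⟨S ⊔ S', fun x hx z hz ↦ ?_, inferInstance,
      add_mem (Submodule.mem_sup_left hm) (Submodule.mem_sup_right hn)⟩
    obtain ⟨a, ha, b, hb, rfl⟩ := Submodule.mem_sup.1 hz
    rw [smul_add]
    exact add_mem (Submodule.mem_sup_left (hS x hx a ha)) (Submodule.mem_sup_right (hS' x hx b hb))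

theorem weightSpace_eq_bot {ν : Module.Dual k T.h} (M : CatObj T A ν) {μ : Module.Dual k T.h}
    (h : ¬ T.WLe μ ν) {m : M.obj} (hm : m ∈ weightSpace T M.obj μ) : m = 0 := by
  have h1 : m ∈ truncSubmodule T M.obj ν :=
    Submodule.mem_iSup_of_mem μ (Submodule.mem_iSup_of_mem h (Submodule.subset_span hm))
  rwa [M.trunc_eq, Submodule.mem_bot] at h1

theorem rootSpace_smul_eq_zero {ν : Module.Dual k T.h} (M : CatObj T A ν) {v : M.obj}
    (hv : v ∈ weightSpace T M.obj ν) {α : Module.Dual k T.h} (hα : α ∈ T.posRoots) {x : g}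
    (hx : x ∈ rootSpace T.h α) (a : A) : envι k (x ⊗ₜ[k] a) • v = 0 := by
  refine weightSpace_eq_bot T M (T.not_wLe_add hα ν) fun y ↦ ?_
  have key : envOne k A (y : g) * envι k (x ⊗ₜ[k] a) =
      envι k (x ⊗ₜ[k] a) * envOne k A (y : g) + α y • envι k (x ⊗ₜ[k] a) := by
    have hy := T.h_even y.2
    have hpar : ∀ i : ZMod 2, ∀ z ∈ part k g i,
        envOne k A (y : g) * envι k (z ⊗ₜ[k] a) =
          envι k (z ⊗ₜ[k] a) * envOne k A (y : g) +
            envι k (sbracket (k := k) (y : g) z ⊗ₜ[k] a) := by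
      intro i z hz
      have h := envι_mul k (tmul_mem_part hy (1 : A)) (tmul_mem_part hz a)
      rw [sbracket_tmul, one_mul] at h
      simpa [envOne, superSign] using h
    have hb : envι k (sbracket (k := k) (y : g) x ⊗ₜ[k] a) = α y • envι k (x ⊗ₜ[k] a) := by
      rw [mem_rootSpace.1 hx y, ← TensorProduct.smul_tmul', map_smul]
    obtain ⟨p, q, hp, hq, hpq⟩ : ∃ p q : g, p ∈ part k g 0 ∧ q ∈ part k g 1 ∧ x = p + q := by
      refine ⟨(2⁻¹ : k) • (x + parity (k := k) x), (2⁻¹ : k) • (x - parity (k := k) x),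
        Submodule.smul_mem _ _ ?_, Submodule.smul_mem _ _ ?_, ?_⟩
      · rw [mem_superPart]; simp [parity_parity, add_comm]
      · rw [mem_superPart]; simp [parity_parity, ZMod.val_one]
      · rw [← smul_add, add_add_sub_cancel, ← two_smul k x, smul_smul,
          inv_mul_cancel₀ two_ne_zero, one_smul]
    rw [← hb, hpq, TensorProduct.add_tmul, map_add, mul_add, hpar 0 p hp, hpar 1 q hq, map_add,
      TensorProduct.add_tmul, map_add, add_mul]
    abel
  rw [← mul_smul, key, add_smul, mul_smul, hv y, smul_comm, smul_assoc, LinearMap.add_apply,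
    add_smul]

theorem nPlus_smul_eq_zero {ν : Module.Dual k T.h} (M : CatObj T A ν) {v : M.obj}
    (hv : v ∈ weightSpace T M.obj ν) {x : g} (hx : x ∈ T.nPlus) : envOne k A x • v = 0 := by
  let f : g →ₗ[k] M.obj :=
    { toFun := fun x ↦ envOne k A x • v
      map_add' := fun x y ↦ by rw [map_add, add_smul]
      map_smul' := fun c x ↦ by rw [map_smul, smul_assoc]; rfl }
  have : T.nPlus ≤ LinearMap.ker f :=
    iSup₂_le fun α hα x hx ↦ rootSpace_smul_eq_zero T M hv hα hx 1
  exact this hx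

theorem pow_smul_eq_zero {M : SuperMod k (g ⊗[k] A)} (hM : FinitelySemisimple r M)
    {α : Module.Dual k T.h} {x y : g} {h : T.h} (ht : T.IsTriple α x y h) {v : M} {m : ℕ}
    (hx : envOne k A x • v = 0) (hh : envOne k A (h : g) • v = (m : k) • v) :
    envOne k A y ^ (m + 1) • v = 0 := by
  obtain ⟨S, hS, hf, hv⟩ := exists_finite_stable hM v
  let act : ∀ z ∈ r, Module.End k S := fun z hz ↦
    { toFun := fun s ↦ ⟨envOne k A z • (s : M), hS z hz s s.2⟩
      map_add' := fun s t ↦ Subtype.ext (smul_add _ _ _)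
      map_smul' := fun c s ↦ Subtype.ext (smul_comm _ _ _) }
  let _ : LieRing (Module.End k S) := LieRing.ofAssociativeRing
  let _ : LieAlgebra k (Module.End k S) := LieAlgebra.ofAssociativeAlgebra
  have hact : ∀ z hz (s : S), ((act z hz s : S) : M) = envOne k A z • (s : M) :=
    fun _ _ _ ↦ rfl
  have hbr : ∀ z hz w hw, ∀ s : S, (((⁅act z hz, act w hw⁆ : Module.End k S) s : S) : M) =
      envOne k A (sbracket (k := k) z w) • (s : M) := by
    intro z hz w hw s
    rw [← envOne_mul_envOne (T.r_even hz) (T.r_even hw), Ring.lie_def]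
    simp only [LinearMap.sub_apply, Module.End.mul_apply, Submodule.coe_sub, hact, sub_smul,
      mul_smul]
  have hxr : x ∈ r := ht.x_mem.2
  have hyr : y ∈ r := ht.y_mem.2
  have hhr : (h : g) ∈ r := T.h_le h.2
  have hEF : ⁅act x hxr, act y hyr⁆ = act h hhr := by
    ext s
    rw [hbr x hxr y hyr s, ht.xy, hact h hhr s]
  have hHE : ⁅act h hhr, act x hxr⁆ = 2 • act x hxr := by
    ext s
    rw [hbr h hhr x hxr s, ht.hx, map_smul, smul_assoc, ofNat_smul_eq_nsmul]
    rfl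
  have hHF : ⁅act h hhr, act y hyr⁆ = -(2 • act y hyr) := by
    ext s
    rw [hbr h hhr y hyr s, ht.hy, map_neg, map_smul, neg_smul, smul_assoc, ofNat_smul_eq_nsmul]
    rfl
  generalize hE : act x hxr = E at *
  generalize hF : act y hyr = F at *
  generalize hH : act h hhr = H at *
  have hpow : ∀ n, (((F ^ n) ⟨v, hv⟩ : S) : M) = envOne k A y ^ n • v := by
    intro n
    induction n with
    | zero => simp
    | succ n ih =>
      rw [pow_succ', Module.End.mul_apply, ← hF, hact y hyr, hF, ih, pow_succ', mul_smul]
  rw [← hpow]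
  by_cases hv0 : v = 0
  · subst hv0
    have : (⟨0, hv⟩ : S) = 0 := rfl
    rw [this, map_zero]
    rfl
  by_cases hH0 : H = 0
  · have : F = 0 := by
      rw [hH0, zero_lie, eq_comm, neg_eq_zero] at hHF
      ext s
      have h2 := congrArg Subtype.val (LinearMap.congr_fun hHF s)
      rw [LinearMap.smul_apply, ← ofNat_smul_eq_nsmul k] at h2
      simpa using h2
    simp [this]
  have t : IsSl2Triple H E F := ⟨hH0, hEF, hHE, hHF⟩
  have P : t.HasPrimitiveVectorWith (⟨v, hv⟩ : S) (m : k) :=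
    { ne_zero := fun h0 ↦ hv0 (congrArg Subtype.val h0)
      lie_h := by rw [← hH]; exact Subtype.ext hh
      lie_e := by rw [← hE]; exact Subtype.ext hx }
  have := P.pow_toEnd_f_eq_zero_of_eq_nat rfl
  rw [LieModule.toEnd_module_end] at this
  exact congrArg Subtype.val this

/-- The weight space `M_ν` of an object `M` of `C_A^ν` is annihilated by `Ann(w_ν)`. -/
theorem smul_eq_zero_of_smul_weylGen {ν : Module.Dual k T.h} (M : CatObj T A ν) {v : M.obj}
    (hv : v ∈ weightSpace T M.obj ν) {u : SuperEnv k (g ⊗[k] A)}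
    (hu : u • weylGen T A ν = 0) : u • v = 0 := by
  let f : SuperEnv k (g ⊗[k] A) →ₗ[SuperEnv k (g ⊗[k] A)] M.obj := LinearMap.toSpanSingleton _ _ v
  have hf : kacIdeal T A ν ≤ LinearMap.ker f := by
    refine Submodule.span_le.2 ?_
    rintro u ((⟨x, hx, rfl⟩ | ⟨x, rfl⟩) | ⟨α, hα, x, y, h, m, ht, hm, rfl⟩)
    · exact nPlus_smul_eq_zero T M hv hx
    · change (_ - _ : SuperEnv k (g ⊗[k] A)) • v = 0
      rw [sub_smul, hv x, algebraMap_smul, sub_self]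
    · refine pow_smul_eq_zero T M.finitelySemisimple ht
        (rootSpace_smul_eq_zero T M hv hα.1.1 ht.x_mem.1 1) ?_
      rw [hv h, hm]
  let F : inducedKac T A ν →ₗ[SuperEnv k (g ⊗[k] A)] M.obj := (kacIdeal T A ν).liftQ f hf
  have hF : truncSubmodule T (inducedKac T A ν) ν ≤ LinearMap.ker F := by
    refine iSup₂_le fun μ hμ ↦ Submodule.span_le.2 fun p hp ↦ ?_
    refine weightSpace_eq_bot T M hμ fun x ↦ ?_
    rw [← map_smul, hp x]
    exact (F.restrictScalars k).map_smul _ _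
  have h1 : u • inducedKacGen T A ν ∈ truncSubmodule T (inducedKac T A ν) ν := by
    exact (Submodule.Quotient.mk_eq_zero _).1 hu
  have h2 : F (u • inducedKacGen T A ν) = 0 := hF h1
  rw [map_smul] at h2
  have h3 : F (inducedKacGen T A ν) = v := by
    change f 1 = v
    simp [f]
  rwa [h3] at h2

/-- The weight space `M_ν`, as a module over `U(𝔥 ⊗ A)`. -/
def cartanWeight (M : SuperMod k (g ⊗[k] A)) (ν : Module.Dual k T.h) :
    Submodule (cartanEnv T A) M where
  carrier := weightSpace T M ν
  zero_mem' := zero_mem _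
  add_mem' := add_mem
  smul_mem' u m hm x := by
    have hx : envOne k A (x : g) ∈ cartanEnv T A := Algebra.subset_adjoin ⟨x, x.2, 1, rfl⟩
    have hc := congrArg Subtype.val (cartanEnv_mul_comm T ⟨_, hx⟩ u)
    change envOne k A (x : g) * (u : SuperEnv k (g ⊗[k] A)) =
      (u : SuperEnv k (g ⊗[k] A)) * envOne k A (x : g) at hc
    change envOne k A (x : g) • (u : SuperEnv k (g ⊗[k] A)) • m =
      ν x • (u : SuperEnv k (g ⊗[k] A)) • m
    rw [← mul_smul, hc, mul_smul, hm x, smul_comm]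

theorem cartanWeight_torsion {ν : Module.Dual k T.h} (M : CatObj T A ν) :
    Module.IsTorsionBySet (cartanEnv T A) (cartanWeight T M.obj ν)
      (cartanAnn T A ν : Set (cartanEnv T A)) :=
  fun v u ↦ Subtype.ext (smul_eq_zero_of_smul_weylGen T M v.2 u.2)

theorem envParity_cartanEnv (u : cartanEnv T A) :
    envParity k (g ⊗[k] A) u = (u : SuperEnv k (g ⊗[k] A)) := by
  obtain ⟨u, hu⟩ := u
  change envParity k (g ⊗[k] A) u = u
  induction hu using Algebra.adjoin_induction with
  | mem u hu =>
    obtain ⟨x, hx, a, rfl⟩ := hu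
    rw [envParity_ι, parity_tmul, TriangularDecomposition.parity_eq_of_even (T.h_even hx)]
  | algebraMap c => exact AlgHom.commutes _ c
  | add u v _ _ hu hv => rw [map_add, hu, hv]
  | mul u v _ _ hu hv => rw [map_mul, hu, hv]

/-- The `𝐀_ν`-module structure on the weight space `M_ν` of an object `M` of `C_A^ν`. -/
@[reducible] def weightModule {ν : Module.Dual k T.h} (M : CatObj T A ν) :
    Module (weylAlg T A ν) (cartanWeight T M.obj ν) := (cartanWeight_torsion T M).module

/-- The functor `𝐑`, sending an object `M` of `C_A^ν` to the `𝐀_ν`-module `M_ν`. -/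
def resFunctor {ν : Module.Dual k T.h} (M : CatObj T A ν) : AMod T A ν where
  carrier := cartanWeight T M.obj ν
  moduleAlg := weightModule T M
  tower := (cartanWeight_torsion T M).isScalarTower (S := k)
  parity := (M.obj.parity.restrict (p := weightSpace T M.obj ν) (q := weightSpace T M.obj ν)
    fun m hm ↦ parity_mem_weightSpace T M.obj hm)
  parity_parity := fun m ↦ Subtype.ext (M.obj.parity_parity m)
  parity_smul := by
    intro a m
    obtain ⟨a, rfl⟩ := Ideal.Quotient.mk_surjective a
    refine Subtype.ext ?_
    change M.obj.parity ((a : SuperEnv k (g ⊗[k] A)) • (m : M.obj)) =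
      (a : SuperEnv k (g ⊗[k] A)) • M.obj.parity (m : M.obj)
    rw [M.obj.parity_smul, envParity_cartanEnv]

/-! ### The Weyl functor -/

/-- The tensor product `W_A(ν) ⊗ V` over the base field. -/
def tensorMod {ν : Module.Dual k T.h} (V : AMod T A ν) : SuperMod k (g ⊗[k] A) where
  carrier := (globalWeyl T A ν).carrier ⊗[k] V.carrier
  parity := TensorProduct.map (globalWeyl T A ν).parity V.parity
  parity_parity t := by
    induction t using TensorProduct.induction_on with
    | zero => simp
    | tmul w v => simp [SuperMod.parity_parity, AMod.parity_parity]
    | add s t hs ht => rw [map_add, map_add, hs, ht]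
  parity_smul a t := by
    induction t using TensorProduct.induction_on with
    | zero => simp
    | tmul w v => simp [TensorProduct.smul_tmul', SuperMod.parity_smul]
    | add s t hs ht => rw [smul_add, map_add, map_add, hs, ht, smul_add]

/-- The relations `x · u ⊗ v = x ⊗ u v`, for `x ∈ W_A(ν)`, `u ∈ 𝐀_ν` and `v ∈ V`, where the right
action of `𝐀_ν` on `W_A(ν)` is given by `(a w_ν) · u = a u w_ν` for `a ∈ U(g ⊗ A)`. -/
def balanced {ν : Module.Dual k T.h} (V : AMod T A ν) :
    Submodule (SuperEnv k (g ⊗[k] A)) (tensorMod T V) :=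
  Submodule.span (SuperEnv k (g ⊗[k] A))
    {t | ∃ (a : SuperEnv k (g ⊗[k] A)) (u : cartanEnv T A) (v : V.carrier),
      t = ((a * (u : SuperEnv k (g ⊗[k] A))) • weylGen T A ν) ⊗ₜ[k] v -
        (a • weylGen T A ν) ⊗ₜ[k] ((Ideal.Quotient.mk (cartanAnn T A ν) u : weylAlg T A ν) • v)}

theorem parity_weylGen (ν : Module.Dual k T.h) :
    (globalWeyl T A ν).parity (weylGen T A ν) = weylGen T A ν := by
  change (globalWeyl T A ν).parity ((truncSubmodule T (inducedKac T A ν) ν).mkQ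
    ((kacIdeal T A ν).mkQ (1 : SuperEnv k (g ⊗[k] A)))) = _
  change (truncSubmodule T (inducedKac T A ν) ν).mkQ
    ((kacIdeal T A ν).mkQ (envParity k (g ⊗[k] A) 1)) = _
  rw [map_one]
  rfl

theorem parity_mem_balanced {ν : Module.Dual k T.h} (V : AMod T A ν) :
    ∀ t ∈ balanced T V, (tensorMod T V).parity t ∈ balanced T V := by
  refine parity_mem_span (tensorMod T V) _ ?_
  rintro _ ⟨a, u, v, rfl⟩
  refine Submodule.subset_span ⟨envParity k (g ⊗[k] A) a, u, V.parity v, ?_⟩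
  change TensorProduct.map (globalWeyl T A ν).parity V.parity _ = _
  rw [map_sub, TensorProduct.map_tmul, TensorProduct.map_tmul, SuperMod.parity_smul,
    SuperMod.parity_smul, map_mul, envParity_cartanEnv, parity_weylGen, AMod.parity_smul]

/-- The Weyl functor `𝐖`, sending an `𝐀_ν`-module `V` to `W_A(ν) ⊗_{𝐀_ν} V`. -/
def weylFunctor {ν : Module.Dual k T.h} (V : AMod T A ν) : SuperMod k (g ⊗[k] A) :=
  (tensorMod T V).quot (balanced T V) (parity_mem_balanced T V)

end Weyl

end

end WeylSuper

/-! The proof is the standard adjunction argument for `𝐖` and `𝐑`, once enough is known about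
modules over the reductive part `r`.

A module `𝐖 V` is generated by the vectors `w_ν ⊗ v`, all of weight `ν`, and satisfies a universal
property: an even `𝐀_ν`-linear map from `V` to `M_ν` extends to a homomorphism `𝐖 V → M` for every
object `M` (`exists_weylLift`). If `N_ν = 0`, then `Hom(𝐖 V, N) = 0` because the generators have
nowhere to go. In an extension `E` of `𝐖 V` by `N`, the map `E_ν → (𝐖 V)_ν` is bijective, so its
inverse composed with `V → (𝐖 V)_ν` extends to a section `𝐖 V → E` (`exists_section`). Hence all
extensions are split, and so equivalent.

Conversely, consider the counit `ε : 𝐖 𝐑 M → M`. Its image contains `M_ν`, so its cokernel has no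
weight `ν`, and the vanishing of `Hom` makes `ε` surjective. The weight space `(𝐖 V)_ν` is just the
image of `V` (`mem_range_weylUnit`), on which `ε` is injective for `V = 𝐑 M`. So the kernel `K`
satisfies `K_ν = 0`, and the vanishing of `Ext¹(M, K)` splits off `K` as a quotient of `𝐖 𝐑 M`. As
there are no nonzero maps `𝐖 𝐑 M → K`, the kernel vanishes (`exists_iso_of_ext`).

The labour lies in showing that the modules used here belong to the category: it must be closed
under submodules, quotients and finite direct sums, and must contain `𝐖 V`. This follows from the
criterion `finitelySemisimple_iff`: a module is finitely semisimple over `r` exactly when it is a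
sum of weight spaces and every vector lies in a finite-dimensional `r`-submodule. The criterion
rests on Weyl's theorem in the form `IsSplit.complementedLattice`, for Lie algebras with a root
space decomposition in which every root vector belongs to an `sl(2)`-triple; such algebras may have
a centre, which is why diagonalizability under the Cartan subalgebra is assumed of the modules.
Local finiteness of `𝐖 V` needs to be checked only on generators, where it is the finiteness of
integrable highest weight modules (`exists_finite_lieSubmodule`).

That `r` has the required triples is proved in `exists_isSplit`. If `g` is simple with reductive
even part, complements of ideals are used. For `sl(n, n)` and the Cartan types there is a faithful
representation with nondegenerate trace form: the natural one for `sl(n, n)`, and `kⁿ`, the degree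
one part of the Grassmann algebra, for the Cartan types. -/

namespace WeylSuper

/-! ### Simultaneous eigenspaces -/

section JointEigenspace

variable {k H V V' : Type*} [Field k] [AddCommGroup H] [Module k H] [AddCommGroup V] [Module k V]
  [AddCommGroup V'] [Module k V']

/-- The simultaneous eigenspace of a linear family of operators. -/
def jointEig (ρ : H →ₗ[k] Module.End k V) (μ : Module.Dual k H) : Submodule k V :=
  ⨅ y : H, LinearMap.ker (ρ y - μ y • LinearMap.id)

theorem mem_jointEig {ρ : H →ₗ[k] Module.End k V} {μ : Module.Dual k H} {v : V} :
    v ∈ jointEig ρ μ ↔ ∀ y, ρ y v = μ y • v := by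
  simp [jointEig, sub_eq_zero]

/-- The family `ρ` is simultaneously diagonalizable. -/
def IsDiag (ρ : H →ₗ[k] Module.End k V) : Prop := ⨆ μ, jointEig ρ μ = ⊤

/-- Stable subspaces contain the weight components of their elements. If `μ ≠ ν` differ at `y`, the
operator `ρ y - ν y` removes the component of weight `ν` and rescales that of weight `μ` by a
nonzero number, so induction on the number of weights applies. -/
theorem mem_of_sum_mem {ρ : H →ₗ[k] Module.End k V} {W : Submodule k V}
    (hW : ∀ y, ∀ w ∈ W, ρ y w ∈ W) (s : Finset (Module.Dual k H)) :
    ∀ v : Module.Dual k H → V, (∀ μ ∈ s, v μ ∈ jointEig ρ μ) → ∑ μ ∈ s, v μ ∈ W →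
      ∀ μ ∈ s, v μ ∈ W := by
  classical
  induction s using Finset.induction_on with
  | empty => simp
  | insert ν s hν ih =>
    intro v hv hsum
    have key : ∀ μ ∈ s, v μ ∈ W := by
      intro μ hμ
      have hne : μ ≠ ν := fun h ↦ hν (h ▸ hμ)
      obtain ⟨y, hy⟩ : ∃ y, μ y ≠ ν y := by
        by_contra! h
        exact hne (LinearMap.ext h)
      have h1 : ∑ μ ∈ s, (μ y - ν y) • v μ ∈ W := by
        have h2 : ρ y (∑ μ ∈ insert ν s, v μ) - ν y • (∑ μ ∈ insert ν s, v μ) ∈ W :=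
          W.sub_mem (hW y _ hsum) (W.smul_mem _ hsum)
        convert h2 using 1
        rw [Finset.sum_insert hν, map_add, smul_add,
          mem_jointEig.1 (hv ν (Finset.mem_insert_self _ _)) y, add_sub_add_left_eq_sub, map_sum,
          Finset.smul_sum, ← Finset.sum_sub_distrib]
        refine Finset.sum_congr rfl fun μ hμ ↦ ?_
        rw [mem_jointEig.1 (hv μ (Finset.mem_insert_of_mem hμ)) y, sub_smul]
      have h3 := ih (fun μ ↦ (μ y - ν y) • v μ)
        (fun μ hμ ↦ Submodule.smul_mem _ _ (hv μ (Finset.mem_insert_of_mem hμ))) h1 μ hμ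
      exact (W.smul_mem_iff (sub_ne_zero.2 hy)).1 h3
    intro μ hμ
    rcases Finset.mem_insert.1 hμ with rfl | hμ
    · rw [Finset.sum_insert hν] at hsum
      exact (W.add_mem_iff_left (W.sum_mem key)).1 hsum
    · exact key μ hμ

theorem IsDiag.exists_sum {ρ : H →ₗ[k] Module.End k V} (hρ : IsDiag ρ) (v : V) :
    ∃ (s : Finset (Module.Dual k H)) (c : Module.Dual k H → V),
      (∀ μ, c μ ∈ jointEig ρ μ) ∧ ∑ μ ∈ s, c μ = v := by
  have hv : v ∈ ⨆ μ, jointEig ρ μ := by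
    rw [IsDiag] at hρ
    simp [hρ]
  obtain ⟨f, hf, rfl⟩ := (Submodule.mem_iSup_iff_exists_finsupp _ _).1 hv
  exact ⟨f.support, f, hf, rfl⟩

theorem IsDiag.exists_sum_of_mem {ρ : H →ₗ[k] Module.End k V} (hρ : IsDiag ρ) {W : Submodule k V}
    (hW : ∀ y, ∀ w ∈ W, ρ y w ∈ W) {v : V} (hv : v ∈ W) :
    ∃ (s : Finset (Module.Dual k H)) (c : Module.Dual k H → V),
      (∀ μ ∈ s, c μ ∈ jointEig ρ μ ∧ c μ ∈ W) ∧ ∑ μ ∈ s, c μ = v := by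
  obtain ⟨s, c, hc, rfl⟩ := hρ.exists_sum v
  exact ⟨s, c, fun μ hμ ↦ ⟨hc μ, mem_of_sum_mem hW s c (fun μ _ ↦ hc μ) hv μ hμ⟩, rfl⟩

theorem isDiag_of_le {ρ : H →ₗ[k] Module.End k V} (h : ∀ v, v ∈ ⨆ μ, jointEig ρ μ) : IsDiag ρ :=
  eq_top_iff.2 fun v _ ↦ h v

theorem IsDiag.of_injective {ρ : H →ₗ[k] Module.End k V} {ρ' : H →ₗ[k] Module.End k V'}
    (hρ : IsDiag ρ) (f : V' →ₗ[k] V) (hf : Function.Injective f)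
    (hc : ∀ y v, f (ρ' y v) = ρ y (f v)) : IsDiag ρ' := by
  refine isDiag_of_le fun v ↦ ?_
  have hW : ∀ y, ∀ w ∈ LinearMap.range f, ρ y w ∈ LinearMap.range f := by
    rintro y _ ⟨w, rfl⟩
    exact ⟨ρ' y w, hc y w⟩
  obtain ⟨s, c, hs, hv⟩ := hρ.exists_sum_of_mem hW ⟨v, rfl⟩
  choose! d hd using fun μ hμ ↦ (hs μ hμ).2
  have : v = ∑ μ ∈ s, d μ := hf (by
    rw [← hv, map_sum]
    exact Finset.sum_congr rfl fun μ hμ ↦ (hd μ hμ).symm)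
  rw [this]
  refine Submodule.sum_mem _ fun μ hμ ↦ Submodule.mem_iSup_of_mem μ (mem_jointEig.2 fun y ↦ hf ?_)
  rw [hc, hd μ hμ, map_smul, hd μ hμ, mem_jointEig.1 (hs μ hμ).1]

theorem map_mem_jointEig {ρ : H →ₗ[k] Module.End k V} {ρ' : H →ₗ[k] Module.End k V'}
    {f : V →ₗ[k] V'} (hc : ∀ y v, f (ρ y v) = ρ' y (f v)) {μ : Module.Dual k H} {v : V}
    (hv : v ∈ jointEig ρ μ) : f v ∈ jointEig ρ' μ :=
  mem_jointEig.2 fun y ↦ by rw [← hc, mem_jointEig.1 hv, map_smul]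

theorem IsDiag.of_surjective {ρ : H →ₗ[k] Module.End k V} {ρ' : H →ₗ[k] Module.End k V'}
    (hρ : IsDiag ρ) (f : V →ₗ[k] V') (hf : Function.Surjective f)
    (hc : ∀ y v, f (ρ y v) = ρ' y (f v)) : IsDiag ρ' := by
  refine isDiag_of_le fun v ↦ ?_
  obtain ⟨v, rfl⟩ := hf v
  obtain ⟨s, c, hs, rfl⟩ := hρ.exists_sum v
  rw [map_sum]
  exact Submodule.sum_mem _ fun μ _ ↦ Submodule.mem_iSup_of_mem μ (map_mem_jointEig hc (hs μ))

/-- If a sum of weight vectors is a weight vector of weight `ν`, it is its own component. -/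
theorem sum_eq_of_mem_jointEig {ρ : H →ₗ[k] Module.End k V} {s : Finset (Module.Dual k H)}
    {c : Module.Dual k H → V} (hc : ∀ μ, c μ ∈ jointEig ρ μ) {ν : Module.Dual k H}
    (h : ∑ μ ∈ s, c μ ∈ jointEig ρ ν) :
    (ν ∈ s ∧ ∑ μ ∈ s, c μ = c ν) ∨ (ν ∉ s ∧ ∑ μ ∈ s, c μ = 0) := by
  classical
  set x := ∑ μ ∈ s, c μ with hx
  have hbot : ∀ y, ∀ w ∈ (⊥ : Submodule k V), ρ y w ∈ (⊥ : Submodule k V) := by simp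
  -- Subtracting `x` from the component of weight `ν` gives a family of weight vectors with sum
  -- zero, so every member of it vanishes.
  set d : Module.Dual k H → V := fun μ ↦ (if μ ∈ s then c μ else 0) - (if μ = ν then x else 0)
  have hd : ∀ μ ∈ insert ν s, d μ ∈ jointEig ρ μ := by
    intro μ _
    refine Submodule.sub_mem _ ?_ ?_
    · split_ifs
      exacts [hc μ, zero_mem _]
    · split_ifs with h1
      exacts [h1 ▸ h, zero_mem _]
  have hsum : ∑ μ ∈ insert ν s, d μ ∈ (⊥ : Submodule k V) := by
    rw [Submodule.mem_bot, Finset.sum_sub_distrib, Finset.sum_ite_mem,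
      Finset.inter_eq_right.2 (Finset.subset_insert _ _), Finset.sum_ite_eq',
      if_pos (Finset.mem_insert_self _ _), ← hx, sub_self]
  have h0 := (Submodule.mem_bot k).1
    (mem_of_sum_mem hbot _ d hd hsum ν (Finset.mem_insert_self _ _))
  by_cases hν : ν ∈ s
  · exact Or.inl ⟨hν, (sub_eq_zero.1 (by simpa [d, hν] using h0)).symm⟩
  · exact Or.inr ⟨hν, by simpa [d, hν] using h0⟩

/-- The component of weight `μ` of any preimage of a vector of weight `μ` is again a preimage. This
is what makes the passage to weight spaces exact. -/
theorem IsDiag.exists_preimage {ρ : H →ₗ[k] Module.End k V} {ρ' : H →ₗ[k] Module.End k V'}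
    (hρ : IsDiag ρ) {f : V →ₗ[k] V'} (hc : ∀ y v, f (ρ y v) = ρ' y (f v))
    {μ : Module.Dual k H} {v : V} (hv : f v ∈ jointEig ρ' μ) : ∃ w ∈ jointEig ρ μ, f w = f v := by
  obtain ⟨s, c, hs, rfl⟩ := hρ.exists_sum v
  rw [map_sum] at hv ⊢
  rcases sum_eq_of_mem_jointEig (c := fun μ ↦ f (c μ)) (fun μ ↦ map_mem_jointEig hc (hs μ)) hv
    with ⟨_, h⟩ | ⟨_, h⟩
  · exact ⟨c μ, hs μ, h.symm⟩
  · exact ⟨0, zero_mem _, by rw [h, map_zero]⟩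

theorem eq_zero_of_mem_iSup {ρ : H →ₗ[k] Module.End k V} {P : Module.Dual k H → Prop}
    {ν : Module.Dual k H} (hν : ¬ P ν) {v : V} (hv : v ∈ jointEig ρ ν)
    (hv' : v ∈ ⨆ (μ) (_ : P μ), jointEig ρ μ) : v = 0 := by
  classical
  rw [iSup_subtype'] at hv'
  obtain ⟨f, hf, rfl⟩ := (Submodule.mem_iSup_iff_exists_finsupp _ _).1 hv'
  set c : Module.Dual k H → V := fun μ ↦ if hμ : P μ then f ⟨μ, hμ⟩ else 0
  have hc : ∀ μ, c μ ∈ jointEig ρ μ := fun μ ↦ by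
    by_cases hμ : P μ
    · simpa [c, hμ] using hf ⟨μ, hμ⟩
    · simp [c, hμ]
  have hsum : (f.sum fun _ x ↦ x) = ∑ μ ∈ f.support.map (Function.Embedding.subtype P), c μ := by
    rw [Finset.sum_map]
    exact Finset.sum_congr rfl fun μ _ ↦ by simp [c, μ.2]
  rw [hsum] at hv ⊢
  rcases sum_eq_of_mem_jointEig hc hv with ⟨h, _⟩ | ⟨_, h⟩
  · obtain ⟨μ, _, rfl⟩ := Finset.mem_map.1 h
    exact absurd μ.2 hν
  · exact h

/-- A finite-dimensional space has finitely many weights. -/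
theorem finite_jointEig_ne_bot [FiniteDimensional k V] (ρ : H →ₗ[k] Module.End k V) :
    {μ | jointEig ρ μ ≠ ⊥}.Finite := by
  have hind : iSupIndep (jointEig ρ) := by
    intro μ
    rw [disjoint_iff, Submodule.eq_bot_iff]
    rintro v ⟨hv, hv'⟩
    exact eq_zero_of_mem_iSup (P := (· ≠ μ)) (fun h ↦ h rfl) hv hv'
  exact WellFoundedGT.finite_ne_bot_of_iSupIndep hind

end JointEigenspace

end WeylSuper

namespace WeylSuper

open Module LieModule

/-! ### Casimir operators -/

section Casimir

variable {k U : Type*} [Field k] [AddCommGroup U] [Module k U] [FiniteDimensional k U]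

/-- The Casimir operator of a Lie algebra of operators whose trace form is nondegenerate. -/
theorem exists_casimir (S : Submodule k (End k U)) (hS : ∀ a ∈ S, ∀ b ∈ S, a * b - b * a ∈ S)
    (nd : ∀ a ∈ S, (∀ b ∈ S, LinearMap.trace k U (a * b) = 0) → a = 0) :
    ∃ Ω ∈ Submodule.span k {c | ∃ a ∈ S, ∃ b ∈ S, c = a * b},
      (∀ a ∈ S, a * Ω = Ω * a) ∧ LinearMap.trace k U Ω = finrank k S := by
  classical
  let B : LinearMap.BilinForm k S :=
    ((LinearMap.mul k (End k U)).compr₂ (LinearMap.trace k U)).domRestrict₁₂ S S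
  have hB : ∀ a b : S, B a b = LinearMap.trace k U ((a : End k U) * b) := fun _ _ ↦ rfl
  have hsymm : ∀ a b, B a b = B b a := fun a b ↦ by rw [hB, hB, LinearMap.trace_mul_comm]
  have hnd : B.Nondegenerate := by
    have hl : B.SeparatingLeft := fun a ha ↦
      Subtype.ext (nd a a.2 fun b hb ↦ ha ⟨b, hb⟩)
    exact ⟨hl, fun a ha ↦ hl a fun b ↦ by rw [hsymm, ha]⟩
  let b := finBasis k S
  let b' := B.dualBasis hnd b
  have hb' : ∀ i j, B (b' i) (b j) = if j = i then 1 else 0 :=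
    LinearMap.BilinForm.apply_dualBasis_left hnd b
  refine ⟨∑ i, (b i : End k U) * b' i, Submodule.sum_mem _ fun i _ ↦
    Submodule.subset_span ⟨_, (b i).2, _, (b' i).2, rfl⟩, fun a ha ↦ ?_, ?_⟩
  · let ad : S → S := fun s ↦ ⟨a * s - s * a, hS a ha s s.2⟩
    -- Cyclicity of the trace makes `ad` skew with respect to `B`.
    have hinv : ∀ s t, B (ad s) t = - B s (ad t) := by
      intro s t
      simp only [hB, ad, sub_mul, mul_sub, map_sub]
      rw [mul_assoc a, LinearMap.trace_mul_comm k a, mul_assoc, mul_assoc]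
      abel
    have h1 : ∀ s : S, s = ∑ j, B (b' j) s • b j := by
      intro s
      apply b'.ext_elem
      intro j
      rw [LinearMap.BilinForm.dualBasis_repr_apply, LinearMap.BilinForm.dualBasis_repr_apply]
      congr 2
      conv_lhs => rw [← b.sum_repr s]
      refine Finset.sum_congr rfl fun i _ ↦ ?_
      congr 1
      conv_rhs => rw [← b.sum_repr s]
      rw [map_sum, Finset.sum_eq_single i]
      · simp [hb']
      · intro j _ hj
        simp [hb', hj]
      · simp
    have h2 : ∀ s : S, s = ∑ j, B s (b j) • b' j := by
      intro s
      conv_lhs => rw [← b'.sum_repr s]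
      exact Finset.sum_congr rfl fun j _ ↦ by rw [LinearMap.BilinForm.dualBasis_repr_apply]
    have h3 : ∀ i, a * b i - b i * a = ∑ j, B (b' j) (ad (b i)) • (b j : End k U) := by
      intro i
      have := congrArg (Subtype.val) (h1 (ad (b i)))
      simpa [ad] using this
    have h4 : ∀ i, a * b' i - b' i * a = ∑ j, B (ad (b' i)) (b j) • (b' j : End k U) := by
      intro i
      have := congrArg (Subtype.val) (h2 (ad (b' i)))
      simpa [ad] using this
    rw [← sub_eq_zero, Finset.mul_sum, Finset.sum_mul, ← Finset.sum_sub_distrib]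
    -- Both commutators are expanded in the dual bases. By skewness the two double sums have the
    -- same terms with `i` and `j` exchanged, so they cancel after summation over `i`.
    have h5 : ∀ i, a * (b i * b' i) - b i * b' i * a =
        (∑ j, B (b' j) (ad (b i)) • ((b j : End k U) * b' i)) -
          ∑ j, B (b' i) (ad (b j)) • ((b i : End k U) * b' j) := by
      intro i
      have : a * (b i * b' i) - b i * b' i * a =
          (a * b i - b i * a) * b' i + b i * (a * b' i - b' i * a) := by noncomm_ring
      rw [this, h3, h4, Finset.sum_mul, Finset.mul_sum, sub_eq_add_neg, ← Finset.sum_neg_distrib]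
      simp only [hinv, smul_mul_assoc, mul_smul_comm, neg_smul, mul_neg]
    simp only [h5, Finset.sum_sub_distrib]
    rw [Finset.sum_comm, sub_self]
  · rw [map_sum]
    have : ∀ i, LinearMap.trace k U ((b i : End k U) * b' i) = 1 := fun i ↦ by
      rw [LinearMap.trace_mul_comm, ← hB, hb', if_pos rfl]
    simp [this]

end Casimir

/-! ### Weight vectors and `sl(2)`-triples -/

section Sl2

variable {k L V : Type*} [Field k] [CharZero k] [LieRing L] [LieAlgebra k L] [AddCommGroup V]
  [Module k V] [LieRingModule L V] [LieModule k L V]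

/-- Let `q = e ^ a p` be the last nonzero power; it is primitive of weight `c + 2a`. If `f ^ n q` is
the last nonzero vector below it, then `0 = e f ^ (n + 1) q = (n + 1)(c + 2a - n) f ^ n q`
determines `c`. -/
theorem sl2_weight_aux {h e f : L} (t : IsSl2Triple h e f) {p : V} (hp : p ≠ 0) {c : k}
    (hc : ⁅h, p⁆ = c • p) (he : ∃ n : ℕ, (toEnd k L V e ^ n) p = 0)
    (hf : ∀ q : V, ∃ n : ℕ, (toEnd k L V f ^ n) q = 0) :
    ∃ n a : ℕ, c = n - 2 * a ∧ ∀ j ≤ n, (toEnd k L V f ^ j) ((toEnd k L V e ^ a) p) ≠ 0 := by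
  obtain ⟨a, ha, ha'⟩ := Nat.exists_not_and_succ_of_not_zero_of_exists
    (p := fun n ↦ (toEnd k L V e ^ n) p = 0) (by simpa using hp) he
  set q := (toEnd k L V e ^ a) p with hq
  have hw : ∀ n : ℕ, ⁅h, (toEnd k L V e ^ n) p⁆ = (c + 2 * n) • (toEnd k L V e ^ n) p := by
    intro n
    induction n with
    | zero => simpa using hc
    | succ n ih =>
      rw [pow_succ', Module.End.mul_apply, toEnd_apply_apply, leibniz_lie, t.lie_h_e_smul k, ih,
        lie_smul, smul_lie, ← add_smul]
      congr 1
      push_cast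
      ring
  have P : t.HasPrimitiveVectorWith q (c + 2 * a) :=
    { ne_zero := ha
      lie_h := hw a
      lie_e := by
        rw [← ha', pow_succ', Module.End.mul_apply, toEnd_apply_apply, hq] }
  obtain ⟨n, hn, hn'⟩ := Nat.exists_not_and_succ_of_not_zero_of_exists
    (p := fun n ↦ (toEnd k L V f ^ n) q = 0) (by simpa using ha) (hf q)
  have hcn : c + 2 * a = n := by
    have := P.lie_e_pow_succ_toEnd_f n
    rw [hn', lie_zero, eq_comm, smul_eq_zero_iff_left hn, mul_eq_zero, sub_eq_zero] at this
    exact this.resolve_left (Nat.cast_add_one_ne_zero n)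
  refine ⟨n, a, by rw [← hcn]; ring, fun j hj h0 ↦ hn ?_⟩
  rw [← Nat.sub_add_cancel hj, pow_add, Module.End.mul_apply, h0, map_zero]

/-- The weights of a locally finite representation of an `sl(2)`-triple are integers, and are
symmetric. -/
theorem sl2_weight {h e f : L} (t : IsSl2Triple h e f) {p : V} (hp : p ≠ 0) {c : k}
    (hc : ⁅h, p⁆ = c • p) (he : ∀ q : V, ∃ n : ℕ, (toEnd k L V e ^ n) q = 0)
    (hf : ∀ q : V, ∃ n : ℕ, (toEnd k L V f ^ n) q = 0) :
    ∃ a b : ℕ, c = b - a ∧ ((toEnd k L V f ^ b) ((toEnd k L V e ^ a) p) ≠ 0 ∨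
      (toEnd k L V e ^ a) ((toEnd k L V f ^ b) p) ≠ 0) := by
  obtain ⟨n, a, hna, h1⟩ := sl2_weight_aux t hp hc (he p) hf
  rcases le_total a n with hle | hle
  · exact ⟨a, n - a, by rw [hna]; push_cast [hle]; ring, Or.inl (h1 _ (Nat.sub_le _ _))⟩
  -- When `n ≤ a`, the opposite triple is used instead; comparing the two expressions for `c` gives
  -- `n + n' = 2a + 2a'`, hence `a' ≤ n'`.
  · have hc' : ⁅-h, p⁆ = (-c) • p := by rw [neg_lie, hc, neg_smul]
    obtain ⟨n', a', hna', h2⟩ := sl2_weight_aux t.symm hp hc' (hf p) he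
    have h3 : n + n' = 2 * a + 2 * a' := by
      have : (n : k) + n' = 2 * a + 2 * a' := by linear_combination (-1 : k) * hna' - hna
      exact_mod_cast this
    have h4 : a' ≤ n' := by omega
    refine ⟨n' - a', a', ?_, Or.inr (h2 _ (Nat.sub_le _ _))⟩
    push_cast [h4]
    linear_combination (-1 : k) * hna'

end Sl2

/-! ### Weights of Lie modules, nilpotency of root vectors, and split Cartan subalgebras. -/

section Weights

variable {k L V : Type*} [Field k] [LieRing L] [LieAlgebra k L] [AddCommGroup V]
  [Module k V] [LieRingModule L V] [LieModule k L V]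

variable (V) in
/-- The operators on `V` defined by the elements of `H`. -/
def opRep (H : Submodule k L) : H →ₗ[k] End k V where
  toFun y := toEnd k L V y
  map_add' _ _ := LinearMap.ext fun _ ↦ add_lie _ _ _
  map_smul' _ _ := LinearMap.ext fun _ ↦ smul_lie _ _ _

@[simp] theorem opRep_apply (H : Submodule k L) (y : H) (v : V) : opRep V H y v = ⁅(y : L), v⁆ := rfl

theorem mem_weight {H : Submodule k L} {μ : Dual k H} {v : V} :
    v ∈ jointEig (opRep V H) μ ↔ ∀ y : H, ⁅(y : L), v⁆ = μ y • v := by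
  simp [mem_jointEig]

theorem lie_mem_weight {H : Submodule k L} {α μ : Dual k H} {x : L} {v : V}
    (hx : x ∈ jointEig (opRep L H) α) (hv : v ∈ jointEig (opRep V H) μ) :
    ⁅x, v⁆ ∈ jointEig (opRep V H) (α + μ) := by
  rw [mem_weight] at *
  intro y
  rw [leibniz_lie, hx, hv, smul_lie, lie_smul, LinearMap.add_apply, add_smul]

theorem pow_mem_weight {H : Submodule k L} {α μ : Dual k H} {x : L} {v : V}
    (hx : x ∈ jointEig (opRep L H) α) (hv : v ∈ jointEig (opRep V H) μ) (n : ℕ) :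
    (toEnd k L V x ^ n) v ∈ jointEig (opRep V H) (n • α + μ) := by
  induction n with
  | zero => simpa using hv
  | succ n ih =>
    rw [pow_succ', Module.End.mul_apply, toEnd_apply_apply, succ_nsmul', add_assoc]
    exact lie_mem_weight hx ih

/-- A root vector moves weights along the string `n • α + μ`; once the string leaves the set of
weights, the vector has been killed. -/
theorem isNilpotent_of_forall_weight {H : Submodule k L} (hV : IsDiag (opRep V H)) {α : Dual k H}
    {x : L} (hx : x ∈ jointEig (opRep L H) α)
    (h : ∀ μ, ∃ n : ℕ, jointEig (opRep V H) (n • α + μ) = ⊥) (q : V) :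
    ∃ n : ℕ, (toEnd k L V x ^ n) q = 0 := by
  obtain ⟨s, c, hc, rfl⟩ := hV.exists_sum q
  choose n hn using h
  refine ⟨s.sup n, ?_⟩
  rw [map_sum]
  refine Finset.sum_eq_zero fun μ hμ ↦ ?_
  rw [← Nat.sub_add_cancel (Finset.le_sup (f := n) hμ), pow_add, Module.End.mul_apply,
    (Submodule.eq_bot_iff _).1 (hn μ) _ (pow_mem_weight hx (hc μ) _), map_zero]

/-- In characteristic zero the weights `n • α + μ` are pairwise distinct, so only finitely many of
them can occur. -/
theorem isNilpotent_of_weight [CharZero k] {H : Submodule k L}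
    (hV : IsDiag (opRep V H)) (hfin : {μ | jointEig (opRep V H) μ ≠ ⊥}.Finite) {α : Dual k H}
    (hα : α ≠ 0) {x : L} (hx : x ∈ jointEig (opRep L H) α) (q : V) :
    ∃ n : ℕ, (toEnd k L V x ^ n) q = 0 := by
  refine isNilpotent_of_forall_weight hV hx (fun μ ↦ ?_) q
  by_contra! h
  have hinj : Function.Injective fun n : ℕ ↦ n • α + μ := by
    intro m n hmn
    obtain ⟨y, hy⟩ : ∃ y, α y ≠ 0 := by
      by_contra! h
      exact hα (LinearMap.ext h)
    have := LinearMap.congr_fun (add_right_cancel hmn) y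
    rw [LinearMap.smul_apply, LinearMap.smul_apply, nsmul_eq_mul, nsmul_eq_mul] at this
    exact_mod_cast mul_right_cancel₀ hy this
  refine Set.infinite_range_of_injective hinj (hfin.subset ?_)
  rintro _ ⟨n, rfl⟩
  exact h n

/-- A diagonalizable space has a basis of weight vectors. -/
theorem IsDiag.exists_basis {H W : Type*} [AddCommGroup H] [Module k H] [AddCommGroup W]
    [Module k W] {ρ : H →ₗ[k] End k W} (hρ : IsDiag ρ) :
    ∃ (ι : Set W) (b : Basis ι k W) (wt : ι → Dual k H), ∀ i, b i ∈ jointEig ρ (wt i) := by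
  have hs : ⊤ ≤ Submodule.span k (⋃ μ, (jointEig ρ μ : Set W)) := by
    rw [Submodule.span_iUnion]
    simp only [Submodule.span_eq]
    exact hρ.ge
  have hmem := Basis.ofSpan_subset hs
  have : ∀ i, ∃ μ, Basis.ofSpan hs i ∈ jointEig ρ μ := fun i ↦
    Set.mem_iUnion.1 (hmem ⟨i, rfl⟩)
  choose wt hwt using this
  exact ⟨_, _, wt, hwt⟩

/-- `H` is a Cartan subalgebra of `L` with respect to which `L` has a root space decomposition, and
every root vector belongs to an `sl(2)`-triple. -/
structure IsSplit (H : Submodule k L) : Prop where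
  lie_eq_zero : ∀ x ∈ H, ∀ y ∈ H, ⁅x, y⁆ = 0
  diag : IsDiag (opRep L H)
  zero_le : jointEig (opRep L H) 0 ≤ H
  exists_coroot : ∀ α ≠ 0, ∀ e ∈ jointEig (opRep L H) α, e ≠ 0 →
    ∃ f ∈ jointEig (opRep L H) (-α), ∃ c : H, ⁅e, f⁆ = (c : L) ∧ α c ≠ 0

theorem IsSplit.exists_triple [CharZero k] {H : Submodule k L} (hH : IsSplit H) {α : Dual k H}
    (hα : α ≠ 0) {e : L} (he : e ∈ jointEig (opRep L H) α) (he0 : e ≠ 0) :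
    ∃ f ∈ jointEig (opRep L H) (-α), ∃ c : H, IsSl2Triple (c : L) e f ∧ α c = 2 := by
  obtain ⟨f, hf, c, hc, hα⟩ := hH.exists_coroot α hα e he he0
  have h2 : α ((2 / α c) • c) = 2 := by
    rw [map_smul, smul_eq_mul, div_mul_cancel₀ _ hα]
  -- The factor `2 / α c` normalises the bracket `[e, f]` to the element on which `α` takes the
  -- value `2`.
  refine ⟨(2 / α c) • f, Submodule.smul_mem _ _ hf, (2 / α c) • c, ⟨?_, ?_, ?_, ?_⟩, h2⟩
  · intro h
    rw [Submodule.coe_eq_zero] at h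
    rw [h, map_zero] at h2
    exact two_ne_zero h2.symm
  · rw [lie_smul, hc]
    rfl
  · rw [mem_weight.1 he, h2, ofNat_smul_eq_nsmul]
  · rw [lie_smul, mem_weight.1 hf, LinearMap.neg_apply, h2, ← ofNat_smul_eq_nsmul k, neg_smul,
      smul_neg, smul_comm]

end Weights

end WeylSuper

namespace WeylSuper

open Module LieModule

/-! ### Complete reducibility via Casimir operators. -/

section Weyl

variable {k L : Type*} [Field k] [LieRing L] [LieAlgebra k L]

theorem trace_eq_sum_of_basis {U ι : Type*} [AddCommGroup U] [Module k U] [Fintype ι]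
    (b : Basis ι k U) (φ : End k U) (c : ι → k) (h : ∀ i, φ (b i) = c i • b i) :
    LinearMap.trace k U φ = ∑ i, c i := by
  classical
  rw [LinearMap.trace_eq_matrix_trace k b, Matrix.trace]
  refine Finset.sum_congr rfl fun i _ ↦ ?_
  rw [Matrix.diag_apply, LinearMap.toMatrix_apply, h, map_smul, Finsupp.smul_apply, b.repr_self,
    Finsupp.single_eq_same, smul_eq_mul, mul_one]

/-- The neutral element of an `sl(2)`-triple acts by zero if its trace form with itself is zero. -/
theorem IsSl2Triple.lie_eq_zero_of_trace [CharZero k] {U : Type*} [AddCommGroup U] [Module k U]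
    [FiniteDimensional k U] [LieRingModule L U] [LieModule k L U] {H : Submodule k L}
    (hU : IsDiag (opRep U H)) {c : H} {e f : L} (t : IsSl2Triple (c : L) e f)
    (he : ∀ q : U, ∃ n : ℕ, (toEnd k L U e ^ n) q = 0)
    (hf : ∀ q : U, ∃ n : ℕ, (toEnd k L U f ^ n) q = 0)
    (h0 : traceForm k L U (c : L) (c : L) = 0) (u : U) : ⁅(c : L), u⁆ = 0 := by
  obtain ⟨ι, b, wt, hb⟩ := hU.exists_basis
  have := FiniteDimensional.fintypeBasisIndex b
  have hc : ∀ i, ⁅(c : L), b i⁆ = wt i c • b i := fun i ↦ mem_weight.1 (hb i) c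
  have hint : ∀ i, ∃ m : ℤ, wt i c = m := by
    intro i
    obtain ⟨a, d, h, -⟩ := sl2_weight t (b.ne_zero i) (hc i) he hf
    exact ⟨d - a, by rw [h]; push_cast; rfl⟩
  choose m hm using hint
  rw [traceForm_apply_apply, trace_eq_sum_of_basis b _ (fun i ↦ wt i c * wt i c)] at h0
  -- The eigenvalues are integers by `sl2_weight`, so the trace of the square is a sum of integer
  -- squares, which vanishes only if every eigenvalue does.
  · have h1 : ∑ i, m i * m i = 0 := by
      simp only [hm] at h0
      exact_mod_cast h0
    have h2 : ∀ i, m i = 0 := fun i ↦ by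
      have := (Finset.sum_eq_zero_iff_of_nonneg fun i _ ↦ mul_self_nonneg (m i)).1 h1 i
        (Finset.mem_univ _)
      exact mul_self_eq_zero.1 this
    have h3 : toEnd k L U c = 0 := b.ext fun i ↦ by
      rw [toEnd_apply_apply, hc, hm, h2, Int.cast_zero, zero_smul, LinearMap.zero_apply]
    exact LinearMap.congr_fun h3 u
  · intro i
    rw [LinearMap.comp_apply, toEnd_apply_apply, toEnd_apply_apply, hc, lie_smul, hc, smul_smul]

/-- Schur's lemma. -/
theorem exists_smul_of_commute [IsAlgClosed k] {U : Type*} [AddCommGroup U] [Module k U]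
    [FiniteDimensional k U] [LieRingModule L U] [LieModule k L U] {W : LieSubmodule k L U}
    (hW : ∀ N ≤ W, N = ⊥ ∨ N = W) (φ : End k U) (hφ : ∀ (x : L) (u : U), φ ⁅x, u⁆ = ⁅x, φ u⁆)
    (hφW : ∀ u ∈ W, φ u ∈ W) : ∃ c : k, ∀ w ∈ W, φ w = c • w := by
  by_cases h0 : W = ⊥
  · exact ⟨0, fun w hw ↦ by rw [h0, LieSubmodule.mem_bot] at hw; simp [hw]⟩
  have : Nontrivial W := (LieSubmodule.nontrivial_iff_ne_bot k L U).2 h0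
  obtain ⟨c, hc⟩ := Module.End.exists_eigenvalue (φ.restrict hφW)
  obtain ⟨w, hw, hw0⟩ := hc.exists_hasEigenvector
  rw [Module.End.mem_eigenspace_iff] at hw
  let N : LieSubmodule k L U :=
    { toSubmodule := (W : Submodule k U) ⊓ LinearMap.ker (φ - c • LinearMap.id)
      lie_mem := by
        rintro x u ⟨hu, hu'⟩
        have h1 : φ u = c • u := by simpa [sub_eq_zero] using hu'
        refine ⟨W.lie_mem hu, ?_⟩
        change (φ - c • (LinearMap.id : End k U)) ⁅x, u⁆ = 0
        simp [hφ, h1] }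
  have hN : N = W := by
    refine (hW N fun u hu ↦ hu.1).resolve_left fun hbot ↦ hw0 ?_
    have : (w : U) ∈ N := ⟨w.2, by
      change (φ - c • (LinearMap.id : End k U)) (w : U) = 0
      have := congrArg Subtype.val hw
      simpa [sub_eq_zero] using this⟩
    rw [hbot, LieSubmodule.mem_bot] at this
    exact Subtype.ext this
  refine ⟨c, fun w hw ↦ ?_⟩
  rw [← hN] at hw
  simpa [sub_eq_zero] using hw.2

variable {H : Submodule k L}

/-- If `c ≠ 0`, then `c⁻¹ • φ` is a projection onto `W`. If `c = 0`, then `φ` squares to zero and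
has trace zero. -/
theorem trace_proj {U : Type*} [AddCommGroup U] [Module k U] [FiniteDimensional k U]
    {W : Submodule k U} {φ : End k U} (hφ : ∀ u, φ u ∈ W) {c : k} (hc : ∀ w ∈ W, φ w = c • w) :
    LinearMap.trace k U φ = c * finrank k W := by
  by_cases h0 : c = 0
  · have : IsNilpotent φ := ⟨2, LinearMap.ext fun u ↦ by
      rw [pow_two, Module.End.mul_apply, hc _ (hφ u), h0, zero_smul, LinearMap.zero_apply]⟩
    rw [(LinearMap.isNilpotent_trace_of_isNilpotent this).eq_zero, h0, zero_mul]
  · have hp : LinearMap.IsProj W (c⁻¹ • φ) :=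
      ⟨fun u ↦ W.smul_mem _ (hφ u), fun w hw ↦ by
        rw [LinearMap.smul_apply, hc w hw, smul_smul, inv_mul_cancel₀ h0, one_smul]⟩
    have := hp.trace
    rw [map_smul, smul_eq_mul] at this
    rw [← this, mul_inv_cancel_left₀ h0]

/-- The kernel of the trace form is the kernel of the action. -/
theorem IsSplit.lie_eq_zero_of_traceForm [CharZero k] [IsAlgClosed k] (hH : IsSplit H) {U : Type*}
    [AddCommGroup U] [Module k U] [FiniteDimensional k U] [LieRingModule L U] [LieModule k L U]
    (hU : IsDiag (opRep U H)) {W : LieSubmodule k L U} (hW : ∀ N ≤ W, N = ⊥ ∨ N = W)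
    (hLU : ∀ (x : L) (u : U), ⁅x, u⁆ ∈ W) {x : L} (hx : ∀ y, traceForm k L U x y = 0) (u : U) :
    ⁅x, u⁆ = 0 := by
  have hfin := finite_jointEig_ne_bot (opRep U H)
  set J : Submodule k L := LinearMap.ker (traceForm k L U)
  have hJ : ∀ x : L, ∀ y ∈ J, ⁅x, y⁆ ∈ J := by
    intro x y hy
    rw [LinearMap.mem_ker] at hy ⊢
    ext z
    rw [traceForm_apply_lie_apply', hy]
    simp
  -- The coroot of a root vector in the ideal `J` is itself orthogonal to everything, hence acts by
  -- zero; then so does `2e = [c, e]`.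
  have hroot : ∀ α ≠ 0, ∀ e ∈ jointEig (opRep L H) α, e ∈ J → ∀ u : U, ⁅e, u⁆ = 0 := by
    intro α hα e he heJ u
    by_cases he0 : e = 0
    · rw [he0, zero_lie]
    obtain ⟨f, hf, c, t, -⟩ := hH.exists_triple hα he he0
    have h0 : ∀ u : U, ⁅(c : L), u⁆ = 0 := by
      refine IsSl2Triple.lie_eq_zero_of_trace hU t (isNilpotent_of_weight hU hfin hα he)
        (isNilpotent_of_weight hU hfin (neg_ne_zero.2 hα) hf) ?_
      conv_lhs => enter [1]; rw [← t.lie_e_f]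
      rw [traceForm_apply_lie_apply, LinearMap.mem_ker.1 heJ, LinearMap.zero_apply]
    have h2 : (2 : k) • ⁅e, u⁆ = 0 := by
      rw [← smul_lie, ← t.lie_h_e_smul k, lie_lie, h0, h0, lie_zero, sub_zero]
    exact (smul_eq_zero_iff_right two_ne_zero).1 h2
  -- An element of `J` of weight zero commutes with the action of `L`, because its brackets with
  -- root vectors are root vectors in `J`, which act by zero. Schur's lemma makes it a scalar on
  -- `W`.
  have hzero : ∀ x ∈ jointEig (opRep L H) 0, x ∈ J → ∀ u : U, ⁅x, u⁆ = 0 := by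
    intro x hx hxJ
    have hxH := hH.zero_le hx
    have hcomm : ∀ (y : L) (u : U), ⁅x, ⁅y, u⁆⁆ = ⁅y, ⁅x, u⁆⁆ := by
      intro y
      obtain ⟨s, c, hc, rfl⟩ := hH.diag.exists_sum y
      intro u
      rw [sum_lie, lie_sum, sum_lie]
      refine Finset.sum_congr rfl fun α _ ↦ ?_
      rw [leibniz_lie, add_eq_right]
      by_cases hα : α = 0
      · rw [hH.lie_eq_zero x hxH _ (hH.zero_le (hα ▸ hc α)), zero_lie]
      · refine hroot α hα _ ?_ ?_ u
        · rw [mem_weight.1 (hc α) ⟨x, hxH⟩]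
          exact Submodule.smul_mem _ _ (hc α)
        · rw [← lie_skew]
          exact J.neg_mem (hJ _ _ hxJ)
    obtain ⟨c, hc⟩ := exists_smul_of_commute hW (toEnd k L U x) hcomm fun u hu ↦ W.lie_mem hu
    have hx2 : ∀ u : U, ⁅x, ⁅x, u⁆⁆ = c • ⁅x, u⁆ := fun u ↦ hc _ (hLU x u)
    by_cases hW0 : W = ⊥
    · intro u
      have := hLU x u
      rwa [hW0, LieSubmodule.mem_bot] at this
    -- As `x` maps `U` to `W` and acts there by `c`, the trace of `x²` on `U` is `c² dim W`, which
    -- is zero since `x` lies in `J`.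
    have hc0 : c = 0 := by
      have h1 : traceForm k L U x x = c * (c * finrank k W) := by
        rw [traceForm_apply_apply, show toEnd k L U x ∘ₗ toEnd k L U x = c • toEnd k L U x from
          LinearMap.ext hx2, map_smul, smul_eq_mul,
          trace_proj (W := (W : Submodule k U)) (φ := toEnd k L U x) (hLU x) hc]
        rfl
      rw [LinearMap.mem_ker.1 hxJ, LinearMap.zero_apply] at h1
      have h2 : (finrank k W : k) ≠ 0 := by
        have : Nontrivial W := (LieSubmodule.nontrivial_iff_ne_bot k L U).2 hW0
        exact_mod_cast (finrank_pos (R := k) (M := W)).ne'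
      simpa [h2] using h1
    -- Now `x² = 0` on `U`, and `x` acts diagonalizably, so it acts by zero.
    intro u
    obtain ⟨s, d, hd, rfl⟩ := hU.exists_sum u
    rw [lie_sum]
    refine Finset.sum_eq_zero fun μ _ ↦ ?_
    have h1 := hx2 (d μ)
    have h2 : ⁅x, d μ⁆ = μ ⟨x, hxH⟩ • d μ := mem_weight.1 (hd μ) ⟨x, hxH⟩
    rw [h2, lie_smul, h2, hc0, zero_smul, smul_smul] at h1
    rw [h2]
    rcases smul_eq_zero.1 h1 with h | h
    · rw [mul_self_eq_zero.1 h, zero_smul]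
    · rw [h, smul_zero]
  obtain ⟨s, c, hc, rfl⟩ := hH.diag.exists_sum_of_mem (W := J) (fun y w hw ↦ hJ y w hw)
    (LinearMap.mem_ker.2 (LinearMap.ext hx) : x ∈ J)
  rw [sum_lie]
  refine Finset.sum_eq_zero fun α hα ↦ ?_
  by_cases h : α = 0
  · exact hzero _ (h ▸ (hc α hα).1) (h ▸ (hc α hα).2) u
  · exact hroot α h _ (hc α hα).1 (hc α hα).2 u

/-- If `L` maps `U` to a simple submodule `W` then `U` is the sum of `W` and the invariants. -/
theorem IsSplit.exists_invariant_of_simple [CharZero k] [IsAlgClosed k] (hH : IsSplit H) {U : Type*}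
    [AddCommGroup U] [Module k U] [FiniteDimensional k U] [LieRingModule L U] [LieModule k L U]
    (hU : IsDiag (opRep U H)) {W : LieSubmodule k L U} (hW : ∀ N ≤ W, N = ⊥ ∨ N = W)
    (hLU : ∀ (x : L) (u : U), ⁅x, u⁆ ∈ W) (u : U) : ∃ w ∈ W, ∀ x : L, ⁅x, u - w⁆ = 0 := by
  -- The Casimir operator is formed in the image of `L`, on which the trace form is nondegenerate
  -- even if the action is not faithful.
  let S : Submodule k (End k U) :=
    { carrier := Set.range (toEnd k L U)
      zero_mem' := ⟨0, map_zero _⟩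
      add_mem' := by
        rintro _ _ ⟨x, rfl⟩ ⟨y, rfl⟩
        exact ⟨x + y, map_add _ _ _⟩
      smul_mem' := by
        rintro c _ ⟨x, rfl⟩
        exact ⟨c • x, map_smul _ _ _⟩ }
  have hS : ∀ a ∈ S, ∀ b ∈ S, a * b - b * a ∈ S := by
    rintro _ ⟨x, rfl⟩ _ ⟨y, rfl⟩
    exact ⟨⁅x, y⁆, LinearMap.ext fun u ↦ lie_lie x y u⟩
  obtain ⟨Ω, hΩS, hcomm, htr⟩ := exists_casimir S hS (by
    rintro _ ⟨x, rfl⟩ h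
    exact LinearMap.ext fun u ↦ hH.lie_eq_zero_of_traceForm hU hW hLU
      (fun y ↦ h _ ⟨y, rfl⟩) u)
  have hΩ : ∀ u, Ω u ∈ W := by
    intro u
    have : Submodule.span k {c | ∃ a ∈ S, ∃ b ∈ S, c = a * b} ≤
        (W : Submodule k U).comap (LinearMap.applyₗ u) := by
      refine Submodule.span_le.2 ?_
      rintro _ ⟨_, ⟨x, rfl⟩, _, ⟨y, rfl⟩, rfl⟩
      exact hLU x _
    exact this hΩS
  have hΩc : ∀ (x : L) (u : U), Ω ⁅x, u⁆ = ⁅x, Ω u⁆ := fun x u ↦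
    (LinearMap.congr_fun (hcomm _ ⟨x, rfl⟩) u).symm
  obtain ⟨c, hc⟩ := exists_smul_of_commute hW Ω hΩc fun u _ ↦ hΩ u
  rw [trace_proj (W := (W : Submodule k U)) hΩ hc] at htr
  by_cases h0 : finrank k S = 0
  · refine ⟨0, zero_mem _, fun x ↦ ?_⟩
    rw [Submodule.finrank_eq_zero, Submodule.eq_bot_iff] at h0
    rw [sub_zero]
    exact LinearMap.congr_fun (h0 _ ⟨x, rfl⟩) u
  -- The trace of the Casimir operator is both `c dim W` and `dim S`. Once `c ≠ 0`, the operator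
  -- `c⁻¹ • Ω` is an equivariant projection onto `W`.
  have hc0 : c ≠ 0 := by
    rintro rfl
    rw [zero_mul, eq_comm, Nat.cast_eq_zero] at htr
    exact h0 htr
  refine ⟨c⁻¹ • Ω u, W.smul_mem _ (hΩ u), fun x ↦ ?_⟩
  rw [lie_sub, lie_smul, ← hΩc, hc _ (hLU x u), smul_smul, inv_mul_cancel₀ hc0, one_smul, sub_self]

theorem isDiag_lieSubmodule {U : Type*} [AddCommGroup U] [Module k U] [LieRingModule L U]
    [LieModule k L U] (hU : IsDiag (opRep U H)) (N : LieSubmodule k L U) : IsDiag (opRep N H) :=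
  hU.of_injective (N : Submodule k U).subtype Subtype.val_injective fun _ _ ↦ rfl

theorem isDiag_quotient {U : Type*} [AddCommGroup U] [Module k U] [LieRingModule L U]
    [LieModule k L U] (hU : IsDiag (opRep U H)) (N : LieSubmodule k L U) :
    IsDiag (opRep (U ⧸ N) H) :=
  hU.of_surjective (LieSubmodule.Quotient.mk' N : U →ₗ[k] U ⧸ N)
    (LieSubmodule.Quotient.surjective_mk' N) fun _ _ ↦ rfl

/-- If `L` maps `U` to `W` then `U` is the sum of `W` and the invariants. -/
theorem IsSplit.exists_invariant [CharZero k] [IsAlgClosed k] (hH : IsSplit H) (n : ℕ) {U : Type u}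
    [AddCommGroup U] [Module k U] [FiniteDimensional k U] [LieRingModule L U] [LieModule k L U]
    (hU : IsDiag (opRep U H)) (W : LieSubmodule k L U) (hn : finrank k W = n)
    (hLU : ∀ (x : L) (u : U), ⁅x, u⁆ ∈ W) (u : U) : ∃ w ∈ W, ∀ x : L, ⁅x, u - w⁆ = 0 := by
  induction n using Nat.strong_induction_on generalizing U with
  | _ n ih =>
  by_cases hW : ∀ N ≤ W, N = ⊥ ∨ N = W
  · exact hH.exists_invariant_of_simple hU hW hLU u
  push Not at hW
  -- A proper nonzero submodule `N` of `W` splits the problem into two of smaller dimension: first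
  -- `W / N` inside `U / N`, which corrects `u` by `w ∈ W` modulo `N`; then `N` inside the submodule
  -- `U'` of vectors mapped into `N`.
  obtain ⟨N, hNW, hN0, hNne⟩ := hW
  have hlt : finrank k N < finrank k W :=
    Submodule.finrank_lt_finrank_of_lt (lt_of_le_of_ne hNW fun h ↦
      hNne (LieSubmodule.toSubmodule_injective h))
  let π := LieSubmodule.Quotient.mk' N
  have hπ : ∀ u, π u = 0 ↔ u ∈ N := fun u ↦ LieSubmodule.Quotient.mk_eq_zero' 
  have hlt' : finrank k (W.map π) < finrank k W := by
    have h1 : finrank k (W.map π) = finrank k ((W : Submodule k U).map (π : U →ₗ[k] U ⧸ N)) := rfl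
    rw [h1]
    refine lt_of_le_of_ne (Submodule.finrank_map_le _ _) fun heq ↦ hN0 ?_
    let g := ((π : U →ₗ[k] U ⧸ N).domRestrict (W : Submodule k U)).rangeRestrict
    have h2 : finrank k (LinearMap.ker ((π : U →ₗ[k] U ⧸ N).domRestrict (W : Submodule k U))) =
        0 := by
      have := LinearMap.finrank_range_add_finrank_ker
        ((π : U →ₗ[k] U ⧸ N).domRestrict (W : Submodule k U))
      rw [LinearMap.range_domRestrict, heq] at this
      exact Nat.add_eq_left.1 this
    rw [Submodule.finrank_eq_zero, Submodule.eq_bot_iff] at h2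
    rw [eq_bot_iff]
    intro v hv
    have := h2 ⟨v, hNW hv⟩ ((hπ v).2 hv)
    rw [LieSubmodule.mem_bot]
    exact congrArg Subtype.val this
  obtain ⟨w, hw, h1⟩ := ih _ (hn ▸ hlt') (isDiag_quotient hU N) (W.map π) rfl (by
    intro x v
    obtain ⟨v, rfl⟩ := LieSubmodule.Quotient.surjective_mk' N v
    exact LieSubmodule.mem_map_of_mem (f := π) (hLU x v)) (π u)
  obtain ⟨w, hwW, rfl⟩ := (LieSubmodule.mem_map _).1 hw
  have h2 : ∀ x : L, ⁅x, u - w⁆ ∈ N := by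
    intro x
    rw [← hπ, LieModuleHom.map_lie, map_sub]
    exact h1 x
  let U' : LieSubmodule k L U :=
    { carrier := {v | ∀ x : L, ⁅x, v⁆ ∈ N}
      zero_mem' := fun x ↦ by simp
      add_mem' := fun hv hw x ↦ by rw [lie_add]; exact add_mem (hv x) (hw x)
      smul_mem' := fun c v hv x ↦ by rw [lie_smul]; exact N.smul_mem c (hv x)
      lie_mem := fun {x v} hv y ↦ N.lie_mem (hv x) }
  have hN' : finrank k (N.comap U'.incl) = finrank k N := by
    have hle : (N : Submodule k U) ≤ U' := fun v hv x ↦ N.lie_mem hv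
    exact (Submodule.comapSubtypeEquivOfLe hle).finrank_eq
  obtain ⟨v, hv, h3⟩ := ih _ (hn ▸ hlt) (isDiag_lieSubmodule hU U') (N.comap U'.incl) hN'
    (fun x v ↦ v.2 x) ⟨u - w, h2⟩
  refine ⟨w + v, add_mem hwW (hNW hv), fun x ↦ ?_⟩
  rw [← sub_sub]
  exact congrArg Subtype.val (h3 x)

/-- Functionals dual to a weight basis of `V`, multiplied by weight vectors of `W`, are weight
vectors, and these rank one maps span the space of linear maps. -/
theorem isDiag_hom {V W : Type*} [AddCommGroup V] [Module k V] [FiniteDimensional k V]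
    [LieRingModule L V] [LieModule k L V] [AddCommGroup W] [Module k W] [LieRingModule L W]
    [LieModule k L W] (hV : IsDiag (opRep V H)) (hW : IsDiag (opRep W H)) :
    IsDiag (opRep (V →ₗ[k] W) H) := by
  obtain ⟨ι, b, wt, hb⟩ := hV.exists_basis
  have := FiniteDimensional.fintypeBasisIndex b
  refine isDiag_of_le fun f ↦ ?_
  have hf : f = ∑ i, (b.coord i).smulRight (f (b i)) := by
    refine b.ext fun j ↦ ?_
    rw [LinearMap.sum_apply, Finset.sum_eq_single j]
    · simp
    · intro i _ hij
      simp [b.repr_self, hij.symm]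
    · simp
  rw [hf]
  refine Submodule.sum_mem _ fun i _ ↦ ?_
  obtain ⟨s, c, hc, hs⟩ := hW.exists_sum (f (b i))
  have h1 : (b.coord i).smulRight (f (b i)) = ∑ ν ∈ s, (b.coord i).smulRight (c ν) := by
    ext v
    simp [← hs, Finset.smul_sum]
  rw [h1]
  refine Submodule.sum_mem _ fun ν _ ↦ Submodule.mem_iSup_of_mem (ν - wt i) (mem_weight.2 fun y ↦ ?_)
  refine b.ext fun j ↦ ?_
  rw [LieHom.lie_apply, mem_weight.1 (hb j), map_smul, LinearMap.smulRight_apply,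
    LinearMap.smul_apply, LinearMap.smulRight_apply, lie_smul, mem_weight.1 (hc ν)]
  by_cases hij : j = i
  · subst hij
    simp [sub_smul]
  · simp [hij]

/-- **Weyl's theorem** on complete reducibility. -/
theorem IsSplit.complementedLattice [CharZero k] [IsAlgClosed k] (hH : IsSplit H) {V : Type u}
    [AddCommGroup V] [Module k V] [FiniteDimensional k V] [LieRingModule L V] [LieModule k L V]
    (hV : IsDiag (opRep V H)) : ComplementedLattice (LieSubmodule k L V) := by
  refine ⟨fun W ↦ ?_⟩
  -- In `U`, the maps that are scalar on `W`, the action of `L` lands in `U₀`, the maps that vanish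
  -- on `W`. Correcting a linear projection by an element of `U₀` therefore produces an equivariant
  -- projection onto `W`, whose kernel is the complement.
  let U : LieSubmodule k L (V →ₗ[k] W) :=
    { carrier := {f | ∃ c : k, ∀ w : W, f w = c • w}
      zero_mem' := ⟨0, by simp⟩
      add_mem' := by
        rintro f g ⟨c, hc⟩ ⟨d, hd⟩
        exact ⟨c + d, fun w ↦ by rw [LinearMap.add_apply, hc, hd, add_smul]⟩
      smul_mem' := by
        rintro a f ⟨c, hc⟩
        exact ⟨a * c, fun w ↦ by rw [LinearMap.smul_apply, hc, mul_smul]⟩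
      lie_mem := by
        rintro x f ⟨c, hc⟩
        refine ⟨0, fun w ↦ ?_⟩
        have h1 := hc ⁅x, w⁆
        rw [LieSubmodule.coe_bracket] at h1
        rw [LieHom.lie_apply, hc, h1, lie_smul, sub_self, zero_smul] }
  let U₀ : LieSubmodule k L U :=
    { carrier := {f | ∀ w : W, (f : V →ₗ[k] W) w = 0}
      zero_mem' := fun w ↦ rfl
      add_mem' := fun {f g} hf hg w ↦ by
        change (f : V →ₗ[k] W) w + (g : V →ₗ[k] W) w = 0
        rw [hf, hg, add_zero]
      smul_mem' := fun c f hf w ↦ by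
        change c • (f : V →ₗ[k] W) w = 0
        rw [hf, smul_zero]
      lie_mem := fun {x f} hf w ↦ by
        change ⁅x, (f : V →ₗ[k] W)⁆ (w : V) = 0
        have h1 := hf ⁅x, w⁆
        rw [LieSubmodule.coe_bracket] at h1
        rw [LieHom.lie_apply, hf, h1, lie_zero, sub_zero] }
  have hU : IsDiag (opRep U H) :=
    isDiag_lieSubmodule (isDiag_hom hV (isDiag_lieSubmodule hV W)) U
  obtain ⟨p, hp⟩ := Submodule.exists_isCompl (W : Submodule k V)
  let π : V →ₗ[k] W := (W : Submodule k V).projectionOnto p hp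
  have hπ : ∀ w : W, π w = w := fun w ↦ Submodule.projectionOnto_apply_left hp w
  obtain ⟨f, hf, hinv⟩ := hH.exists_invariant _ hU U₀ rfl (by
    rintro x ⟨f, c, hc⟩ w
    change ⁅x, f⁆ (w : V) = 0
    have h1 := hc ⁅x, w⁆
    rw [LieSubmodule.coe_bracket] at h1
    rw [LieHom.lie_apply, hc, h1, lie_smul, sub_self]) ⟨π, 1, fun w ↦ by rw [hπ, one_smul]⟩
  let q : V →ₗ[k] W := π - f
  have hq : ∀ w : W, q w = w := fun w ↦ by
    change π w - (f : V →ₗ[k] W) w = w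
    rw [hπ, hf, sub_zero]
  have hql : ∀ (x : L) v, q ⁅x, v⁆ = ⁅x, q v⁆ := by
    intro x v
    have := LinearMap.congr_fun (congrArg Subtype.val (hinv x)) v
    change ⁅x, q⁆ v = 0 at this
    rw [LieHom.lie_apply, sub_eq_zero] at this
    exact this.symm
  let K : LieSubmodule k L V :=
    { toSubmodule := LinearMap.ker q
      lie_mem := fun {x v} hv ↦ by
        change q ⁅x, v⁆ = 0
        rw [hql, show q v = 0 from hv, lie_zero] }
  refine ⟨K, ?_, ?_⟩
  · rw [disjoint_iff, eq_bot_iff]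
    rintro v ⟨hv, hv'⟩
    have h1 : q v = 0 := hv'
    have h2 := hq ⟨v, hv⟩
    rw [h1] at h2
    rw [LieSubmodule.mem_bot]
    exact (congrArg Subtype.val h2).symm
  · rw [codisjoint_iff, eq_top_iff]
    intro v _
    rw [LieSubmodule.mem_sup]
    refine ⟨q v, (q v).2, v - q v, ?_, by abel⟩
    change q (v - q v) = 0
    rw [map_sub, hq, sub_self]

end Weyl

end WeylSuper

namespace WeylSuper

open Module LieModule

/-! ### Finite-dimensional highest weight modules -/

/-- A subspace generated from `Z₀` by the operators in `N` is stable under operators in `B` that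
preserve `Z₀`, if commuting an element of `B` past one of `N` produces elements of `N` and `B`. -/
theorem stable_of_commute {k X : Type*} [Field k] [AddCommGroup X] [Module k X]
    {Z₀ Z : Submodule k X} {N B : Set (End k X)} (hZ₀ : Z₀ ≤ Z) (hN : ∀ y ∈ N, ∀ z ∈ Z, y z ∈ Z)
    (hmin : ∀ Z' : Submodule k X, Z₀ ≤ Z' → (∀ y ∈ N, ∀ z ∈ Z', y z ∈ Z') → Z ≤ Z')
    (hB : ∀ b ∈ B, ∀ z ∈ Z₀, b z ∈ Z)
    (hcomm : ∀ b ∈ B, ∀ y ∈ N, ∃ s : k, b * y - s • (y * b) ∈ Submodule.span k (N ∪ B)) :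
    ∀ b ∈ B, ∀ z ∈ Z, b z ∈ Z := by
  -- The part of `Z` that `B` maps into `Z` contains `Z₀` and is stable under `N`, so by minimality
  -- it is everything. The scalar `s` leaves room for the signs of supercommutators.
  let Z' : Submodule k X :=
    { carrier := {z | z ∈ Z ∧ ∀ b ∈ B, b z ∈ Z}
      zero_mem' := ⟨zero_mem _, fun b _ ↦ by rw [map_zero]; exact zero_mem _⟩
      add_mem' := fun {x y} hx hy ↦ ⟨add_mem hx.1 hy.1, fun b hb ↦ by
        rw [map_add]; exact add_mem (hx.2 b hb) (hy.2 b hb)⟩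
      smul_mem' := fun c x hx ↦ ⟨Z.smul_mem c hx.1, fun b hb ↦ by
        rw [map_smul]; exact Z.smul_mem c (hx.2 b hb)⟩ }
  have hle : Z ≤ Z' := by
    refine hmin Z' (fun z hz ↦ ⟨hZ₀ hz, fun b hb ↦ hB b hb z hz⟩) fun y hy z hz ↦
      ⟨hN y hy z hz.1, fun b hb ↦ ?_⟩
    obtain ⟨s, hs⟩ := hcomm b hb y hy
    have h1 : Submodule.span k (N ∪ B) ≤ Z.comap (LinearMap.applyₗ z) := by
      refine Submodule.span_le.2 ?_
      rintro c (hc | hc)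
      exacts [hN c hc z hz.1, hz.2 c hc]
    have h2 : (b * y - s • (y * b)) z ∈ Z := h1 hs
    have h3 : b (y z) = (b * y - s • (y * b)) z + s • y (b z) := by simp
    rw [h3]
    exact add_mem h2 (Z.smul_mem s (hN y hy _ (hz.2 b hb)))
  exact fun b hb z hz ↦ (hle hz).2 b hb

/-! ### Reflections, simple roots and integrable highest weight vectors. -/

section Integrable

variable {k L : Type*} [Field k] [LieRing L] [LieAlgebra k L] {H : Submodule k L}

/-- The reflection `μ ↦ μ - μ(c) α`. -/
def reflect (α : Dual k H) (c : H) : End k (Dual k H) :=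
  LinearMap.id - (LinearMap.applyₗ c).smulRight α

theorem reflect_apply (α : Dual k H) (c : H) (μ : Dual k H) : reflect α c μ = μ - μ c • α := rfl

theorem reflect_reflect {α : Dual k H} {c : H} (h : α c = 2) (μ : Dual k H) :
    reflect α c (reflect α c μ) = μ := by
  ext y
  simp only [reflect_apply, LinearMap.sub_apply, LinearMap.smul_apply, smul_eq_mul, h]
  ring

/-- The weights of a locally finite representation are invariant under reflections. -/
theorem reflect_weight [CharZero k] {V : Type*} [AddCommGroup V] [Module k V] [LieRingModule L V]
    [LieModule k L V] {α : Dual k H} {c : H} {e f : L} (t : IsSl2Triple (c : L) e f)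
    (he : e ∈ jointEig (opRep L H) α) (hf : f ∈ jointEig (opRep L H) (-α))
    (hen : ∀ q : V, ∃ n : ℕ, (toEnd k L V e ^ n) q = 0)
    (hfn : ∀ q : V, ∃ n : ℕ, (toEnd k L V f ^ n) q = 0) {μ : Dual k H}
    (hμ : jointEig (opRep V H) μ ≠ ⊥) : jointEig (opRep V H) (reflect α c μ) ≠ ⊥ := by
  obtain ⟨p, hp, hp0⟩ := Submodule.exists_mem_ne_zero_of_ne_bot hμ
  -- The nonzero vector supplied here has weight `μ + aα - bα`, and `μ(c) = b - a`, so this is the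
  -- reflected weight.
  obtain ⟨a, b, hab, h⟩ := sl2_weight t hp0 (mem_weight.1 hp c) hen hfn
  rw [reflect_apply, hab, Submodule.ne_bot_iff]
  rcases h with h | h
  · refine ⟨_, ?_, h⟩
    convert pow_mem_weight hf (pow_mem_weight he hp a) b using 2
    ext y
    simp
    ring
  · refine ⟨_, ?_, h⟩
    convert pow_mem_weight he (pow_mem_weight hf hp b) a using 2
    ext y
    simp
    ring

variable (ev : Dual k H →+ ℝ)

/-- The positive roots. -/
def positive : Set (Dual k H) := {α | α ≠ 0 ∧ jointEig (opRep L H) α ≠ ⊥ ∧ 0 < ev α}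

/-- The simple roots. -/
def simple : Set (Dual k H) :=
  {α | α ∈ positive ev ∧ ∀ β ∈ positive ev, ∀ γ ∈ positive ev, α ≠ β + γ}

variable {ev}

theorem positive_finite [FiniteDimensional k L] : (positive ev).Finite :=
  (finite_jointEig_ne_bot (opRep L H)).subset fun _ h ↦ h.2.1

/-- Induction on the number of positive roots with smaller evaluation: a root that is not simple is
a sum of two positive roots, both of smaller evaluation. -/
theorem mem_closure_simple [FiniteDimensional k L] {α : Dual k H} (hα : α ∈ positive ev) :
    α ∈ AddSubmonoid.closure (simple ev) := by
  have hfin := positive_finite (ev := ev)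
  generalize hn : {β ∈ positive ev | ev β < ev α}.ncard = n
  induction n using Nat.strong_induction_on generalizing α with
  | _ n ih =>
  have ih' : ∀ β ∈ positive ev, ev β < ev α → β ∈ AddSubmonoid.closure (simple ev) := by
    intro β hβ hlt
    have hss : {γ ∈ positive ev | ev γ < ev β} ⊂ {γ ∈ positive ev | ev γ < ev α} :=
      ⟨fun _ h ↦ ⟨h.1, h.2.trans hlt⟩, fun h ↦ lt_irrefl _ (h ⟨hβ, hlt⟩).2⟩
    exact ih _ (hn ▸ Set.ncard_lt_ncard hss (hfin.subset fun _ h ↦ h.1)) hβ rfl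
  by_cases h : α ∈ simple ev
  · exact AddSubmonoid.subset_closure h
  · simp only [simple, Set.mem_ofPred_eq, hα, true_and, not_forall] at h
    obtain ⟨β, hβ, γ, hγ, h⟩ := h
    obtain rfl := not_not.1 h
    have h1 := hβ.2.2
    have h2 := hγ.2.2
    refine add_mem (ih' β hβ ?_) (ih' γ hγ ?_) <;> rw [map_add] <;> linarith

/-- A set of weights invariant under the reflections in the simple roots and bounded above is bounded
below. -/
theorem exists_bound_of_reflect [CharZero k] [FiniteDimensional k L] (hH : IsSplit H)
    {Q : Set (Dual k H)} {ν : Dual k H}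
    {c : Dual k H → H} {e f : Dual k H → L} (hc : ∀ α ∈ simple ev, α (c α) = 2)
    (ht : ∀ α ∈ simple ev, IsSl2Triple (c α : L) (e α) (f α))
    (he : ∀ α ∈ simple ev, e α ∈ jointEig (opRep L H) α)
    (hf : ∀ α ∈ simple ev, f α ∈ jointEig (opRep L H) (-α))
    (hQ : ∀ α ∈ simple ev, ∀ μ ∈ Q, reflect α (c α) μ ∈ Q)
    (hν : ∀ μ ∈ Q, ν - μ ∈ AddSubmonoid.closure (simple ev)) :
    ∃ C : ℝ, ∀ μ ∈ Q, ev (ν - μ) ≤ C := by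
  classical
  set R : Set (Dual k H) := {α | jointEig (opRep L H) α ≠ ⊥}
  have hRfin : R.Finite := finite_jointEig_ne_bot (opRep L H)
  have := hRfin.to_subtype
  have hsR : simple ev ⊆ R := fun α hα ↦ hα.1.2.1
  have hnilp : ∀ α ≠ 0, ∀ x ∈ jointEig (opRep L H) α, ∀ q : L,
      ∃ n : ℕ, (toEnd k L L x ^ n) q = 0 := fun α hα x hx q ↦
    isNilpotent_of_weight hH.diag hRfin hα hx q
  have hR : ∀ α ∈ simple ev, ∀ β ∈ R, reflect α (c α) β ∈ R := fun α hα β hβ ↦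
    reflect_weight (ht α hα) (he α hα) (hf α hα) (hnilp α hα.1.1 _ (he α hα))
      (hnilp _ (neg_ne_zero.2 hα.1.1) _ (hf α hα)) hβ
  let W : Submonoid (End k (Dual k H)) :=
    Submonoid.closure ((fun α ↦ reflect α (c α)) '' simple ev)
  have hW : ∀ Q' : Set (Dual k H), (∀ α ∈ simple ev, ∀ μ ∈ Q', reflect α (c α) μ ∈ Q') →
      ∀ w ∈ W, ∀ μ ∈ Q', w μ ∈ Q' := by
    intro Q' hQ' w hw
    induction hw using Submonoid.closure_induction with
    | mem w hw =>
      obtain ⟨α, hα, rfl⟩ := hw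
      exact hQ' α hα
    | one => exact fun μ hμ ↦ hμ
    | mul w w' _ _ h h' => exact fun μ hμ ↦ h _ (h' μ hμ)
  -- Finiteness of the monoid `W` is not needed. The functions that its elements induce on the roots
  -- through `ev` suffice; they take values in the finite set `ev '' R`.
  let O : Set (R → ℝ) := {φ | ∃ w ∈ W, ∀ β : R, φ β = ev (w β)}
  have hOfin : O.Finite := by
    refine (Set.Finite.pi' (t := fun _ : R ↦ ev '' R) fun _ ↦ hRfin.image _).subset ?_
    rintro φ ⟨w, hw, hφ⟩ β
    rw [hφ]
    exact ⟨_, hW R hR w hw β β.2, rfl⟩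
  -- Composition with the reflection in `α` permutes `O` and changes the sign of the value at `α`,
  -- so the sum equals its own negative.
  have hsum : ∀ α (hα : α ∈ simple ev), ∑ φ ∈ hOfin.toFinset, φ ⟨α, hsR hα⟩ = 0 := by
    intro α hα
    let σ : R → R := fun β ↦ ⟨reflect α (c α) β, hR α hα β β.2⟩
    have hσ : ∀ β, σ (σ β) = β := fun β ↦ Subtype.ext (reflect_reflect (hc α hα) _)
    have hO : ∀ φ ∈ O, φ ∘ σ ∈ O := by
      rintro φ ⟨w, hw, hφ⟩
      exact ⟨w * reflect α (c α), W.mul_mem hw (Submonoid.subset_closure ⟨α, hα, rfl⟩),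
        fun β ↦ hφ _⟩
    have h1 : ∑ φ ∈ hOfin.toFinset, φ ⟨α, hsR hα⟩ =
        ∑ φ ∈ hOfin.toFinset, (φ ∘ σ) ⟨α, hsR hα⟩ := by
      refine (Finset.sum_nbij' (fun φ ↦ φ ∘ σ) (fun φ ↦ φ ∘ σ) ?_ ?_ ?_ ?_ ?_).symm
      · intro φ hφ
        simpa using hO φ (by simpa using hφ)
      · intro φ hφ
        simpa using hO φ (by simpa using hφ)
      · intro φ _
        funext β
        simp [hσ]
      · intro φ _
        funext β
        simp [hσ]
      · intro φ _
        rfl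
    have h2 : ∀ φ ∈ hOfin.toFinset, (φ ∘ σ) ⟨α, hsR hα⟩ = - φ ⟨α, hsR hα⟩ := by
      intro φ hφ
      obtain ⟨w, hw, hφ⟩ := (hOfin.mem_toFinset).1 hφ
      rw [Function.comp_apply, hφ, hφ]
      have : reflect α (c α) α = -α := by
        ext y
        simp only [reflect_apply, hc α hα, LinearMap.sub_apply, LinearMap.smul_apply, smul_eq_mul,
          LinearMap.neg_apply]
        ring
      change ev (w (reflect α (c α) α)) = _
      rw [this, map_neg, map_neg]
    rw [Finset.sum_congr rfl h2, Finset.sum_neg_distrib] at h1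
    linarith
  have hch : ∀ φ : R → ℝ, ∃ w : End k (Dual k H), φ ∈ O → w ∈ W ∧ ∀ β : R, φ β = ev (w β) := by
    intro φ
    by_cases h : φ ∈ O
    · obtain ⟨w, hw⟩ := h
      exact ⟨w, fun _ ↦ hw⟩
    · exact ⟨0, fun h' ↦ absurd h' h⟩
  choose w hw using hch
  -- Averaging `ev` over representatives of `O` gives an additive function that vanishes on the span
  -- of the simple roots, hence is constant on `Q`.
  let S : Dual k H →+ ℝ := ∑ φ ∈ hOfin.toFinset, ev.comp (w φ).toAddMonoidHom
  have hS : ∀ μ, S μ = ∑ φ ∈ hOfin.toFinset, ev (w φ μ) := fun μ ↦ by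
    simp [S]
  have hS0 : ∀ μ ∈ AddSubmonoid.closure (simple ev), S μ = 0 := by
    intro μ hμ
    induction hμ using AddSubmonoid.closure_induction with
    | mem α hα =>
      rw [hS, ← hsum α hα]
      exact Finset.sum_congr rfl fun φ hφ ↦
        ((hw φ ((hOfin.mem_toFinset).1 hφ)).2 ⟨α, hsR hα⟩).symm
    | zero => exact map_zero _
    | add _ _ _ _ h h' => rw [map_add, h, h', add_zero]
  have hpos : ∀ μ ∈ AddSubmonoid.closure (simple ev), 0 ≤ ev μ := by
    intro μ hμ
    induction hμ using AddSubmonoid.closure_induction with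
    | mem α hα => exact hα.1.2.2.le
    | zero => rw [map_zero]
    | add _ _ _ _ h h' => rw [map_add]; exact add_nonneg h h'
  -- The term belonging to the identity need not be represented by the identity itself, but its
  -- representative agrees with `ev` on sums of simple roots, which is all that is used.
  let φ₀ : R → ℝ := fun β ↦ ev β
  have hφ₀ : φ₀ ∈ O := ⟨1, W.one_mem, fun β ↦ rfl⟩
  have hw₀ : ∀ μ ∈ AddSubmonoid.closure (simple ev), ev (w φ₀ μ) = ev μ := by
    intro μ hμ
    induction hμ using AddSubmonoid.closure_induction with
    | mem α hα => exact ((hw φ₀ hφ₀).2 ⟨α, hsR hα⟩).symm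
    | zero => rw [map_zero]
    | add _ _ _ _ h h' => rw [map_add, map_add, map_add, h, h']
  refine ⟨ev (w φ₀ ν) - S ν + ∑ φ ∈ hOfin.toFinset.erase φ₀, ev ν, fun μ hμ ↦ ?_⟩
  have h1 : S μ = S ν := by
    have := hS0 _ (hν μ hμ)
    rw [map_sub] at this
    linarith
  have h2 : ev (w φ₀ ν) - ev (w φ₀ μ) = ev (ν - μ) := by
    rw [← hw₀ _ (hν μ hμ), map_sub, map_sub]
  have h3 : ev (w φ₀ μ) + ∑ φ ∈ hOfin.toFinset.erase φ₀, ev (w φ μ) = S μ := by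
    rw [hS]
    exact Finset.add_sum_erase _ (fun φ ↦ ev (w φ μ)) ((hOfin.mem_toFinset).2 hφ₀)
  -- Every `w φ μ` lies again in `Q` and so has evaluation at most `ev ν`. Since the total over `O`
  -- is fixed, bounding all other terms above bounds the remaining one below.
  have h4 : ∑ φ ∈ hOfin.toFinset.erase φ₀, ev (w φ μ) ≤ ∑ φ ∈ hOfin.toFinset.erase φ₀, ev ν := by
    refine Finset.sum_le_sum fun φ hφ ↦ ?_
    have hφO := (hOfin.mem_toFinset).1 (Finset.mem_of_mem_erase hφ)
    have := hpos _ (hν _ (hW Q hQ _ (hw φ hφO).1 μ hμ))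
    rw [map_sub] at this
    linarith
  linarith

/-- The vectors obtained from `v` by applying `n` negative root vectors. -/
def lowerings (ev : Dual k H →+ ℝ) {X : Type*} [AddCommGroup X] [LieRingModule L X] (v : X) :
    ℕ → Set X
  | 0 => {v}
  | n + 1 => {x | ∃ α ∈ positive (L := L) ev, ∃ y ∈ jointEig (opRep L H) (-α),
      ∃ p ∈ lowerings ev v n, x = ⁅y, p⁆}

variable {X : Type*} [AddCommGroup X] [Module k X] [LieRingModule L X] [LieModule k L X]

/-- Each lowering decreases the evaluation by at least `ε`. The resulting bound `n * ε` is what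
later kills all sufficiently long words. -/
theorem exists_weight_of_mem_lowerings [FiniteDimensional k L] {ν : Dual k H} {v : X}
    (hv : v ∈ jointEig (opRep X H) ν) {ε : ℝ} (hε : ∀ α ∈ positive (L := L) ev, ε ≤ ev α) (n : ℕ) :
    ∀ x ∈ lowerings (L := L) ev v n, ∃ μ, x ∈ jointEig (opRep X H) μ ∧
      ν - μ ∈ AddSubmonoid.closure (simple (L := L) ev) ∧ n * ε ≤ ev (ν - μ) := by
  induction n with
  | zero =>
    rintro _ rfl
    exact ⟨ν, hv, by simp, by simp⟩
  | succ n ih =>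
    rintro _ ⟨α, hα, y, hy, p, hp, rfl⟩
    obtain ⟨μ, hμ, h1, h2⟩ := ih p hp
    have h3 : ν - (-α + μ) = (ν - μ) + α := by abel
    refine ⟨-α + μ, lie_mem_weight hy hμ, ?_, ?_⟩
    · rw [h3]
      exact add_mem h1 (mem_closure_simple hα)
    · rw [h3, map_add, Nat.cast_add, Nat.cast_one, add_mul, one_mul]
      exact add_le_add h2 (hε α hα)

/-- A root of negative evaluation is the negative of a positive root, since an `sl(2)`-triple
provides a nonzero vector in the opposite root space. -/
theorem exists_root_trichotomy [CharZero k] (hH : IsSplit H)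
    (hev : ∀ α : Dual k H, α ≠ 0 → jointEig (opRep L H) α ≠ ⊥ → ev α ≠ 0) {α : Dual k H}
    (hα : jointEig (opRep L H) α ≠ ⊥) :
    α = 0 ∨ α ∈ positive (L := L) ev ∨ -α ∈ positive (L := L) ev := by
  by_cases h0 : α = 0
  · exact Or.inl h0
  rcases lt_or_gt_of_ne (hev α h0 hα) with h | h
  · obtain ⟨e, he, he0⟩ := Submodule.exists_mem_ne_zero_of_ne_bot hα
    obtain ⟨f, hf, c, t, -⟩ := hH.exists_triple h0 he he0
    refine Or.inr (Or.inr ⟨neg_ne_zero.2 h0, (Submodule.ne_bot_iff _).2 ⟨f, hf, t.f_ne_zero⟩, ?_⟩)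
    rw [map_neg]
    linarith
  · exact Or.inr (Or.inl ⟨h0, hα, h⟩)

/-- The submodule generated by a highest weight vector is generated by the negative root vectors. -/
theorem exists_lieSubmodule_lowerings [CharZero k] (hH : IsSplit H)
    (hev : ∀ α : Dual k H, α ≠ 0 → jointEig (opRep L H) α ≠ ⊥ → ev α ≠ 0) {ν : Dual k H} {v : X}
    (hv : v ∈ jointEig (opRep X H) ν)
    (hpos : ∀ α ∈ positive (L := L) ev, ∀ x ∈ jointEig (opRep L H) α, ⁅x, v⁆ = 0) :
    ∃ P : LieSubmodule k L X,
      (P : Submodule k X) = Submodule.span k (⋃ n, lowerings (L := L) ev v n) := by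
  set Z := Submodule.span k (⋃ n, lowerings (L := L) ev v n) with hZ
  let N : Set (End k X) :=
    {φ | ∃ α ∈ positive (L := L) ev, ∃ y ∈ jointEig (opRep L H) (-α), φ = toEnd k L X y}
  let B : Set (End k X) := {φ | ∃ α, (α = 0 ∨ α ∈ positive (L := L) ev) ∧
    ∃ y ∈ jointEig (opRep L H) α, φ = toEnd k L X y}
  have hspan : ∀ x : L, toEnd k L X x ∈ Submodule.span k (N ∪ B) := by
    intro x
    obtain ⟨s, d, hd, rfl⟩ := hH.diag.exists_sum x
    rw [map_sum]
    refine Submodule.sum_mem _ fun α _ ↦ ?_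
    by_cases h0 : d α = 0
    · rw [h0, map_zero]
      exact zero_mem _
    · refine Submodule.subset_span ?_
      rcases exists_root_trichotomy hH hev ((Submodule.ne_bot_iff _).2 ⟨_, hd α, h0⟩) with h | h | h
      · exact Or.inr ⟨α, Or.inl h, _, hd α, rfl⟩
      · exact Or.inr ⟨α, Or.inr h, _, hd α, rfl⟩
      · exact Or.inl ⟨-α, h, _, by rw [neg_neg]; exact hd α, rfl⟩
  have hvZ : v ∈ Z := Submodule.subset_span (Set.mem_iUnion.2 ⟨0, rfl⟩)
  have hNZ : ∀ y ∈ N, ∀ z ∈ Z, y z ∈ Z := by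
    rintro _ ⟨α, hα, y, hy, rfl⟩ z hz
    have : Z ≤ Z.comap (toEnd k L X y) := by
      refine Submodule.span_le.2 fun p hp ↦ ?_
      obtain ⟨n, hn⟩ := Set.mem_iUnion.1 hp
      exact Submodule.subset_span (Set.mem_iUnion.2 ⟨n + 1, α, hα, y, hy, p, hn, rfl⟩)
    exact this hz
  -- Nonnegative root vectors are moved past the negative ones until they reach `v`, on which they
  -- act by scalars or by zero.
  have hBZ := stable_of_commute (Z₀ := Submodule.span k {v}) (Z := Z) (N := N) (B := B)
    (by rwa [Submodule.span_singleton_le_iff_mem]) hNZ (by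
      intro Z' hv' hN'
      refine Submodule.span_le.2 (Set.iUnion_subset fun n ↦ ?_)
      induction n with
      | zero =>
        rintro _ rfl
        exact hv' (Submodule.mem_span_singleton_self _)
      | succ n ih =>
        rintro _ ⟨α, hα, y, hy, p, hp, rfl⟩
        exact hN' _ ⟨α, hα, y, hy, rfl⟩ p (ih hp)) (by
      rintro _ ⟨α, hα, y, hy, rfl⟩ z hz
      obtain ⟨a, rfl⟩ := Submodule.mem_span_singleton.1 hz
      rw [map_smul]
      refine Z.smul_mem _ ?_
      rw [toEnd_apply_apply]
      rcases hα with rfl | hα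
      · rw [mem_weight.1 hv ⟨y, hH.zero_le hy⟩]
        exact Z.smul_mem _ hvZ
      · rw [hpos α hα y hy]
        exact zero_mem _) (by
      rintro _ ⟨α, hα, x, hx, rfl⟩ _ ⟨β, hβ, y, hy, rfl⟩
      refine ⟨1, ?_⟩
      rw [one_smul]
      convert hspan ⁅x, y⁆ using 1
      exact LinearMap.ext fun u ↦ (lie_lie x y u).symm)
  refine ⟨{ toSubmodule := Z, lie_mem := fun {x z} hz ↦ ?_ }, rfl⟩
  have : Submodule.span k (N ∪ B) ≤ Z.comap (LinearMap.applyₗ z) := by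
    refine Submodule.span_le.2 ?_
    rintro c (hc | hc)
    exacts [hNZ c hc z hz, hBZ c hc z hz]
  exact this (hspan x)

/-- A highest weight vector annihilated by powers of the simple negative root vectors generates a
finite-dimensional module. -/
theorem exists_finite_lieSubmodule [CharZero k] [FiniteDimensional k L] (hH : IsSplit H)
    (hev : ∀ α : Dual k H, α ≠ 0 → jointEig (opRep L H) α ≠ ⊥ → ev α ≠ 0) {ν : Dual k H} {v : X}
    (hv : v ∈ jointEig (opRep X H) ν)
    (hpos : ∀ α ∈ positive (L := L) ev, ∀ x ∈ jointEig (opRep L H) α, ⁅x, v⁆ = 0)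
    (hint : ∀ α ∈ simple (L := L) ev, ∃ e ∈ jointEig (opRep L H) α,
      ∃ f ∈ jointEig (opRep L H) (-α), ∃ c : H, IsSl2Triple (c : L) e f ∧ α c = 2 ∧
        ∃ n : ℕ, (toEnd k L X f ^ n) v = 0) :
    ∃ P : LieSubmodule k L X, Module.Finite k P ∧ v ∈ P := by
  obtain ⟨P, hP⟩ := exists_lieSubmodule_lowerings hH hev hv hpos
  have hmem : ∀ n, ∀ x ∈ lowerings (L := L) ev v n, x ∈ P := fun n x hx ↦ by
    rw [← LieSubmodule.mem_toSubmodule, hP]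
    exact Submodule.subset_span (Set.mem_iUnion.2 ⟨n, hx⟩)
  have hvP : v ∈ P := hmem 0 v rfl
  obtain ⟨ε, hε0, hε⟩ : ∃ ε : ℝ, 0 < ε ∧ ∀ α ∈ positive (L := L) ev, ε ≤ ev α := by
    rcases (positive (L := L) ev).eq_empty_or_nonempty with h | h
    · exact ⟨1, one_pos, by simp [h]⟩
    · obtain ⟨α, hα, hmin⟩ := Set.exists_min_image _ ev (positive_finite (ev := ev)) h
      exact ⟨ev α, hα.2.2, hmin⟩
  have hlow := exists_weight_of_mem_lowerings hv hε
  set Q : Set (Dual k H) := {μ | jointEig (opRep P H) μ ≠ ⊥}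
  have hincl : ∀ {μ : Dual k H} {p : P}, p ∈ jointEig (opRep P H) μ ↔
      (p : X) ∈ jointEig (opRep X H) μ := by
    intro μ p
    rw [mem_weight, mem_weight]
    exact forall_congr' fun y ↦ Subtype.ext_iff
  have htop : ⨆ (μ) (_ : ν - μ ∈ AddSubmonoid.closure (simple (L := L) ev)),
      jointEig (opRep P H) μ = ⊤ := by
    set Y := ⨆ (μ) (_ : ν - μ ∈ AddSubmonoid.closure (simple (L := L) ev)),
      jointEig (opRep P H) μ with hY
    have h1 : (P : Submodule k X) ≤ Y.map (P : Submodule k X).subtype := by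
      conv_lhs => rw [hP]
      refine Submodule.span_le.2 (Set.iUnion_subset fun n x hx ↦ ?_)
      obtain ⟨μ, h1, h2, -⟩ := hlow n x hx
      exact ⟨⟨x, hmem n x hx⟩, Submodule.mem_iSup_of_mem μ (Submodule.mem_iSup_of_mem h2
        (hincl.2 h1)), rfl⟩
    rw [eq_top_iff]
    rintro ⟨x, hx⟩ _
    obtain ⟨y, hy, h⟩ := h1 hx
    have : y = ⟨x, hx⟩ := Subtype.ext h
    exact this ▸ hy
  have hQ : ∀ μ ∈ Q, ν - μ ∈ AddSubmonoid.closure (simple (L := L) ev) := by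
    intro μ hμ
    by_contra h
    refine hμ ((Submodule.eq_bot_iff _).2 fun p hp ↦ ?_)
    exact eq_zero_of_mem_iSup
      (P := fun μ ↦ ν - μ ∈ AddSubmonoid.closure (simple (L := L) ev)) h hp
      (htop.symm.le Submodule.mem_top)
  have hdiag : IsDiag (opRep P H) := by
    refine eq_top_iff.2 (htop.ge.trans ?_)
    exact iSup_mono fun μ ↦ iSup_le fun _ ↦ le_rfl
  have hpos' : ∀ μ ∈ AddSubmonoid.closure (simple (L := L) ev), 0 ≤ ev μ := by
    intro μ hμ
    induction hμ using AddSubmonoid.closure_induction with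
    | mem α hα => exact hα.1.2.2.le
    | zero => rw [map_zero]
    | add _ _ _ _ h h' => rw [map_add]; exact add_nonneg h h'
  choose! e he f hf c t hc hn using hint
  -- Raising increases the evaluation, which is bounded above by that of `ν`.
  have hen : ∀ α ∈ simple (L := L) ev, ∀ q : P, ∃ n : ℕ, (toEnd k L P (e α) ^ n) q = 0 := by
    intro α hα q
    refine isNilpotent_of_forall_weight hdiag (he α hα) (fun μ ↦ ?_) q
    obtain ⟨n, hn⟩ := exists_nat_gt (ev (ν - μ) / ev α)
    refine ⟨n, ?_⟩
    by_contra h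
    have h1 := hpos' _ (hQ _ h)
    rw [show ν - (n • α + μ) = (ν - μ) - n • α by abel, map_sub, map_nsmul, nsmul_eq_mul] at h1
    rw [div_lt_iff₀ hα.1.2.2] at hn
    linarith
  -- The vectors killed by a power of `f α` form the generalized eigenspace for `0`. It is stable
  -- under `L` because `f α` is ad-nilpotent, and it contains `v`.
  have hfn : ∀ α ∈ simple (L := L) ev, ∀ q : P, ∃ n : ℕ, (toEnd k L P (f α) ^ n) q = 0 := by
    intro α hα
    have hE : ∀ x : X, x ∈ (toEnd k L X (f α)).maxGenEigenspace 0 ↔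
        ∃ n : ℕ, (toEnd k L X (f α) ^ n) x = 0 := by
      intro x
      rw [Module.End.mem_maxGenEigenspace]
      simp
    have hlie : ∀ (y : L) (x : X), x ∈ (toEnd k L X (f α)).maxGenEigenspace 0 →
        ⁅y, x⁆ ∈ (toEnd k L X (f α)).maxGenEigenspace 0 := by
      intro y x hx
      rw [← add_zero (0 : k)]
      refine lie_mem_maxGenEigenspace_toEnd ?_ hx
      rw [Module.End.mem_maxGenEigenspace]
      simpa using isNilpotent_of_weight hH.diag (finite_jointEig_ne_bot _)
        (neg_ne_zero.2 hα.1.1) (hf α hα) y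
    have hle : ∀ n, ∀ x ∈ lowerings (L := L) ev v n,
        x ∈ (toEnd k L X (f α)).maxGenEigenspace 0 := by
      intro n
      induction n with
      | zero =>
        rintro _ rfl
        exact (hE _).2 (hn α hα)
      | succ n ih =>
        rintro _ ⟨β, hβ, y, hy, p, hp, rfl⟩
        exact hlie y p (ih p hp)
    have hPle : (P : Submodule k X) ≤ (toEnd k L X (f α)).maxGenEigenspace 0 := by
      rw [hP]
      exact Submodule.span_le.2 (Set.iUnion_subset hle)
    intro q
    obtain ⟨n, hn⟩ := (hE q).1 (hPle q.2)
    refine ⟨n, Subtype.ext (Eq.trans ?_ hn)⟩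
    clear hn
    induction n with
    | zero => rfl
    | succ n ih =>
      rw [pow_succ', Module.End.mul_apply, toEnd_apply_apply, LieSubmodule.coe_bracket, ih,
        pow_succ', Module.End.mul_apply, toEnd_apply_apply]
  -- Local nilpotency makes the set of weights invariant under simple reflections, so their depth
  -- below `ν` is bounded by `C`, and words of length at least `m > C / ε` vanish.
  obtain ⟨C, hC⟩ := exists_bound_of_reflect hH (Q := Q) hc t he hf
    (fun α hα μ hμ ↦ reflect_weight (t α hα) (he α hα) (hf α hα) (hen α hα) (hfn α hα) hμ) hQ
  obtain ⟨m, hm⟩ := exists_nat_gt (C / ε)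
  have hzero : ∀ n, m ≤ n → ∀ x ∈ lowerings (L := L) ev v n, x = 0 := by
    intro n hmn x hx
    by_contra hx0
    obtain ⟨μ, h1, h2, h3⟩ := hlow n x hx
    have h4 : μ ∈ Q := (Submodule.ne_bot_iff _).2
      ⟨⟨x, hmem n x hx⟩, hincl.2 h1, fun h ↦ hx0 (congrArg Subtype.val h)⟩
    have h5 := hC μ h4
    rw [div_lt_iff₀ hε0] at hm
    have h6 : (m : ℝ) * ε ≤ n * ε := by gcongr
    linarith
  -- Words of a fixed length span a finite-dimensional space because `L` is finite dimensional; only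
  -- lengths below `m` contribute to `P`.
  have hfd : ∀ n, Module.Finite k (Submodule.span k (lowerings (L := L) ev v n)) := by
    intro n
    induction n with
    | zero => exact Module.Finite.span_of_finite k (Set.finite_singleton v)
    | succ n ih =>
      have h1 : Submodule.span k (lowerings (L := L) ev v (n + 1)) ≤
          Submodule.map₂ ((toEnd k L X : L →ₗ[k] End k X)) ⊤ (Submodule.span k (lowerings (L := L) ev v n)) := by
        refine Submodule.span_le.2 ?_
        rintro _ ⟨α, hα, y, hy, p, hp, rfl⟩
        exact Submodule.apply_mem_map₂ _ trivial (Submodule.subset_span hp)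
      have : Module.Finite k (Submodule.map₂ (toEnd k L X : L →ₗ[k] End k X) ⊤
          (Submodule.span k (lowerings (L := L) ev v n))) :=
        Module.Finite.iff_fg.2 (Submodule.FG.map₂ _ Module.Finite.fg_top (Module.Finite.iff_fg.1 ih))
      exact Submodule.finiteDimensional_of_le h1
  refine ⟨P, ?_, hvP⟩
  have hle : (P : Submodule k X) ≤ ⨆ n ∈ Finset.range m, Submodule.span k (lowerings (L := L) ev v n) := by
    rw [hP]
    refine Submodule.span_le.2 (Set.iUnion_subset fun n x hx ↦ ?_)
    by_cases h : n < m
    · exact Submodule.mem_iSup_of_mem n (Submodule.mem_iSup_of_mem (Finset.mem_range.2 h)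
        (Submodule.subset_span hx))
    · rw [hzero n (not_lt.1 h) x hx]
      exact zero_mem _
  have : FiniteDimensional k
      (⨆ n ∈ Finset.range m, Submodule.span k (lowerings (L := L) ev v n) : Submodule k X) :=
    Submodule.finiteDimensional_finset_sup _ _ |> fun h ↦ by rwa [Finset.sup_eq_iSup] at h
  exact Submodule.finiteDimensional_of_le hle

end Integrable

end WeylSuper

namespace WeylSuper

open Module LieModule

/-! ### Existence of coroots -/

theorem isNilpotent_of_forall_not_hasEigenvalue {k V : Type*} [Field k] [IsAlgClosed k]
    [AddCommGroup V] [Module k V] [FiniteDimensional k V] {C : End k V}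
    (h : ∀ μ, C.HasEigenvalue μ → μ = 0) : IsNilpotent C := by
  have htop : C.maxGenEigenspace 0 = ⊤ := by
    rw [← Module.End.iSup_maxGenEigenspace_eq_top C]
    refine le_antisymm (le_iSup _ 0) (iSup_le fun μ ↦ ?_)
    by_cases hμ : μ = 0
    · rw [hμ]
    have : C.maxGenEigenspace μ = ⊥ := by
      by_contra hne
      exact hμ (h μ (Module.End.HasUnifEigenvalue.lt (k := ⊤) one_pos hne))
    rw [this]
    exact bot_le
  refine ⟨C.maxGenEigenspaceIndex 0, LinearMap.ext fun v ↦ ?_⟩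
  have hv : v ∈ C.maxGenEigenspace 0 := htop ▸ Submodule.mem_top
  rw [Module.End.maxGenEigenspace_eq] at hv
  simpa [Module.End.mem_genEigenspace_nat] using hv

/-- A commutator that commutes with its entries is nilpotent. -/
theorem isNilpotent_of_commutator {k V : Type*} [Field k] [CharZero k] [IsAlgClosed k]
    [AddCommGroup V] [Module k V] [FiniteDimensional k V] {E F C : End k V}
    (hC : C = E * F - F * E) (hE : C * E = E * C) (hF : C * F = F * C) : IsNilpotent C := by
  refine isNilpotent_of_forall_not_hasEigenvalue fun μ hμ ↦ ?_
  have hmem : ∀ {v}, v ∈ C.eigenspace μ ↔ C v = μ • v := Module.End.mem_eigenspace_iff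
  have hst : ∀ {G : End k V}, C * G = G * C → ∀ v ∈ C.eigenspace μ, G v ∈ C.eigenspace μ := by
    intro G hG v hv
    rw [hmem] at hv ⊢
    rw [← Module.End.mul_apply, hG, Module.End.mul_apply, hv, map_smul]
  -- Since `E` and `F` preserve the eigenspace of `C` for `μ`, their commutator there has trace
  -- zero, while it equals `μ` times the identity.
  have h1 : E.restrict (hst hE) * F.restrict (hst hF) - F.restrict (hst hF) * E.restrict (hst hE) =
      μ • (1 : End k (C.eigenspace μ)) := by
    ext v
    have h0 : (E * F - F * E) (v : V) = μ • (v : V) := hC ▸ hmem.1 v.2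
    exact h0
  have h2 := congrArg (LinearMap.trace k _) h1
  rw [map_sub, LinearMap.trace_mul_comm, sub_self, map_smul, LinearMap.trace_one, smul_eq_mul] at h2
  rcases mul_eq_zero.1 h2.symm with h | h
  · exact h
  · rw [Nat.cast_eq_zero, Submodule.finrank_eq_zero] at h
    exact absurd h hμ

section Coroot

variable {k L : Type*} [Field k] [LieRing L] [LieAlgebra k L] {H : Submodule k L}

theorem exists_ne_zero_of_ne_zero {α : Dual k H} (hα : α ≠ 0) : ∃ y, α y ≠ 0 := by
  by_contra! h
  exact hα (LinearMap.ext h)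

/-- Coroots exist if `L` has a faithful representation whose trace form is nondegenerate. -/
theorem exists_coroot_of_trace [CharZero k] [IsAlgClosed k] (hab : ∀ x ∈ H, ∀ y ∈ H, ⁅x, y⁆ = 0)
    (hdiag : IsDiag (opRep L H)) (hzero : jointEig (opRep L H) 0 ≤ H) {V : Type*}
    [AddCommGroup V] [Module k V] [FiniteDimensional k V] (ρ : L →ₗ[k] End k V)
    (hρ : ∀ x y, ρ ⁅x, y⁆ = ρ x * ρ y - ρ y * ρ x)
    (nd : ∀ x, (∀ y, LinearMap.trace k V (ρ x * ρ y) = 0) → x = 0) {α : Dual k H} (hα : α ≠ 0)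
    {e : L} (he : e ∈ jointEig (opRep L H) α) (he0 : e ≠ 0) :
    ∃ f ∈ jointEig (opRep L H) (-α), ∃ c : H, ⁅e, f⁆ = (c : L) ∧ α c ≠ 0 := by
  have hinv : ∀ x y z, LinearMap.trace k V (ρ ⁅x, y⁆ * ρ z) = LinearMap.trace k V (ρ x * ρ ⁅y, z⁆) := by
    intro x y z
    rw [hρ, hρ, sub_mul, mul_sub, map_sub, map_sub, mul_assoc, mul_assoc,
      LinearMap.trace_mul_comm k (ρ y), mul_assoc]
  obtain ⟨y, hy⟩ : ∃ y, LinearMap.trace k V (ρ e * ρ y) ≠ 0 := by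
    by_contra! h
    exact he0 (nd e h)
  obtain ⟨s, d, hd, rfl⟩ := hdiag.exists_sum y
  rw [map_sum, Finset.mul_sum, map_sum] at hy
  obtain ⟨β, -, hβ⟩ := Finset.exists_ne_zero_of_sum_ne_zero hy
  -- By invariance, root spaces pair nontrivially under the trace form only if their weights are
  -- opposite.
  have hβα : β = -α := by
    rw [eq_neg_iff_add_eq_zero]
    ext h
    have h1 := hinv e h (d β)
    rw [← lie_skew, mem_weight.1 he, mem_weight.1 (hd β), map_neg, map_smul, map_smul, neg_mul,
      smul_mul_assoc, mul_smul_comm, map_neg, map_smul, map_smul, neg_eq_iff_add_eq_zero,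
      ← add_smul, smul_eq_mul] at h1
    rw [add_comm]
    exact (mul_eq_zero.1 h1).resolve_right hβ
  have hf := hd β
  rw [hβα] at hf hβ
  set f := d (-α)
  have hc : ⁅e, f⁆ ∈ jointEig (opRep L H) 0 := by
    have := lie_mem_weight he hf
    rwa [add_neg_cancel] at this
  refine ⟨f, hf, ⟨_, hzero hc⟩, rfl, fun hαc ↦ ?_⟩
  obtain ⟨h, hh⟩ := exists_ne_zero_of_ne_zero hα
  have hcomm : ∀ z, ⁅⁅e, f⁆, z⁆ = 0 → ρ ⁅e, f⁆ * ρ z = ρ z * ρ ⁅e, f⁆ := fun z hz ↦ by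
    rw [← sub_eq_zero, ← hρ, hz, map_zero]
  -- If `α` vanished on `[e, f]`, this element would commute with both `e` and `f`, and a commutator
  -- commuting with its entries is nilpotent.
  have hnil : IsNilpotent (ρ ⁅e, f⁆) := by
    refine isNilpotent_of_commutator (hρ e f) (hcomm e ?_) (hcomm f ?_)
    · rw [mem_weight.1 he ⟨_, hzero hc⟩, hαc, zero_smul]
    · rw [mem_weight.1 hf ⟨_, hzero hc⟩, LinearMap.neg_apply, hαc, neg_zero, zero_smul]
  -- The product of `ρ [e, f]` with the commuting operator `ρ h` is nilpotent, so its trace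
  -- vanishes; by invariance the same trace is `α(h)` times the nonzero pairing of `e` and `f`.
  have htr : LinearMap.trace k V (ρ ⁅e, f⁆ * ρ h) = 0 := by
    have h1 : Commute (ρ ⁅e, f⁆) (ρ h) := hcomm h (hab _ (hzero hc) _ h.2)
    exact (LinearMap.isNilpotent_trace_of_isNilpotent (h1.isNilpotent_mul_right hnil)).eq_zero
  rw [hinv, ← lie_skew, mem_weight.1 hf, map_neg, map_smul, LinearMap.neg_apply, neg_smul, neg_neg,
    mul_smul_comm, map_smul, smul_eq_mul] at htr
  exact (mul_ne_zero hh hβ) htr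

/-- Coroots exist if every ideal of `L` has a complement. -/
theorem exists_coroot_of_complementedLattice [CharZero k] [IsAlgClosed k] [FiniteDimensional k L]
    [ComplementedLattice (LieIdeal k L)] (hab : ∀ x ∈ H, ∀ y ∈ H, ⁅x, y⁆ = 0)
    (hdiag : IsDiag (opRep L H)) (hzero : jointEig (opRep L H) 0 ≤ H) {α : Dual k H} (hα : α ≠ 0)
    {e : L} (he : e ∈ jointEig (opRep L H) α) (he0 : e ≠ 0) :
    ∃ f ∈ jointEig (opRep L H) (-α), ∃ c : H, ⁅e, f⁆ = (c : L) ∧ α c ≠ 0 := by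
  have hlie0 : ∀ {α : Dual k H} {e f : L}, e ∈ jointEig (opRep L H) α →
      f ∈ jointEig (opRep L H) (-α) → ⁅e, f⁆ ∈ H := by
    intro α e f he hf
    have := lie_mem_weight he hf
    rw [add_neg_cancel] at this
    exact hzero this
  have hfin := finite_jointEig_ne_bot (opRep L H)
  -- the brackets of a root vector without coroot vanish
  have hvanish : ∀ α : Dual k H, α ≠ 0 → ∀ e ∈ jointEig (opRep L H) α,
      (∀ f ∈ jointEig (opRep L H) (-α), ∀ c : H, ⁅e, f⁆ = (c : L) → α c = 0) →
      ∀ f ∈ jointEig (opRep L H) (-α), ⁅e, f⁆ = 0 := by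
    intro α hα e he hbad f hf
    have hc := hlie0 he hf
    have hαc := hbad f hf ⟨_, hc⟩ rfl
    have hce : ⁅⁅e, f⁆, e⁆ = 0 := by rw [mem_weight.1 he ⟨_, hc⟩, hαc, zero_smul]
    have hcf : ⁅⁅e, f⁆, f⁆ = 0 := by
      rw [mem_weight.1 hf ⟨_, hc⟩, LinearMap.neg_apply, hαc, neg_zero, zero_smul]
    have hcomm : ∀ z, ⁅⁅e, f⁆, z⁆ = 0 → toEnd k L L ⁅e, f⁆ * toEnd k L L z =
        toEnd k L L z * toEnd k L L ⁅e, f⁆ := fun z hz ↦ LinearMap.ext fun u ↦ by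
      have := lie_lie ⁅e, f⁆ z u
      rw [hz, zero_lie] at this
      exact (sub_eq_zero.1 this.symm)
    obtain ⟨n, hn⟩ := isNilpotent_of_commutator (E := toEnd k L L e) (F := toEnd k L L f)
      (LinearMap.ext fun u ↦ lie_lie e f u) (hcomm e hce) (hcomm f hcf)
    -- The adjoint action of `[e, f]` is nilpotent, and it is diagonalizable because `[e, f]` lies
    -- in `H`; hence it is zero.
    have hcen : ∀ x : L, ⁅⁅e, f⁆, x⁆ = 0 := by
      intro x
      obtain ⟨s, d, hd, rfl⟩ := hdiag.exists_sum x
      rw [lie_sum]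
      refine Finset.sum_eq_zero fun β _ ↦ ?_
      have h1 : ⁅⁅e, f⁆, d β⁆ = β ⟨_, hc⟩ • d β := mem_weight.1 (hd β) ⟨_, hc⟩
      have h2 : ∀ m : ℕ, (toEnd k L L ⁅e, f⁆ ^ m) (d β) = β ⟨_, hc⟩ ^ m • d β := by
        intro m
        induction m with
        | zero => simp
        | succ m ih =>
          rw [pow_succ', Module.End.mul_apply, ih, map_smul, toEnd_apply_apply, h1, smul_smul,
            pow_succ]
      have h3 := h2 n
      rw [hn, LinearMap.zero_apply] at h3
      rw [h1]
      rcases smul_eq_zero.1 h3.symm with h | h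
      · rw [eq_zero_of_pow_eq_zero h, zero_smul]
      · rw [h, smul_zero]
    obtain ⟨J, hJ⟩ := exists_isCompl (LieAlgebra.center k L)
    have hcent : ⁅e, f⁆ ∈ LieAlgebra.center k L := by
      rw [LieModule.mem_maxTrivSubmodule]
      intro x
      rw [← lie_skew, hcen, neg_zero]
    -- Choosing `h` with `α h ≠ 0`, the bracket `[h, e] = α(h) e` removes the central component of
    -- `e`. Then `[e, f]` lies both in the centre and in its complement.
    have heJ : e ∈ J := by
      obtain ⟨z, hz, j, hj, hzj⟩ := (LieSubmodule.mem_sup _ _ _).1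
        (hJ.sup_eq_top ▸ LieSubmodule.mem_top e : e ∈ LieAlgebra.center k L ⊔ J)
      obtain ⟨h, hh⟩ := exists_ne_zero_of_ne_zero hα
      have h1 : α h • e ∈ J := by
        rw [← mem_weight.1 he h, ← hzj, lie_add, (LieModule.mem_maxTrivSubmodule k L L z).1 hz, zero_add]
        exact J.lie_mem hj
      exact ((J : Submodule k L).smul_mem_iff hh).1 h1
    have h2 : ⁅e, f⁆ ∈ LieAlgebra.center k L ⊓ J := ⟨hcent, by
      rw [← lie_skew]
      exact neg_mem (J.lie_mem heJ)⟩
    rwa [hJ.inf_eq_bot, LieSubmodule.mem_bot] at h2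
  -- If a root vector in the radical of the Killing form had a coroot, that coroot would be
  -- orthogonal to itself and act by zero on `L`, against `[c, e] = 2e`.
  have hker : ∀ α : Dual k H, α ≠ 0 → ∀ e ∈ jointEig (opRep L H) α,
      (∀ y, traceForm k L L e y = 0) → ∀ f ∈ jointEig (opRep L H) (-α), ⁅e, f⁆ = 0 := by
    intro α hα e he hκ
    refine hvanish α hα e he fun f hf c hc ↦ ?_
    by_contra hαc
    have t : IsSl2Triple (((2 / α c) • c : H) : L) e ((2 / α c) • f) := by
      have h2 : α ((2 / α c) • c) = 2 := by rw [map_smul, smul_eq_mul, div_mul_cancel₀ _ hαc]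
      refine ⟨fun h ↦ ?_, ?_, ?_, ?_⟩
      · rw [Submodule.coe_eq_zero] at h
        rw [h, map_zero] at h2
        exact two_ne_zero h2.symm
      · rw [lie_smul, hc]
        rfl
      · rw [mem_weight.1 he, h2, ofNat_smul_eq_nsmul]
      · rw [lie_smul, mem_weight.1 hf, LinearMap.neg_apply, h2, ← ofNat_smul_eq_nsmul k, neg_smul,
          smul_neg, smul_comm]
    have h0 : ⁅(((2 / α c) • c : H) : L), e⁆ = 0 := by
      refine IsSl2Triple.lie_eq_zero_of_trace hdiag t (isNilpotent_of_weight hdiag hfin hα he)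
        (isNilpotent_of_weight hdiag hfin (neg_ne_zero.2 hα) (Submodule.smul_mem _ _ hf)) ?_ e
      conv_lhs => enter [1]; rw [← t.lie_e_f]
      rw [traceForm_apply_lie_apply, hκ]
    rw [t.lie_h_e_smul k, smul_eq_zero_iff_right two_ne_zero] at h0
    exact t.e_ne_zero h0
  by_contra! hbad
  have hbad' := hvanish α hα e he hbad
  -- Only the root space of `-α` could pair nontrivially with `e`. Its elements commute with `e`, so
  -- the product of the adjoint operators is nilpotent.
  have hκe : ∀ y, traceForm k L L e y = 0 := by
    intro y
    obtain ⟨s, d, hd, rfl⟩ := hdiag.exists_sum y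
    rw [map_sum]
    refine Finset.sum_eq_zero fun β _ ↦ ?_
    by_cases hβ : β = -α
    · have h1 : ⁅e, d β⁆ = 0 := hbad' _ (hβ ▸ hd β)
      have h2 : Commute (toEnd k L L e) (toEnd k L L (d β)) := LinearMap.ext fun u ↦ by
        have := lie_lie e (d β) u
        rw [h1, zero_lie] at this
        exact (sub_eq_zero.1 this.symm)
      have hn : IsNilpotent (toEnd k L L e) :=
        Module.End.isNilpotent_iff_of_finite.2 (isNilpotent_of_weight hdiag hfin hα he)
      exact (LinearMap.isNilpotent_trace_of_isNilpotent (h2.isNilpotent_mul_right hn)).eq_zero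
    · obtain ⟨h, hh⟩ := exists_ne_zero_of_ne_zero (sub_ne_zero.2 hβ)
      have h1 := traceForm_apply_lie_apply k L L e h (d β)
      rw [← lie_skew, mem_weight.1 he, mem_weight.1 (hd β), map_neg, map_smul, map_smul,
        LinearMap.neg_apply, LinearMap.smul_apply, neg_eq_iff_add_eq_zero, ← add_smul] at h1
      refine (smul_eq_zero.1 h1).resolve_left ?_
      rw [LinearMap.sub_apply, LinearMap.neg_apply, sub_neg_eq_add] at hh
      rwa [add_comm]
  let κ := LinearMap.ker (traceForm k L L)
  have hκ : ∀ x : L, ∀ y ∈ κ, ⁅x, y⁆ ∈ κ := by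
    intro x y hy
    rw [LinearMap.mem_ker] at hy ⊢
    ext z
    rw [traceForm_apply_lie_apply', hy]
    simp
  -- The root vectors in the radical of the Killing form span an ideal: by `hker`, brackets that
  -- would have weight zero vanish. A complement of this ideal is then shown to contain `H`.
  let K : LieIdeal k L :=
    { toSubmodule := ⨆ (α : Dual k H) (_ : α ≠ 0), jointEig (opRep L H) α ⊓ κ
      lie_mem := by
        intro x m hm
        obtain ⟨s, d, hd, rfl⟩ := hdiag.exists_sum x
        rw [sum_lie]
        refine Submodule.sum_mem _ fun γ _ ↦ ?_
        have hle : (⨆ (α : Dual k H) (_ : α ≠ 0), jointEig (opRep L H) α ⊓ κ) ≤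
            (⨆ (α : Dual k H) (_ : α ≠ 0), jointEig (opRep L H) α ⊓ κ).comap
              (toEnd k L L (d γ)) := by
          refine iSup₂_le fun α hα m hm ↦ ?_
          rw [Submodule.mem_comap, toEnd_apply_apply]
          by_cases h0 : γ + α = 0
          · have h1 := hker α hα m hm.1 (LinearMap.congr_fun (LinearMap.mem_ker.1 hm.2)) (d γ)
              (eq_neg_of_add_eq_zero_left h0 ▸ hd γ)
            rw [← lie_skew, h1, neg_zero]
            exact zero_mem _
          · exact Submodule.mem_iSup_of_mem _ (Submodule.mem_iSup_of_mem h0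
              ⟨lie_mem_weight (hd γ) hm.1, hκ _ _ hm.2⟩)
        exact hle hm }
  have heK : e ∈ K := Submodule.mem_iSup_of_mem α (Submodule.mem_iSup_of_mem hα
    ⟨he, LinearMap.mem_ker.2 (LinearMap.ext hκe)⟩)
  obtain ⟨J, hJ⟩ := exists_isCompl K
  have hdisj : ∀ x ∈ K, x ∈ J → x = 0 := fun x hx hx' ↦ by
    have : x ∈ K ⊓ J := ⟨hx, hx'⟩
    rwa [hJ.inf_eq_bot, LieSubmodule.mem_bot] at this
  obtain ⟨h, hh⟩ := exists_ne_zero_of_ne_zero hα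
  have hhJ : (h : L) ∈ J := by
    obtain ⟨z, hz, j, hj, hzj⟩ := (LieSubmodule.mem_sup _ _ _).1
      (hJ.sup_eq_top ▸ LieSubmodule.mem_top (h : L) : (h : L) ∈ K ⊔ J)
    -- As `H` is abelian, `[y, z] = -[y, j]` lies in both `K` and `J`, so `z` has weight zero; but
    -- `K` lies in the sum of the nonzero weight spaces.
    have hz0 : z = 0 := by
      refine eq_zero_of_mem_iSup (ρ := opRep L H) (P := fun α ↦ α ≠ 0) (ν := 0) (by simp)
        (mem_weight.2 fun y ↦ ?_) ?_
      · rw [LinearMap.zero_apply, zero_smul]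
        refine hdisj _ (K.lie_mem hz) ?_
        have h1 := hab y y.2 h h.2
        rw [← hzj, lie_add, add_eq_zero_iff_eq_neg] at h1
        rw [h1]
        exact neg_mem (J.lie_mem hj)
      · have hle : (K : Submodule k L) ≤ ⨆ (α : Dual k H) (_ : α ≠ 0), jointEig (opRep L H) α :=
          iSup₂_mono fun _ _ ↦ inf_le_left
        exact hle hz
    rw [hz0, zero_add] at hzj
    exact hzj ▸ hj
  have h1 : ⁅(h : L), e⁆ = 0 := hdisj _ (K.lie_mem heK) (by
    rw [← lie_skew]
    exact neg_mem (J.lie_mem hhJ))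
  rw [mem_weight.1 he] at h1
  exact (smul_ne_zero hh he0) h1

end Coroot

end WeylSuper

namespace WeylSuper

open Module LieModule LieSuperalgebra

/-! ### The reductive part as a Lie algebra -/

section EvenSub

variable {k : Type*} {g : Type*} [Field k] [AddCommGroup g] [Module k g]
  [LieSuperalgebra k g] {r : Submodule k g}

/-- `r` is a subalgebra of the even part. -/
structure IsEvenSubalgebra (r : Submodule k g) : Prop where
  even : r ≤ part k g 0
  closed : ∀ x ∈ r, ∀ y ∈ r, sbracket (k := k) x y ∈ r

/-- A subalgebra of the even part, as a Lie algebra. -/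
def EvenSub (_ : IsEvenSubalgebra r) : Type _ := r

variable (hr : IsEvenSubalgebra r)

instance : AddCommGroup (EvenSub hr) := inferInstanceAs (AddCommGroup r)

instance : Module k (EvenSub hr) := inferInstanceAs (Module k r)

instance [FiniteDimensional k g] : FiniteDimensional k (EvenSub hr) :=
  inferInstanceAs (FiniteDimensional k r)

/-- The inclusion of a subalgebra. -/
def evenIncl : EvenSub hr →ₗ[k] g := r.subtype

theorem evenIncl_injective : Function.Injective (evenIncl hr) := Subtype.val_injective

theorem evenIncl_mem (x : EvenSub hr) : evenIncl hr x ∈ r := x.2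

theorem exists_evenIncl {x : g} (hx : x ∈ r) : ∃ y : EvenSub hr, evenIncl hr y = x := ⟨⟨x, hx⟩, rfl⟩

theorem skew_of_even {x y : g} (hx : x ∈ part k g 0) (hy : y ∈ part k g 0) :
    sbracket (k := k) x y = - sbracket (k := k) y x := by
  simpa [superSign] using skew (k := k) 0 0 x y hx hy

instance [CharZero k] : LieRing (EvenSub hr) where
  bracket x y := ⟨sbracket (k := k) (evenIncl hr x) (evenIncl hr y), hr.closed _ x.2 _ y.2⟩
  add_lie x y z := evenIncl_injective hr (by
    change sbracket (k := k) (evenIncl hr (x + y)) (evenIncl hr z) = sbracket (k := k) _ _ +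
      sbracket (k := k) _ _
    rw [map_add, map_add, LinearMap.add_apply])
  lie_add x y z := evenIncl_injective hr (by
    change sbracket (k := k) (evenIncl hr x) (evenIncl hr (y + z)) = sbracket (k := k) _ _ +
      sbracket (k := k) _ _
    rw [map_add, map_add])
  lie_self x := evenIncl_injective hr (by
    change sbracket (k := k) (evenIncl hr x) (evenIncl hr x) = 0
    have h := skew_of_even (hr.even x.2) (hr.even x.2)
    rw [eq_neg_iff_add_eq_zero, ← two_smul k] at h
    exact (smul_eq_zero_iff_right two_ne_zero).1 h)
  leibniz_lie x y z := evenIncl_injective hr (by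
    change sbracket (k := k) (evenIncl hr x) (sbracket (k := k) (evenIncl hr y) (evenIncl hr z)) =
      sbracket (k := k) (sbracket (k := k) (evenIncl hr x) (evenIncl hr y)) (evenIncl hr z) +
        sbracket (k := k) (evenIncl hr y) (sbracket (k := k) (evenIncl hr x) (evenIncl hr z))
    simpa [superSign] using jacobi (k := k) 0 0 (evenIncl hr x) (evenIncl hr y) (evenIncl hr z)
      (hr.even x.2) (hr.even y.2))

theorem evenIncl_lie [CharZero k] (x y : EvenSub hr) :
    evenIncl hr ⁅x, y⁆ = sbracket (k := k) (evenIncl hr x) (evenIncl hr y) := rfl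

instance [CharZero k] : LieAlgebra k (EvenSub hr) where
  lie_smul c x y := evenIncl_injective hr (by
    rw [evenIncl_lie, map_smul, map_smul, map_smul, evenIncl_lie])

theorem isEvenSubalgebra_part : IsEvenSubalgebra (part k g 0) := by
  refine ⟨le_rfl, fun x hx y hy ↦ ?_⟩
  rw [mem_superPart] at *
  rw [parity_sbracket, hx, hy]
  simp

/-- If the even part is reductive, its ideals have complements. -/
theorem complementedLattice_of_evenPartReductive [CharZero k] (h : EvenPartReductive k g) :
    ComplementedLattice (LieIdeal k (EvenSub (isEvenSubalgebra_part (k := k) (g := g)))) := by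
  set hp := isEvenSubalgebra_part (k := k) (g := g)
  refine ⟨fun I ↦ ?_⟩
  obtain ⟨J, hJ, hJi, hinf, hsup⟩ := h ((I : Submodule k (EvenSub hp)).map (evenIncl hp))
    (by rintro _ ⟨x, -, rfl⟩; exact x.2) (by
      rintro x hx _ ⟨y, hy, rfl⟩
      obtain ⟨x, rfl⟩ := exists_evenIncl hp hx
      exact ⟨⁅x, y⁆, I.lie_mem hy, rfl⟩)
  refine ⟨{ toSubmodule := J.comap (evenIncl hp), lie_mem := fun {x y} hy ↦ hJi _ x.2 _ hy },
    ?_, ?_⟩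
  · rw [disjoint_iff, eq_bot_iff]
    rintro x ⟨hx, hx'⟩
    have : evenIncl hp x ∈ (I : Submodule k (EvenSub hp)).map (evenIncl hp) ⊓ J := ⟨⟨x, hx, rfl⟩, hx'⟩
    rw [hinf, Submodule.mem_bot] at this
    rw [LieSubmodule.mem_bot]
    exact evenIncl_injective hp (this.trans (map_zero _).symm)
  · rw [codisjoint_iff, eq_top_iff]
    intro x _
    have : evenIncl hp x ∈ (I : Submodule k (EvenSub hp)).map (evenIncl hp) ⊔ J :=
      hsup.ge (evenIncl_mem hp x)
    obtain ⟨_, ⟨y, hy, rfl⟩, z, hz, hyz⟩ := Submodule.mem_sup.1 this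
    rw [LieSubmodule.mem_sup]
    obtain ⟨z, rfl⟩ := exists_evenIncl hp (hJ hz)
    exact ⟨y, hy, z, hz, evenIncl_injective hp hyz⟩

end EvenSub

/-! ### The Cartan subalgebra inside `r`, and splitness for classical types and `sl(n, n)`. -/

section Cartan

variable {k g : Type u} [Field k] [AddCommGroup g] [Module k g]
  [LieSuperalgebra k g] {r : Submodule k g} (T : TriangularDecomposition r)
  (hr : IsEvenSubalgebra r)

/-- The Cartan subalgebra, as a subspace of the Lie algebra `r`. -/
def cartanSub : Submodule k (EvenSub hr) := T.h.comap (evenIncl hr)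

/-- The two versions of the Cartan subalgebra are equivalent. -/
def cartanEquiv : cartanSub T hr ≃ₗ[k] T.h := Submodule.comapSubtypeEquivOfLe T.h_le

theorem coe_cartanEquiv (y : cartanSub T hr) :
    (cartanEquiv T hr y : g) = evenIncl hr (y : EvenSub hr) := rfl

/-- The equivalence between the weights of the two versions of the Cartan subalgebra. -/
def weightEquiv : Dual k (cartanSub T hr) ≃ₗ[k] Dual k T.h :=
  (cartanEquiv T hr).symm.dualMap

theorem weightEquiv_apply (α : Dual k (cartanSub T hr)) (y : cartanSub T hr) :
    weightEquiv T hr α (cartanEquiv T hr y) = α y := by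
  simp [weightEquiv]

theorem mem_rootSpace_weightEquiv [CharZero k] {α : Dual k (cartanSub T hr)} {x : EvenSub hr} :
    evenIncl hr x ∈ rootSpace T.h (weightEquiv T hr α) ↔
      x ∈ jointEig (opRep (EvenSub hr) (cartanSub T hr)) α := by
  rw [mem_rootSpace, mem_weight, (cartanEquiv T hr).surjective.forall]
  refine forall_congr' fun y ↦ ?_
  rw [weightEquiv_apply, coe_cartanEquiv, ← evenIncl_lie, ← map_smul]
  exact (evenIncl_injective hr).eq_iff

theorem cartanSub_lie [CharZero k] (x : EvenSub hr) (hx : x ∈ cartanSub T hr) (y : EvenSub hr)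
    (hy : y ∈ cartanSub T hr) : ⁅x, y⁆ = 0 :=
  evenIncl_injective hr (T.sbracket_h hx hy)

/-- The Cartan subalgebra acts diagonalizably on all of `g`, and diagonalizability passes to the
stable subspace `r`. -/
theorem isDiag_evenSub [CharZero k] : IsDiag (opRep (EvenSub hr) (cartanSub T hr)) := by
  let ρ : cartanSub T hr →ₗ[k] End k g :=
    (sbracket (k := k) (L := g)) ∘ₗ T.h.subtype ∘ₗ (cartanEquiv T hr : cartanSub T hr →ₗ[k] T.h)
  have h : IsDiag ρ := by
    refine eq_top_iff.2 (T.iSup_rootSpace.ge.trans (iSup_le fun α x hx ↦ ?_))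
    refine Submodule.mem_iSup_of_mem ((weightEquiv T hr).symm α) (mem_jointEig.2 fun y ↦ ?_)
    rw [← weightEquiv_apply T hr, LinearEquiv.apply_symm_apply]
    exact mem_rootSpace.1 hx _
  exact h.of_injective (evenIncl hr) (evenIncl_injective hr) fun _ _ ↦ rfl

theorem zeroWeight_le [CharZero k] : jointEig (opRep (EvenSub hr) (cartanSub T hr)) 0 ≤ cartanSub T hr := by
  intro x hx
  rw [← mem_rootSpace_weightEquiv, map_zero, T.rootSpace_zero] at hx
  exact hx

/-- `r` is split if it has a faithful representation whose trace form is nondegenerate. -/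
theorem isSplit_of_trace [IsAlgClosed k] [CharZero k] {V : Type*} [AddCommGroup V] [Module k V]
    [FiniteDimensional k V] (ρ : EvenSub hr →ₗ[k] End k V)
    (hρ : ∀ x y, ρ ⁅x, y⁆ = ρ x * ρ y - ρ y * ρ x)
    (nd : ∀ x, (∀ y, LinearMap.trace k V (ρ x * ρ y) = 0) → x = 0) : IsSplit (cartanSub T hr) :=
  ⟨cartanSub_lie T hr, isDiag_evenSub T hr, zeroWeight_le T hr, fun _ hα _ he he0 ↦
    exists_coroot_of_trace (cartanSub_lie T hr) (isDiag_evenSub T hr) (zeroWeight_le T hr) ρ hρ nd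
      hα he he0⟩

theorem isSplit_of_evenPartReductive [IsAlgClosed k] [CharZero k] [FiniteDimensional k g]
    (h : EvenPartReductive k g) (hrp : r = part k g 0) : IsSplit (cartanSub T hr) := by
  subst hrp
  have := complementedLattice_of_evenPartReductive h
  exact ⟨cartanSub_lie T hr, isDiag_evenSub T hr, zeroWeight_le T hr, fun _ hα _ he he0 ↦
    exists_coroot_of_complementedLattice (cartanSub_lie T hr) (isDiag_evenSub T hr)
      (zeroWeight_le T hr) hα he he0⟩

/-- The ordinary trace form of the natural representation, as opposed to the supertrace form, is
nondegenerate on the even part. A block diagonal matrix orthogonal to the even part is tested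
against off-diagonal matrix units and against pairs of diagonal units, one in each block. -/
theorem isSplit_of_slnn [IsAlgClosed k] [CharZero k] {n : ℕ}
    {φ : g →ₗ[k] Matrix (Fin n ⊕ Fin n) (Fin n ⊕ Fin n) k} (hφ : IsSuperEmbedding (matrixParity k n) φ)
    (hrange : LinearMap.range φ = slnn k n) (hrp : r = part k g 0) : IsSplit (cartanSub T hr) := by
  let ρ : EvenSub hr →ₗ[k] End k (Fin n ⊕ Fin n → k) :=
    (Matrix.toLin' : _ ≃ₗ[k] _).toLinearMap ∘ₗ φ ∘ₗ evenIncl hr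
  have htr : ∀ x y, LinearMap.trace k _ (ρ x * ρ y) =
      (φ (evenIncl hr x) * φ (evenIncl hr y)).trace := by
    intro x y
    have : ρ x * ρ y = Matrix.toLin' (φ (evenIncl hr x) * φ (evenIncl hr y)) :=
      (Matrix.toLin'_mul _ _).symm
    rw [this, Matrix.trace_toLin'_eq]
  refine isSplit_of_trace T hr ρ (fun x y ↦ ?_) fun x hx ↦ ?_
  · have h1 : φ (evenIncl hr ⁅x, y⁆) = φ (evenIncl hr x) * φ (evenIncl hr y) -
        φ (evenIncl hr y) * φ (evenIncl hr x) := by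
      rw [evenIncl_lie, hφ.map_sbracket 0 0 _ _ (hr.even (evenIncl_mem hr x))
        (hr.even (evenIncl_mem hr y))]
      simp [superSign]
    change Matrix.toLin' (φ (evenIncl hr ⁅x, y⁆)) = _
    rw [h1, map_sub, Matrix.toLin'_mul, Matrix.toLin'_mul]
    rfl
  · have hmem : ∀ A B : Matrix (Fin n) (Fin n) k, A.trace = B.trace →
        ((φ (evenIncl hr x)).toBlocks₁₁ * A).trace + ((φ (evenIncl hr x)).toBlocks₂₂ * B).trace = 0 := by
      intro A B hAB
      have h1 : Matrix.fromBlocks A 0 0 B ∈ slnn k n := by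
        change (Matrix.fromBlocks A 0 0 B).toBlocks₁₁.trace = (Matrix.fromBlocks A 0 0 B).toBlocks₂₂.trace
        simpa using hAB
      obtain ⟨y, hy⟩ := hrange.ge h1
      have hyr : y ∈ r := by
        rw [hrp, mem_superPart]
        simp only [ZMod.val_zero, pow_zero, one_smul]
        refine hφ.injective ?_
        rw [hφ.map_parity, hy]
        simp [matrixParity, Matrix.fromBlocks_multiply]
      obtain ⟨y, rfl⟩ := exists_evenIncl hr hyr
      have h2 := hx y
      rw [htr, hy, ← Matrix.fromBlocks_toBlocks (φ (evenIncl hr x)), Matrix.fromBlocks_multiply] at h2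
      simpa [Matrix.trace, Fintype.sum_sum_type] using h2
    have hxe : matrixParity k n (φ (evenIncl hr x)) = φ (evenIncl hr x) := by
      rw [← hφ.map_parity, TriangularDecomposition.parity_eq_of_even (hr.even (evenIncl_mem hr x))]
    have hxs : (φ (evenIncl hr x)).toBlocks₁₁.trace = (φ (evenIncl hr x)).toBlocks₂₂.trace :=
      (hrange.le ⟨_, rfl⟩ : φ (evenIncl hr x) ∈ slnn k n)
    refine evenIncl_injective hr (hφ.injective ?_)
    rw [map_zero, map_zero]
    generalize φ (evenIncl hr x) = X at hmem hxe hxs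
    obtain ⟨A, B, C, D, rfl⟩ : ∃ A B C D, X = Matrix.fromBlocks A B C D :=
      ⟨_, _, _, _, (Matrix.fromBlocks_toBlocks X).symm⟩
    simp only [Matrix.toBlocks_fromBlocks₁₁, Matrix.toBlocks_fromBlocks₂₂] at hmem hxs
    have hneg : ∀ {M : Matrix (Fin n) (Fin n) k}, -M = M → M = 0 := by
      intro M hM
      ext i j
      have := congrFun (congrFun hM i) j
      rw [Matrix.neg_apply, neg_eq_iff_add_eq_zero, ← two_mul] at this
      simpa using this
    have hBC : B = 0 ∧ C = 0 := by
      simp only [matrixParity, LinearMap.comp_apply, LinearMap.mulRight_apply,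
        LinearMap.mulLeft_apply, Matrix.fromBlocks_multiply] at hxe
      have h1 := Matrix.fromBlocks_inj.1 hxe
      simp only [mul_one, mul_zero, add_zero, zero_add, one_mul, zero_mul, mul_neg, neg_mul,
        neg_zero, neg_neg] at h1
      exact ⟨hneg h1.2.1, hneg h1.2.2.1⟩
    have hoff : ∀ i j, i ≠ j → A i j = 0 ∧ D i j = 0 := by
      intro i j hij
      have ht : (Matrix.single j i (1 : k)).trace = 0 := Matrix.trace_single_eq_of_ne _ _ _ hij.symm
      have h1 := hmem (Matrix.single j i 1) 0 (by rw [ht, Matrix.trace_zero])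
      have h2 := hmem 0 (Matrix.single j i 1) (by rw [ht, Matrix.trace_zero])
      rw [mul_zero, Matrix.trace_zero, Matrix.trace_mul_single] at h1 h2
      simpa using And.intro h1 h2
    have hdiag : ∀ i j, A i i + D j j = 0 := by
      intro i j
      have h1 := hmem (Matrix.single i i 1) (Matrix.single j j 1) (by
        rw [Matrix.trace_single_eq_same, Matrix.trace_single_eq_same])
      rw [Matrix.trace_mul_single, Matrix.trace_mul_single] at h1
      simpa using h1
    -- The relations `A i i + D j j = 0` for all `i` and `j` make the blocks the scalars `a` and
    -- `-a`; equality of their traces gives `2na = 0`.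
    have hA : ∀ i, A i i = 0 := by
      intro i
      have h1 : ∀ j, D j j = - A i i := fun j ↦ eq_neg_of_add_eq_zero_right (hdiag i j)
      have h2 : ∀ j, A j j = A i i := fun j ↦ by
        have := hdiag j i
        rw [h1, add_neg_eq_zero] at this
        exact this
      simp only [Matrix.trace, Matrix.diag_apply, h1, h2, Finset.sum_const, Finset.card_univ,
        Fintype.card_fin, nsmul_eq_mul] at hxs
      have h3 : (n : k) ≠ 0 := by
        have := i.pos
        exact_mod_cast this.ne'
      have h4 : (2 * n : k) * A i i = 0 := by linear_combination hxs
      simpa [h3] using h4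
    have hA0 : A = 0 := by
      ext i j
      by_cases hij : i = j
      · rw [hij, hA, Matrix.zero_apply]
      · exact (hoff i j hij).1
    have hD0 : D = 0 := by
      ext i j
      by_cases hij : i = j
      · have := hdiag j j
        rw [hA, zero_add] at this
        rw [hij, this, Matrix.zero_apply]
      · exact (hoff i j hij).2
    rw [hA0, hBC.1, hBC.2, hD0, Matrix.fromBlocks_zero]

end Cartan

end WeylSuper

namespace WeylSuper

open Module LieSuperalgebra

/-! ### Superderivations of the Grassmann algebra -/

section Grassmann

variable {k : Type*} [Field k] {n : ℕ}

theorem superSign_comm (i j : ZMod 2) : superSign k i j = superSign k j i := by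
  rw [superSign, superSign, mul_comm]

theorem neg_one_pow_val (i j : ZMod 2) :
    (-1 : k) ^ (i + j).val = (-1) ^ i.val * (-1) ^ j.val := by
  rw [← pow_add, ZMod.val_add, ← neg_one_pow_eq_pow_mod_two]

theorem superSign_add_left (i j p : ZMod 2) :
    superSign k (i + j) p = superSign k i p * superSign k j p := by
  simp only [superSign, pow_mul, neg_one_pow_val, mul_pow]

theorem superSign_add_right (i j p : ZMod 2) :
    superSign k p (i + j) = superSign k p i * superSign k p j := by
  rw [superSign_comm, superSign_add_left, superSign_comm i, superSign_comm j]

theorem superSign_mul_self (i j : ZMod 2) : superSign k i j * superSign k i j = 1 := by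
  rw [superSign, ← mul_pow]
  simp

theorem exists_add_superPart [CharZero k] {V : Type*} [AddCommGroup V] [Module k V]
    {σ : V →ₗ[k] V} (hσ : ∀ x, σ (σ x) = x) (x : V) :
    ∃ y ∈ superPart σ 0, ∃ z ∈ superPart σ 1, x = y + z := by
  refine ⟨(2⁻¹ : k) • (x + σ x), Submodule.smul_mem _ _ ?_, (2⁻¹ : k) • (x - σ x),
    Submodule.smul_mem _ _ ?_, ?_⟩
  · rw [mem_superPart]; simp [hσ, add_comm]
  · rw [mem_superPart]; simp [hσ, ZMod.val_one]
  · rw [← smul_add, add_add_sub_cancel, ← two_smul k x, smul_smul,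
      inv_mul_cancel₀ two_ne_zero, one_smul]

theorem superPart_inf [CharZero k] {V : Type*} [AddCommGroup V] [Module k V]
    {σ : V →ₗ[k] V} {x : V} (h : x ∈ superPart σ 0) (h' : x ∈ superPart σ 1) : x = 0 := by
  rw [mem_superPart] at h h'
  rw [h, ZMod.val_zero, ZMod.val_one, pow_zero, pow_one, one_smul, neg_one_smul,
    eq_neg_iff_add_eq_zero, ← two_smul k] at h'
  exact (smul_eq_zero_iff_right two_ne_zero).1 h'

theorem grassmannParity_ι (v : Fin n → k) :
    grassmannParity k n (ExteriorAlgebra.ι k v) = - ExteriorAlgebra.ι k v :=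
  CliffordAlgebra.involute_ι v

theorem grassmannParity_mul (x y : Grassmann k n) :
    grassmannParity k n (x * y) = grassmannParity k n x * grassmannParity k n y :=
  map_mul CliffordAlgebra.involute x y

theorem grassmannParity_algebraMap (c : k) :
    grassmannParity k n (algebraMap k _ c) = algebraMap k _ c :=
  AlgHom.commutes CliffordAlgebra.involute c

theorem grassmannParity_grassmannParity (x : Grassmann k n) :
    grassmannParity k n (grassmannParity k n x) = x :=
  CliffordAlgebra.involute_involutive x

theorem endParity_apply (D : End k (Grassmann k n)) (x : Grassmann k n) :
    endParity k n D x = grassmannParity k n (D (grassmannParity k n x)) := rfl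

/-- Moving a generator past `b` produces the sign of the degree of `b`, which the parity involution
records without assuming `b` homogeneous. -/
theorem ι_mul_eq (v : Fin n → k) (b : Grassmann k n) :
    ExteriorAlgebra.ι k v * b = grassmannParity k n b * ExteriorAlgebra.ι k v := by
  induction b using ExteriorAlgebra.induction with
  | algebraMap c => rw [grassmannParity_algebraMap, Algebra.commutes]
  | ι w =>
    rw [grassmannParity_ι, neg_mul, eq_neg_iff_add_eq_zero, ExteriorAlgebra.ι_add_mul_swap]
  | mul a b ha hb => rw [grassmannParity_mul, ← mul_assoc, ha, mul_assoc, hb, mul_assoc]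
  | add a b ha hb => rw [map_add, mul_add, ha, hb, add_mul]

theorem mul_eq_of_even {b : Grassmann k n} (hb : grassmannParity k n b = b) (a : Grassmann k n) :
    a * b = b * a := by
  induction a using ExteriorAlgebra.induction with
  | algebraMap c => rw [Algebra.commutes]
  | ι w => rw [ι_mul_eq, hb]
  | mul a b ha hb => rw [mul_assoc, hb, ← mul_assoc, ha, mul_assoc]
  | add a b ha hb => rw [add_mul, ha, hb, mul_add]

theorem mul_eq_of_odd {b : Grassmann k n} (hb : grassmannParity k n b = -b) (a : Grassmann k n) :
    a * b = b * grassmannParity k n a := by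
  induction a using ExteriorAlgebra.induction with
  | algebraMap c => rw [grassmannParity_algebraMap, Algebra.commutes]
  | ι w => rw [ι_mul_eq, hb, grassmannParity_ι, neg_mul, mul_neg]
  | mul a b ha hb => rw [grassmannParity_mul, mul_assoc, hb, ← mul_assoc, ha, mul_assoc]
  | add a b ha hb => rw [add_mul, ha, hb, map_add, mul_add]

/-- Supercommutativity of the Grassmann algebra. -/
theorem mul_superComm {i p : ZMod 2} {x y : Grassmann k n} (hx : x ∈ superPart (grassmannParity k n) i)
    (hy : y ∈ superPart (grassmannParity k n) p) : x * y = superSign k i p • (y * x) := by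
  rw [mem_superPart] at hx hy
  obtain rfl | rfl := (by decide : ∀ p : ZMod 2, p = 0 ∨ p = 1) p
  · rw [mul_eq_of_even (by simpa using hy)]
    simp [superSign]
  · rw [mul_eq_of_odd (by simpa [ZMod.val_one] using hy), hx]
    simp [superSign, ZMod.val_one]

theorem partialD_ι (j : Fin n) (v : Fin n → k) :
    partialD k n j (ExteriorAlgebra.ι k v) = algebraMap k _ (v j) :=
  CliffordAlgebra.contractLeft_ι _ _ v

theorem partialD_partialD (i j : Fin n) (x : Grassmann k n) :
    partialD k n i (partialD k n j x) = - partialD k n j (partialD k n i x) :=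
  CliffordAlgebra.contractLeft_comm _ _ _

theorem partialD_algebraMap_mul (j : Fin n) (c : k) (x : Grassmann k n) :
    partialD k n j (algebraMap k _ c * x) = algebraMap k _ c * partialD k n j x :=
  CliffordAlgebra.contractLeft_algebraMap_mul _ _ _

theorem partialD_algebraMap (j : Fin n) (c : k) :
    partialD k n j (algebraMap k _ c) = 0 :=
  CliffordAlgebra.contractLeft_algebraMap _ _ _

theorem partialD_ι_mul (j : Fin n) (v : Fin n → k) (x : Grassmann k n) :
    partialD k n j (ExteriorAlgebra.ι k v * x) = v j • x - ExteriorAlgebra.ι k v * partialD k n j x :=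
  CliffordAlgebra.contractLeft_ι_mul _ _ _

theorem partialD_mul (j : Fin n) (x y : Grassmann k n) :
    partialD k n j (x * y) = partialD k n j x * y + grassmannParity k n x * partialD k n j y := by
  induction x using ExteriorAlgebra.induction generalizing y with
  | algebraMap c =>
    rw [partialD_algebraMap_mul, partialD_algebraMap, grassmannParity_algebraMap, zero_mul, zero_add]
  | ι v =>
    rw [partialD_ι_mul, partialD_ι, grassmannParity_ι, ← Algebra.smul_def, neg_mul, sub_eq_add_neg]
  | mul a b ha hb =>
    rw [mul_assoc, ha, hb, ha, grassmannParity_mul]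
    noncomm_ring
  | add a b ha hb =>
    rw [add_mul, map_add, ha, hb, map_add, map_add]
    noncomm_ring

theorem grassmannParity_partialD (j : Fin n) (x : Grassmann k n) :
    grassmannParity k n (partialD k n j x) = - partialD k n j (grassmannParity k n x) := by
  induction x using ExteriorAlgebra.induction with
  | algebraMap c => simp only [partialD_algebraMap, grassmannParity_algebraMap, map_zero, neg_zero]
  | ι v => simp only [partialD_ι, grassmannParity_algebraMap, grassmannParity_ι, map_neg, neg_neg]
  | mul a b ha hb =>
    simp only [partialD_mul, grassmannParity_mul, map_add, ha, hb, grassmannParity_grassmannParity]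
    noncomm_ring
  | add a b ha hb => simp only [map_add, ha, hb, neg_add]

theorem mem_superPart_endParity {i : ZMod 2} {D : End k (Grassmann k n)} :
    D ∈ superPart (endParity k n) i ↔
      ∀ x, grassmannParity k n (D x) = (-1 : k) ^ i.val • D (grassmannParity k n x) := by
  rw [mem_superPart]
  constructor
  · intro h x
    rw [← LinearMap.smul_apply, ← h, endParity_apply, grassmannParity_grassmannParity]
  · intro h
    refine LinearMap.ext fun x ↦ ?_
    rw [endParity_apply, h, grassmannParity_grassmannParity, LinearMap.smul_apply]

theorem apply_mem_superPart {i j : ZMod 2} {D : End k (Grassmann k n)}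
    (hD : D ∈ superPart (endParity k n) i) {x : Grassmann k n}
    (hx : x ∈ superPart (grassmannParity k n) j) : D x ∈ superPart (grassmannParity k n) (i + j) := by
  rw [mem_superPart] at hx
  rw [mem_superPart, mem_superPart_endParity.1 hD, hx, map_smul, smul_smul, neg_one_pow_val]

theorem partialD_mem_superDer (j : Fin n) : partialD k n j ∈ superDer k n 1 := by
  refine ⟨mem_superPart_endParity.2 fun x ↦ ?_, fun p x y hx ↦ ?_⟩
  · rw [grassmannParity_partialD, ZMod.val_one, pow_one, neg_one_smul]
  · rw [partialD_mul, mem_superPart.1 hx, superSign, ZMod.val_one, one_mul, smul_mul_assoc]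

theorem mulLeft_comp_mem_superDer {i j : ZMod 2} {f : Grassmann k n}
    (hf : f ∈ superPart (grassmannParity k n) i) {D : End k (Grassmann k n)}
    (hD : D ∈ superDer k n j) : LinearMap.mulLeft k f * D ∈ superDer k n (i + j) := by
  refine ⟨mem_superPart_endParity.2 fun x ↦ ?_, fun p x y hx ↦ ?_⟩
  · change grassmannParity k n (f * D x) = (-1 : k) ^ (i + j).val • (f * D _)
    rw [grassmannParity_mul, mem_superPart_endParity.1 hD.1, mem_superPart.1 hf, smul_mul_smul_comm,
      neg_one_pow_val]
  · change f * D (x * y) = f * D x * y + superSign k (i + j) p • (x * (f * D y))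
    rw [hD.2 p x y hx, mul_add, mul_smul_comm, ← mul_assoc f x, mul_superComm hf hx, smul_mul_assoc,
      smul_smul, superSign_add_left, mul_comm (superSign k j p), mul_assoc, mul_assoc]

/-- This places `H(n)`, which is defined as a span of supercommutators, inside `W(n)`. -/
theorem commutator_mem_superDer {i j : ZMod 2} {D D' : End k (Grassmann k n)}
    (hD : D ∈ superDer k n i) (hD' : D' ∈ superDer k n j) :
    D * D' - superSign k i j • (D' * D) ∈ superDer k n (i + j) := by
  have h1 := mem_superPart_endParity.1 hD.1
  have h2 := mem_superPart_endParity.1 hD'.1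
  refine ⟨mem_superPart_endParity.2 fun x ↦ ?_, fun p x y hx ↦ ?_⟩
  · simp only [LinearMap.sub_apply, LinearMap.smul_apply, End.mul_apply, map_sub, map_smul, h1, h2,
      smul_sub, smul_smul, neg_one_pow_val]
    congr 2
    ring
  · have e1 := hD.2 _ _ y (apply_mem_superPart hD'.1 hx)
    have e2 := hD'.2 _ _ y (apply_mem_superPart hD.1 hx)
    have e3 := superSign_mul_self (k := k) i j
    simp only [LinearMap.sub_apply, LinearMap.smul_apply, End.mul_apply, hD.2 p x _ hx,
      hD'.2 p x _ hx, map_add, map_smul, e1, e2, superSign_add_right, superSign_add_left, smul_add,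
      smul_smul, sub_mul, mul_sub, smul_mul_assoc, mul_smul_comm, smul_sub, superSign_comm j i]
    have e4 : superSign k i j * (superSign k i j * superSign k j p) = superSign k j p := by
      rw [← mul_assoc, e3, one_mul]
    rw [e4, mul_comm (superSign k j p) (superSign k i p), mul_comm (superSign k i j) (_ * _)]
    abel

/-- An even superderivation is a derivation. -/
theorem superDer_zero_mul [CharZero k] {D : End k (Grassmann k n)} (hD : D ∈ superDer k n 0)
    (x y : Grassmann k n) : D (x * y) = D x * y + x * D y := by
  obtain ⟨x, hx, x', hx', rfl⟩ := exists_add_superPart grassmannParity_grassmannParity x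
  rw [add_mul, map_add, hD.2 0 x y hx, hD.2 1 x' y hx', map_add]
  simp only [superSign, ZMod.val_zero, zero_mul, pow_zero, one_smul, add_mul]
  abel

theorem superDer_zero_algebraMap [CharZero k] {D : End k (Grassmann k n)} (hD : D ∈ superDer k n 0)
    (c : k) : D (algebraMap k _ c) = 0 := by
  have h := superDer_zero_mul hD 1 1
  rw [mul_one, mul_one, one_mul, left_eq_add] at h
  rw [Algebra.algebraMap_eq_smul_one, map_smul, h, smul_zero]

/-- A derivation is determined by its values on generators. Degree zero elements are thereby
identified with endomorphisms of `kⁿ`. -/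
theorem superDer_zero_ext [CharZero k] {D D' : End k (Grassmann k n)} (hD : D ∈ superDer k n 0)
    (hD' : D' ∈ superDer k n 0)
    (h : ∀ v, D (ExteriorAlgebra.ι k v) = D' (ExteriorAlgebra.ι k v)) : D = D' := by
  refine LinearMap.ext fun x ↦ ?_
  induction x using ExteriorAlgebra.induction with
  | algebraMap c => rw [superDer_zero_algebraMap hD, superDer_zero_algebraMap hD']
  | ι v => exact h v
  | mul a b ha hb => rw [superDer_zero_mul hD, superDer_zero_mul hD', ha, hb]
  | add a b ha hb => rw [map_add, map_add, ha, hb]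

theorem superDer_zero_mem_degreeZero [CharZero k] {D : End k (Grassmann k n)}
    (hD : D ∈ superDer k n 0) (h : ∀ v, D (ExteriorAlgebra.ι k v) ∈
      LinearMap.range (ExteriorAlgebra.ι k (M := Fin n → k))) : D ∈ degreeZero k n := by
  refine (Submodule.mem_iInf _).2 fun p ↦ ?_
  induction p with
  | zero =>
    rintro x hx
    change x ∈ (LinearMap.range (ExteriorAlgebra.ι k (M := Fin n → k)) ^ 0) at hx
    rw [pow_zero, Submodule.mem_one] at hx
    obtain ⟨c, rfl⟩ := hx
    rw [Submodule.mem_comap, superDer_zero_algebraMap hD]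
    exact zero_mem _
  | succ p ih =>
    change LinearMap.range (ExteriorAlgebra.ι k (M := Fin n → k)) ^ (p + 1) ≤
      Submodule.comap D (LinearMap.range (ExteriorAlgebra.ι k (M := Fin n → k)) ^ (p + 1))
    rw [pow_succ, Submodule.mul_le]
    rintro x hx _ ⟨v, rfl⟩
    rw [Submodule.mem_comap, superDer_zero_mul hD]
    exact add_mem (Submodule.mul_mem_mul (ih hx) ⟨v, rfl⟩) (Submodule.mul_mem_mul hx (h v))

/-- The odd summand of an even element of `W(n)` is both even and odd, hence zero. -/
theorem mem_superDer_zero_of_even [CharZero k] {D : End k (Grassmann k n)} (hD : D ∈ cartanW k n)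
    (hD' : D ∈ superPart (endParity k n) 0) : D ∈ superDer k n 0 := by
  obtain ⟨D₀, h₀, D₁, h₁, rfl⟩ := Submodule.mem_sup.1 hD
  have : D₁ = 0 := superPart_inf ((Submodule.add_mem_iff_right _ h₀.1).1 hD') h₁.1
  rwa [this, add_zero]

/-! ### The derivation of the Grassmann algebra induced by an endomorphism -/

/-- The derivation of the Grassmann algebra which extends the linear map `Y`. -/
def grassmannDer (Y : End k (Fin n → k)) : End k (Grassmann k n) :=
  ∑ j, LinearMap.mulLeft k (ExteriorAlgebra.ι k (Y (Pi.single j 1))) * partialD k n j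

theorem grassmannDer_apply (Y : End k (Fin n → k)) (x : Grassmann k n) : grassmannDer Y x =
    ∑ j, ExteriorAlgebra.ι k (Y (Pi.single j 1)) * partialD k n j x := by
  simp [grassmannDer]

theorem grassmannDer_ι (Y : End k (Fin n → k)) (v : Fin n → k) :
    grassmannDer Y (ExteriorAlgebra.ι k v) = ExteriorAlgebra.ι k (Y v) := by
  rw [grassmannDer_apply]
  conv_rhs => rw [pi_eq_sum_univ' v, map_sum, map_sum]
  refine Finset.sum_congr rfl fun j _ ↦ ?_
  rw [partialD_ι, ← Algebra.commutes, ← Algebra.smul_def, ← map_smul, ← map_smul]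

theorem grassmannDer_mem_superDer (Y : End k (Fin n → k)) : grassmannDer Y ∈ superDer k n 0 := by
  refine Submodule.sum_mem _ fun j _ ↦ ?_
  have h := mulLeft_comp_mem_superDer (i := 1) (f := ExteriorAlgebra.ι k (Y (Pi.single j 1)))
    (by rw [mem_superPart, grassmannParity_ι, ZMod.val_one, pow_one, neg_one_smul])
    (partialD_mem_superDer (k := k) j)
  exact h

theorem grassmannDer_mem_cartanW (Y : End k (Fin n → k)) : grassmannDer Y ∈ cartanW k n :=
  Submodule.mem_sup_left (grassmannDer_mem_superDer Y)

theorem grassmannDer_mem_degreeZero [CharZero k] (Y : End k (Fin n → k)) :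
    grassmannDer Y ∈ degreeZero k n :=
  superDer_zero_mem_degreeZero (grassmannDer_mem_superDer Y) fun v ↦
    ⟨Y v, (grassmannDer_ι Y v).symm⟩

/-- Through this identity the divergence conditions defining `S(n)` become trace conditions in
degree zero. -/
theorem divergence_grassmannDer (Y : End k (Fin n → k)) :
    divergence k n (grassmannDer Y) = algebraMap k _ (LinearMap.trace k _ Y) := by
  rw [LinearMap.trace_eq_matrix_trace k (Pi.basisFun k (Fin n)), Matrix.trace, map_sum]
  simp only [divergence, LinearMap.sum_apply, LinearMap.comp_apply, LinearMap.applyₗ_apply_apply, xi]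
  refine Finset.sum_congr rfl fun j _ ↦ ?_
  rw [grassmannDer_ι, partialD_ι]
  simp

/-- The derivation extending `Y` acts on the top form by the trace. Applying `∂ⱼ` to `v ∧ ξ₁⋯ξₙ = 0`
shows that `v ∧ ∂ⱼ(ξ₁⋯ξₙ)` is `vⱼ` times the top form; summing over `j` gives the trace. -/
theorem grassmannDer_xiTop (Y : End k (Fin n → k)) :
    grassmannDer Y (xiTop k n) = LinearMap.trace k _ Y • xiTop k n := by
  have h0 : ∀ v, ExteriorAlgebra.ι k v * xiTop k n = 0 := by
    intro v
    rw [pi_eq_sum_univ' v, map_sum, Finset.sum_mul]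
    refine Finset.sum_eq_zero fun i _ ↦ ?_
    have h := ExteriorAlgebra.ι_mul_prod_list (R := k) (fun i : Fin n ↦ (Pi.single i 1 : Fin n → k)) i
    rw [map_smul, smul_mul_assoc]
    exact (congrArg (v i • ·) h).trans (smul_zero _)
  have h1 : ∀ (v : Fin n → k) j, ExteriorAlgebra.ι k v * partialD k n j (xiTop k n) =
      v j • xiTop k n := by
    intro v j
    have h := congrArg (partialD k n j) (h0 v)
    rw [partialD_ι_mul, map_zero, sub_eq_zero] at h
    exact h.symm
  rw [grassmannDer_apply, LinearMap.trace_eq_matrix_trace k (Pi.basisFun k (Fin n)), Matrix.trace,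
    Finset.sum_smul]
  refine Finset.sum_congr rfl fun j _ ↦ ?_
  rw [h1]
  simp

theorem algebraMapInv_xiTop (hn : 0 < n) : ExteriorAlgebra.algebraMapInv (xiTop k n) = 0 := by
  rw [xiTop, map_list_prod]
  refine List.prod_eq_zero (List.mem_map.2 ⟨xi k n ⟨0, hn⟩, ?_, ?_⟩)
  · rw [List.mem_ofFn]
    exact ⟨_, rfl⟩
  · simp [xi, ExteriorAlgebra.algebraMapInv]

theorem eq_zero_of_trace_mul {X : End k (Fin n → k)}
    (h : ∀ Y, LinearMap.trace k _ (X * Y) = 0) : X = 0 := by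
  have h1 : LinearMap.toMatrix' X = 0 := by
    rw [Matrix.ext_iff_trace_mul_right]
    intro M
    rw [zero_mul, Matrix.trace_zero, ← h (Matrix.toLin' M), ← Matrix.trace_toLin'_eq,
      Matrix.toLin'_mul, Matrix.toLin'_toMatrix']
    rfl
  exact (LinearEquiv.map_eq_zero_iff _).1 h1

/-- A traceless `X` is orthogonal to the scalars, so each `Y` may be replaced by its traceless part.
-/
theorem eq_zero_of_trace_mul_of_trace_eq_zero [CharZero k] (hn : n ≠ 0) {X : End k (Fin n → k)}
    (hX : LinearMap.trace k _ X = 0)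
    (h : ∀ Y, LinearMap.trace k _ Y = 0 → LinearMap.trace k _ (X * Y) = 0) : X = 0 := by
  refine eq_zero_of_trace_mul fun Y ↦ ?_
  have h1 := h (Y - (LinearMap.trace k _ Y / n) • 1) (by
    have : (n : k) ≠ 0 := by exact_mod_cast hn
    rw [map_sub, map_smul, LinearMap.trace_one]
    simp [this])
  rwa [mul_sub, mul_smul_comm, mul_one, map_sub, map_smul, hX, smul_zero, sub_zero] at h1

end Grassmann

end WeylSuper

namespace WeylSuper

open Module LieSuperalgebra

/-! ### The reductive parts of the Lie superalgebras of Cartan type -/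

section Hamiltonian

variable {k : Type*} [Field k] {n : ℕ}

/-- The superderivation `D_x = ∑ᵢ ∂ᵢ(x) ∂ᵢ`. -/
def hamiltonian (k : Type*) [Field k] (n : ℕ) : Grassmann k n →ₗ[k] End k (Grassmann k n) :=
  ∑ i, LinearMap.mulRight k (partialD k n i) ∘ₗ (LinearMap.mul k (Grassmann k n)) ∘ₗ partialD k n i

theorem hamiltonian_eq (x : Grassmann k n) :
    hamiltonian k n x = ∑ i, LinearMap.mulLeft k (partialD k n i x) * partialD k n i := by
  rw [hamiltonian, LinearMap.sum_apply]
  rfl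

theorem hamiltonian_apply (x y : Grassmann k n) :
    hamiltonian k n x y = ∑ i, partialD k n i x * partialD k n i y := by
  rw [hamiltonian_eq, LinearMap.sum_apply]
  rfl

theorem hamiltonian_ι (x : Grassmann k n) (m : Fin n) :
    hamiltonian k n x (xi k n m) = partialD k n m x := by
  rw [hamiltonian_apply, Finset.sum_eq_single m]
  · rw [xi, partialD_ι, Pi.single_eq_same, map_one, mul_one]
  · intro b _ hb
    rw [xi, partialD_ι, Pi.single_eq_of_ne hb, map_zero, mul_zero]
  · simp

theorem partialD_mem_superPart {i : ZMod 2} {x : Grassmann k n}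
    (hx : x ∈ superPart (grassmannParity k n) i) (m : Fin n) :
    partialD k n m x ∈ superPart (grassmannParity k n) (1 + i) :=
  apply_mem_superPart (partialD_mem_superDer m).1 hx

theorem hamiltonian_mem_superDer {i : ZMod 2} {x : Grassmann k n}
    (hx : x ∈ superPart (grassmannParity k n) i) : hamiltonian k n x ∈ superDer k n i := by
  rw [hamiltonian_eq]
  refine Submodule.sum_mem _ fun j _ ↦ ?_
  have h := mulLeft_comp_mem_superDer (partialD_mem_superPart hx j) (partialD_mem_superDer j)
  rwa [add_right_comm, (by decide : (1 : ZMod 2) + 1 = 0), zero_add] at h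

/-- A homogeneous Hamiltonian superderivation comes from a homogeneous element. -/
theorem exists_hamiltonian [CharZero k] {i : ZMod 2} {D : End k (Grassmann k n)}
    (hD : D ∈ cartanHtilde k n ⊓ superPart (endParity k n) i) :
    ∃ x ∈ superPart (grassmannParity k n) i, hamiltonian k n x = D := by
  obtain ⟨⟨x, hx⟩, hi⟩ := hD
  obtain ⟨x₀, h₀, x₁, h₁, rfl⟩ := exists_add_superPart grassmannParity_grassmannParity x
  change hamiltonian k n _ = D at hx
  rw [map_add] at hx
  have e₀ := (hamiltonian_mem_superDer h₀).1
  have e₁ := (hamiltonian_mem_superDer h₁).1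
  obtain rfl | rfl := (by decide : ∀ p : ZMod 2, p = 0 ∨ p = 1) i
  · refine ⟨x₀, h₀, ?_⟩
    rw [← hx] at hi
    rw [← hx, superPart_inf ((Submodule.add_mem_iff_right _ e₀).1 hi) e₁, add_zero]
  · refine ⟨x₁, h₁, ?_⟩
    rw [← hx] at hi
    rw [← hx, superPart_inf e₀ ((Submodule.add_mem_iff_left _ e₁).1 hi), zero_add]

theorem superDer_le_cartanW (i : ZMod 2) : superDer k n i ≤ cartanW k n := by
  obtain rfl | rfl := (by decide : ∀ p : ZMod 2, p = 0 ∨ p = 1) i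
  · exact le_sup_left
  · exact le_sup_right

theorem cartanH_le_cartanW [CharZero k] : cartanH k n ≤ cartanW k n := by
  refine Submodule.span_le.2 ?_
  rintro _ ⟨i, j, D, D', hD, hD', rfl⟩
  obtain ⟨x, hx, rfl⟩ := exists_hamiltonian hD
  obtain ⟨y, hy, rfl⟩ := exists_hamiltonian hD'
  exact superDer_le_cartanW _
    (commutator_mem_superDer (hamiltonian_mem_superDer hx) (hamiltonian_mem_superDer hy))

/-- Elements of `H(n)` have a potential. -/
theorem exists_potential [CharZero k] {D : End k (Grassmann k n)} (hD : D ∈ cartanH k n) :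
    ∃ z, ∀ m, D (xi k n m) = partialD k n m z := by
  induction hD using Submodule.span_induction with
  | zero => exact ⟨0, fun m ↦ by simp⟩
  | add D D' _ _ h h' =>
    obtain ⟨z, hz⟩ := h
    obtain ⟨z', hz'⟩ := h'
    exact ⟨z + z', fun m ↦ by rw [LinearMap.add_apply, hz, hz', map_add]⟩
  | smul c D _ h =>
    obtain ⟨z, hz⟩ := h
    exact ⟨c • z, fun m ↦ by rw [LinearMap.smul_apply, hz, map_smul]⟩
  | mem D hD =>
    obtain ⟨i, j, D, D', hD, hD', rfl⟩ := hD
    obtain ⟨x, hx, rfl⟩ := exists_hamiltonian hD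
    obtain ⟨y, hy, rfl⟩ := exists_hamiltonian hD'
    -- Up to the sign of `x`, the potential of the supercommutator of `D_x` and `D_y` is the Poisson
    -- bracket of `x` and `y`.
    refine ⟨(-1 : k) ^ i.val • ∑ l, partialD k n l x * partialD k n l y, fun m ↦ ?_⟩
    rw [LinearMap.sub_apply, LinearMap.smul_apply, End.mul_apply, End.mul_apply, hamiltonian_ι,
      hamiltonian_ι, hamiltonian_apply, hamiltonian_apply, map_smul, map_sum, Finset.smul_sum,
      Finset.smul_sum, ← Finset.sum_sub_distrib]
    refine Finset.sum_congr rfl fun l _ ↦ ?_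
    have hxl := partialD_mem_superPart hx l
    have hyl := partialD_mem_superPart hy l
    have hxml := partialD_mem_superPart hxl m
    have h1 := mul_superComm hxml hyl
    rw [partialD_mul, mem_superPart.1 hxl, h1, partialD_partialD l m y, partialD_partialD l m x]
    rw [← add_assoc, (by decide : (1 : ZMod 2) + 1 = 0), zero_add, superSign_add_right,
      neg_one_pow_val, smul_add, smul_smul, smul_mul_assoc, smul_smul]
    have h2 : superSign k i 1 = (-1) ^ i.val := by rw [superSign, ZMod.val_one, mul_one]
    have h3 : ((-1 : k) ^ i.val) * (-1) ^ i.val = 1 := by rw [← mul_pow]; simp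
    rw [h2, ZMod.val_one, pow_one, ← mul_assoc, h3, mul_left_comm, h3]
    simp only [one_mul, mul_one, mul_neg, neg_one_smul, smul_neg, sub_neg_eq_add]
    abel

/-- The infinitesimal rotation in the plane spanned by two basis vectors. -/
def rotation (k : Type*) [Field k] {n : ℕ} (a b : Fin n) : End k (Fin n → k) :=
  LinearMap.single k (fun _ ↦ k) b ∘ₗ LinearMap.proj a - LinearMap.single k (fun _ ↦ k) a ∘ₗ LinearMap.proj b

theorem rotation_apply (a b : Fin n) (v : Fin n → k) :
    rotation k a b v = Pi.single b (v a) - Pi.single a (v b) := rfl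

/-- The infinitesimal rotation is the Hamiltonian superderivation of the quadratic element `ξₐ ξ_b`.
-/
theorem grassmannDer_rotation_mem (a b : Fin n) :
    grassmannDer (rotation k a b) ∈ cartanHtilde k n ⊓ superPart (endParity k n) 0 := by
  refine ⟨⟨xi k n a * xi k n b, ?_⟩, (grassmannDer_mem_superDer _).1⟩
  change hamiltonian k n _ = _
  rw [hamiltonian_eq, grassmannDer]
  refine Finset.sum_congr rfl fun j _ ↦ ?_
  congr 2
  rw [xi, xi, partialD_ι_mul, partialD_ι, ← Algebra.commutes, ← Algebra.smul_def, ← map_smul,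
    ← map_smul, ← map_sub, rotation_apply]
  have hs : ∀ (b : Fin n) (c : k), (Pi.single b c : Fin n → k) = c • Pi.single b 1 := fun b c ↦ by
    rw [← Pi.single_smul', smul_eq_mul, mul_one]
  have hc : ∀ a : Fin n, (Pi.single a 1 : Fin n → k) j = (Pi.single j 1 : Fin n → k) a := fun a ↦ by
    simp [Pi.single_apply, eq_comm]
  rw [hc, hc, ← hs, ← hs]

/-- The commutator of rotations in two planes sharing the axis `b` is the rotation in the plane of
`c` and `a`. A third index is needed because `H(n)` consists of sums of supercommutators. -/
theorem grassmannDer_rotation_mem_cartanH [CharZero k] {a b c : Fin n} (hab : a ≠ b) (hbc : b ≠ c)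
    (hac : a ≠ c) : grassmannDer (rotation k c a) ∈ cartanH k n := by
  refine Submodule.subset_span ⟨0, 0, _, _, grassmannDer_rotation_mem a b,
    grassmannDer_rotation_mem b c, ?_⟩
  have hm := commutator_mem_superDer (grassmannDer_mem_superDer (rotation k a b))
    (grassmannDer_mem_superDer (rotation k b c))
  rw [add_zero] at hm
  refine superDer_zero_ext (grassmannDer_mem_superDer _) hm fun v ↦ ?_
  have hs : superSign k 0 0 = 1 := by simp [superSign]
  rw [hs, one_smul, LinearMap.sub_apply, End.mul_apply, End.mul_apply]
  simp only [grassmannDer_ι]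
  rw [← map_sub]
  congr 1
  ext l
  simp only [rotation_apply]
  by_cases hl : l = a <;>
    simp [Pi.single_apply, hab, hbc, hac, hab.symm, hbc.symm, hac.symm, hl]

end Hamiltonian

/-! ### Splitness of the degree zero part, type by type. -/

section CartanType

variable {k g : Type u} [Field k] [AddCommGroup g] [Module k g]
  [LieSuperalgebra k g] {r : Submodule k g}

theorem isEvenSubalgebra_degreeZero {n : ℕ} {φ : g →ₗ[k] End k (Grassmann k n)}
    (hφ : IsSuperEmbedding (endParity k n) φ) (hr : r = (degreeZero k n).comap φ)
    (he : r ≤ part k g 0) : IsEvenSubalgebra r := by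
  refine ⟨he, fun x hx y hy ↦ ?_⟩
  have h := hφ.map_sbracket 0 0 x y (he hx) (he hy)
  have hs : superSign k 0 0 = 1 := by simp [superSign]
  rw [hs, one_smul] at h
  rw [hr, Submodule.mem_comap] at hx hy ⊢
  rw [h]
  simp only [degreeZero, Submodule.mem_iInf] at hx hy ⊢
  intro p z hz
  have h1 : φ x (φ y z) ∈ ⋀[k]^p (Fin n → k) := hx p (hy p hz)
  have h2 : φ y (φ x z) ∈ ⋀[k]^p (Fin n → k) := hy p (hx p hz)
  exact sub_mem h1 h2

/-- A criterion for the degree zero part of a Lie superalgebra of Cartan type to be split. -/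
theorem isSplit_of_degreeZero [IsAlgClosed k] [CharZero k] (T : TriangularDecomposition r)
    (hr : IsEvenSubalgebra r) {n : ℕ} {φ : g →ₗ[k] End k (Grassmann k n)}
    (hφ : IsSuperEmbedding (endParity k n) φ) (hrφ : r = (degreeZero k n).comap φ)
    (hW : LinearMap.range φ ≤ cartanW k n)
    (nd : ∀ X : End k (Fin n → k), grassmannDer X ∈ LinearMap.range φ →
      (∀ Y, grassmannDer Y ∈ LinearMap.range φ → LinearMap.trace k _ (X * Y) = 0) → X = 0) :
    IsSplit (cartanSub T hr) := by
  -- The representation is the action on the degree one part `kⁿ` of the Grassmann algebra.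
  let ρ : EvenSub hr →ₗ[k] End k (Fin n → k) :=
    { toFun := fun x ↦ ExteriorAlgebra.ιInv ∘ₗ φ (evenIncl hr x) ∘ₗ ExteriorAlgebra.ι k
      map_add' := fun x y ↦ by
        rw [map_add, map_add, LinearMap.add_comp, LinearMap.comp_add]
      map_smul' := fun c x ↦ by
        rw [map_smul, map_smul, LinearMap.smul_comp, LinearMap.comp_smul]; rfl }
  have hι : ∀ x v, φ (evenIncl hr x) (ExteriorAlgebra.ι k v) = ExteriorAlgebra.ι k (ρ x v) := by
    intro x v
    have h1 : φ (evenIncl hr x) ∈ degreeZero k n := hrφ.le (evenIncl_mem hr x)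
    have h2 := (Submodule.mem_iInf _).1 h1 1
    have h3 : ExteriorAlgebra.ι k v ∈ ⋀[k]^1 (Fin n → k) := by
      rw [ExteriorAlgebra.exteriorPower, pow_one]
      exact ⟨v, rfl⟩
    have h4 : φ (evenIncl hr x) (ExteriorAlgebra.ι k v) ∈ ⋀[k]^1 (Fin n → k) := h2 h3
    rw [ExteriorAlgebra.exteriorPower, pow_one] at h4
    obtain ⟨w, hw⟩ := h4
    change _ = ExteriorAlgebra.ι k (ExteriorAlgebra.ιInv (φ (evenIncl hr x) (ExteriorAlgebra.ι k v)))
    rw [← hw, ExteriorAlgebra.ι_leftInverse]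
  -- An even degree zero superderivation is the derivation extending its action on generators, so
  -- `ρ` is faithful and `r` is a Lie algebra of matrices.
  have hder : ∀ x, φ (evenIncl hr x) = grassmannDer (ρ x) := by
    intro x
    refine superDer_zero_ext (mem_superDer_zero_of_even (hW ⟨_, rfl⟩) ?_)
      (grassmannDer_mem_superDer _) fun v ↦ by rw [hι, grassmannDer_ι]
    rw [mem_superPart, ← hφ.map_parity,
      TriangularDecomposition.parity_eq_of_even (hr.even (evenIncl_mem hr x)), ZMod.val_zero,
      pow_zero, one_smul]
  refine isSplit_of_trace T hr ρ (fun x y ↦ ?_) fun x hx ↦ ?_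
  · refine LinearMap.ext fun v ↦ ExteriorAlgebra.ι_inj k _ _ |>.1 ?_
    have hs : superSign k 0 0 = 1 := by simp [superSign]
    rw [← hι, evenIncl_lie, hφ.map_sbracket 0 0 _ _ (hr.even (evenIncl_mem hr x))
      (hr.even (evenIncl_mem hr y)), hs, one_smul, LinearMap.sub_apply, LinearMap.sub_apply, map_sub]
    simp only [End.mul_apply, hι]
  · have h0 := nd (ρ x) (hder x ▸ ⟨_, rfl⟩) fun Y hY ↦ by
      obtain ⟨y, hy⟩ := hY
      have hyr : y ∈ r := by
        rw [hrφ, Submodule.mem_comap, hy]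
        exact grassmannDer_mem_degreeZero Y
      obtain ⟨y, rfl⟩ := exists_evenIncl hr hyr
      rw [← hx y]
      congr 2
      refine LinearMap.ext fun v ↦ ExteriorAlgebra.ι_inj k _ _ |>.1 ?_
      rw [← hι, hy, grassmannDer_ι]
    refine evenIncl_injective hr (hφ.injective ?_)
    rw [hder, h0, map_zero, map_zero]
    simp [grassmannDer]

/-- On `kⁿ` the degree zero parts act as all matrices for `W(n)`, as traceless ones for `S(n)` and
`S̃(n)`, and as skew-symmetric ones for `H(n)`; the trace form is nondegenerate in each case. The
classical types use complements of ideals, and `sl(n, n)` its natural representation. -/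
theorem exists_isSplit [IsAlgClosed k] [CharZero k] [FiniteDimensional k g]
    (hr : IsReductivePart r) (T : TriangularDecomposition r) :
    ∃ he : IsEvenSubalgebra r, IsSplit (cartanSub T he) := by
  cases hr with
  | classical _ h2 h3 =>
    have he : IsEvenSubalgebra r := h3 ▸ isEvenSubalgebra_part
    exact ⟨he, isSplit_of_evenPartReductive T he h2 h3⟩
  | slnn n φ _ h2 h3 h4 =>
    have he : IsEvenSubalgebra r := h4 ▸ isEvenSubalgebra_part
    exact ⟨he, isSplit_of_slnn T he h2 h3 h4⟩
  | cartanW n φ _ h2 h3 h4 =>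
    have he := isEvenSubalgebra_degreeZero h2 h4 T.r_even
    refine ⟨he, isSplit_of_degreeZero T he h2 h4 h3.le fun X _ h ↦ eq_zero_of_trace_mul fun Y ↦ ?_⟩
    exact h Y (h3 ▸ grassmannDer_mem_cartanW Y)
  | cartanS n φ hn h2 h3 h4 =>
    have he := isEvenSubalgebra_degreeZero h2 h4 T.r_even
    refine ⟨he, isSplit_of_degreeZero T he h2 h4 (h3.le.trans inf_le_left) fun X hX h ↦
      eq_zero_of_trace_mul_of_trace_eq_zero (by lia) ?_ fun Y hY ↦ h Y ?_⟩
    · rw [h3] at hX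
      have : divergence k n (grassmannDer X) = 0 := hX.2
      rwa [divergence_grassmannDer, ExteriorAlgebra.algebraMap_eq_zero_iff] at this
    · rw [h3]
      refine ⟨grassmannDer_mem_cartanW Y, ?_⟩
      change divergence k n (grassmannDer Y) = 0
      rw [divergence_grassmannDer, hY, map_zero]
  | cartanStilde n φ hn _ h2 h3 h4 =>
    have he := isEvenSubalgebra_degreeZero h2 h4 T.r_even
    refine ⟨he, isSplit_of_degreeZero T he h2 h4 (h3.le.trans inf_le_left) fun X hX h ↦
      eq_zero_of_trace_mul_of_trace_eq_zero (by lia) ?_ fun Y hY ↦ h Y ?_⟩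
    · rw [h3] at hX
      -- The scalar part of the relation defining `S̃(n)` is the trace, as the top form has no
      -- scalar part.
      have := congrArg ExteriorAlgebra.algebraMapInv (LinearMap.mem_ker.1 hX.2)
      rw [LinearMap.add_apply, LinearMap.comp_apply, divergence_grassmannDer,
        LinearMap.applyₗ_apply_apply, grassmannDer_xiTop, map_zero, map_add, map_smul,
        LinearMap.mulLeft_apply, map_mul, map_add, algebraMapInv_xiTop (by lia), map_one, smul_zero,
        add_zero, add_zero, one_mul, ExteriorAlgebra.algebraMap_leftInverse] at this
      exact this
    · rw [h3]
      refine ⟨grassmannDer_mem_cartanW Y, ?_⟩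
      refine LinearMap.mem_ker.2 ?_
      rw [LinearMap.add_apply, LinearMap.comp_apply, divergence_grassmannDer, hY,
        LinearMap.applyₗ_apply_apply, grassmannDer_xiTop, hY, map_zero, map_zero, zero_smul, add_zero]
  | cartanH n φ hn h2 h3 h4 =>
    have he := isEvenSubalgebra_degreeZero h2 h4 T.r_even
    refine ⟨he, isSplit_of_degreeZero T he h2 h4 (h3.le.trans cartanH_le_cartanW) fun X hX h ↦ ?_⟩
    rw [h3] at hX
    obtain ⟨z, hz⟩ := exists_potential hX
    -- The entries of `X` are second derivatives of the potential `z`, and the `∂ᵢ` anticommute, so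
    -- `X` is skew-symmetric.
    have hX' : ∀ i j, X (Pi.single j 1) i = - X (Pi.single i 1) j := by
      intro i j
      refine ExteriorAlgebra.algebraMap_leftInverse (Fin n → k) |>.injective ?_
      rw [map_neg, ← partialD_ι, ← partialD_ι, ← grassmannDer_ι, ← grassmannDer_ι]
      exact (congrArg _ (hz j)).trans ((partialD_partialD _ _ _).trans (congrArg _ (congrArg _ (hz i).symm)))
    have htr : ∀ a b, LinearMap.trace k _ (X * rotation k a b) =
        X (Pi.single b 1) a - X (Pi.single a 1) b := by
      intro a b
      rw [LinearMap.trace_eq_matrix_trace k (Pi.basisFun k (Fin n)), Matrix.trace]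
      simp only [Matrix.diag_apply, LinearMap.toMatrix_apply, Pi.basisFun_apply, Pi.basisFun_repr,
        End.mul_apply, rotation_apply, map_sub, Finsupp.sub_apply, Finset.sum_sub_distrib]
      congr 1
      · rw [Finset.sum_eq_single a]
        · simp
        · intro c _ hc
          simp [hc.symm]
        · simp
      · rw [Finset.sum_eq_single b]
        · simp
        · intro c _ hc
          simp [hc.symm]
        · simp
    have h0 : ∀ i j, X (Pi.single j 1) i = 0 := by
      intro i j
      by_cases hij : i = j
      · subst hij
        exact self_eq_neg.1 (hX' i i)
      -- The bound `4 ≤ n` supplies an index apart from `i` and `j`, so that a rotation in their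
      -- plane lies in `H(n)` and detects the entry of `X`.
      · obtain ⟨b, hb⟩ : ∃ b, b ∉ ({i, j} : Finset (Fin n)) := by
          by_contra! hb
          have := Finset.card_le_card (fun x _ ↦ hb x : Finset.univ ⊆ _)
          rw [Finset.card_univ, Fintype.card_fin] at this
          have := Finset.card_le_two (a := i) (b := j)
          lia
        simp only [Finset.mem_insert, Finset.mem_singleton, not_or] at hb
        have := h _ (h3 ▸ grassmannDer_rotation_mem_cartanH (Ne.symm hb.2) hb.1 (Ne.symm hij))
        rw [htr, hX' j i, sub_neg_eq_add, ← two_mul] at this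
        simpa using this
    refine (Pi.basisFun k (Fin n)).ext fun j ↦ ?_
    ext i
    rw [Pi.basisFun_apply, h0]
    rfl

end CartanType

end WeylSuper

namespace WeylSuper

open Module LieSuperalgebra

/-! ### The action of `g ⊗ A` on its modules -/

section Enveloping

variable {k L : Type u} [Field k] [AddCommGroup L] [Module k L] [LieSuperalgebra k L]

theorem adjoin_envι : Algebra.adjoin k (Set.range (envι k (L := L))) = ⊤ := by
  have h := congrArg (Subalgebra.map (RingQuot.mkAlgHom k (EnvRel k L)))
    (TensorAlgebra.adjoin_range_ι (R := k) (M := L))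
  rw [AlgHom.map_adjoin, Algebra.map_top, (AlgHom.range_eq_top _).2 (RingQuot.mkAlgHom_surjective k _),
    ← Set.range_comp] at h
  exact h

theorem env_smul_mem (M : SuperMod k L) {S : Submodule k M}
    (hS : ∀ t : L, ∀ m ∈ S, envι k t • m ∈ S) (u : SuperEnv k L) : ∀ m ∈ S, u • m ∈ S := by
  have hu : u ∈ Algebra.adjoin k (Set.range (envι k (L := L))) := by
    rw [adjoin_envι]
    trivial
  induction hu using Algebra.adjoin_induction with
  | mem u hu =>
    obtain ⟨t, rfl⟩ := hu
    exact hS t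
  | algebraMap c =>
    intro m hm
    rw [algebraMap_smul]
    exact S.smul_mem c hm
  | add u v _ _ hu hv =>
    intro m hm
    rw [add_smul]
    exact add_mem (hu m hm) (hv m hm)
  | mul u v _ _ hu hv =>
    intro m hm
    rw [mul_smul]
    exact hu _ (hv m hm)

/-- A subspace that is stable under `L` is a submodule. -/
def stableSubmodule (M : SuperMod k L) (S : Submodule k M)
    (hS : ∀ t : L, ∀ m ∈ S, envι k t • m ∈ S) : Submodule (SuperEnv k L) M where
  carrier := S
  zero_mem' := zero_mem S
  add_mem' := add_mem
  smul_mem' u m hm := env_smul_mem M hS u m hm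

end Enveloping

/-! ### Modules over `g ⊗ A` as Lie modules over `r`, and the action of root vectors. -/

section Action

variable {k g A : Type u} [Field k] [AddCommGroup g] [Module k g]
  [LieSuperalgebra k g] [CommRing A] [Algebra k A] {r : Submodule k g}

theorem smul_map_of_linear [CharZero k] {M N : SuperMod k (g ⊗[k] A)}
    (f : M →ₗ[SuperEnv k (g ⊗[k] A)] N) (c : k) (m : M) : f (c • m) = c • f m := by
  rw [← algebraMap_smul (SuperEnv k (g ⊗[k] A)) c m, map_smul, algebraMap_smul]

/-- Commutation of an even element of `g` with an element of `g ⊗ A`. -/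
theorem envOne_mul_envι [CharZero k] {z : g} (hz : z ∈ part k g 0) (x : g) (a : A) :
    envOne k A z * envι k (x ⊗ₜ[k] a) =
      envι k (x ⊗ₜ[k] a) * envOne k A z + envι k (sbracket (k := k) z x ⊗ₜ[k] a) := by
  have hpar : ∀ i : ZMod 2, ∀ x ∈ part k g i, envOne k A z * envι k (x ⊗ₜ[k] a) =
      envι k (x ⊗ₜ[k] a) * envOne k A z + envι k (sbracket (k := k) z x ⊗ₜ[k] a) := by
    intro i x hx
    have h := envι_mul k (tmul_mem_part hz (1 : A)) (tmul_mem_part hx a)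
    rw [sbracket_tmul, one_mul] at h
    simpa [envOne, superSign] using h
  obtain ⟨p, hp, q, hq, rfl⟩ := exists_add_superPart (parity_parity (k := k)) x
  rw [TensorProduct.add_tmul, map_add, mul_add, hpar 0 p hp, hpar 1 q hq, map_add,
    TensorProduct.add_tmul, map_add, add_mul]
  abel

variable [CharZero k] (hr : IsEvenSubalgebra r)

instance (M : SuperMod k (g ⊗[k] A)) : LieRingModule (EvenSub hr) M where
  bracket x m := envOne k A (evenIncl hr x) • m
  add_lie x y m := by
    change envOne k A (evenIncl hr (x + y)) • m = envOne k A _ • m + envOne k A _ • m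
    rw [map_add, map_add, add_smul]
  lie_add x m n := smul_add _ _ _
  leibniz_lie x y m := by
    change envOne k A (evenIncl hr x) • envOne k A (evenIncl hr y) • m =
      envOne k A (evenIncl hr ⁅x, y⁆) • m + envOne k A (evenIncl hr y) • envOne k A (evenIncl hr x) • m
    rw [evenIncl_lie, ← envOne_mul_envOne (hr.even (evenIncl_mem hr x))
      (hr.even (evenIncl_mem hr y)), sub_smul, mul_smul, mul_smul, sub_add_cancel]

theorem evenSub_lie (M : SuperMod k (g ⊗[k] A)) (x : EvenSub hr) (m : M) :
    ⁅x, m⁆ = envOne k A (evenIncl hr x) • m := rfl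

instance (M : SuperMod k (g ⊗[k] A)) : LieModule k (EvenSub hr) M where
  smul_lie c x m := by rw [evenSub_lie, map_smul, map_smul, smul_assoc, evenSub_lie]
  lie_smul c x m := by rw [evenSub_lie, evenSub_lie, smul_comm]

theorem isStable_lieSubmodule {M : SuperMod k (g ⊗[k] A)} (P : LieSubmodule k (EvenSub hr) M) :
    IsStable r (P : Submodule k M) := by
  intro x hx m hm
  obtain ⟨x, rfl⟩ := exists_evenIncl hr hx
  exact P.lie_mem hm

/-- A subspace stable under `r`, as a Lie submodule. -/
def IsStable.toLieSubmodule {M : SuperMod k (g ⊗[k] A)} {S : Submodule k M} (hS : IsStable r S) :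
    LieSubmodule k (EvenSub hr) M where
  toSubmodule := S
  lie_mem hm := hS _ (evenIncl_mem hr _) _ hm

variable (T : TriangularDecomposition r)

theorem mem_weightSpace_weightEquiv {M : SuperMod k (g ⊗[k] A)} {μ : Dual k (cartanSub T hr)} {m : M} :
    m ∈ weightSpace T M (weightEquiv T hr μ) ↔ m ∈ jointEig (opRep M (cartanSub T hr)) μ := by
  rw [mem_weight]
  change (∀ y : T.h, _) ↔ _
  rw [(cartanEquiv T hr).surjective.forall]
  refine forall_congr' fun y ↦ ?_
  rw [weightEquiv_apply, coe_cartanEquiv, evenSub_lie]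

theorem smul_mem_weightSpace {M : SuperMod k (g ⊗[k] A)} {α μ : Dual k T.h} {x : g}
    (hx : x ∈ rootSpace T.h α) (a : A) {m : M} (hm : m ∈ weightSpace T M μ) :
    envι k (x ⊗ₜ[k] a) • m ∈ weightSpace T M (μ + α) := by
  intro y
  rw [← mul_smul, envOne_mul_envι (T.h_even y.2), mem_rootSpace.1 hx, add_smul, mul_smul, hm y,
    smul_comm, ← TensorProduct.smul_tmul', map_smul, smul_assoc, LinearMap.add_apply, add_smul]

/-- The operators on `M` defined by the homogeneous elements of `g_α ⊗ A` with `α ∈ S`. -/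
def rootOps (M : SuperMod k (g ⊗[k] A)) (S : Set (Dual k T.h)) : Set (End k M) :=
  {f | ∃ α ∈ S, ∃ i, ∃ x ∈ rootSpace T.h α, x ∈ part k g i ∧ ∃ a : A,
    f = Algebra.lsmul k k M (envι k (x ⊗ₜ[k] a))}

/-- As `𝔥` is even, parity preserves root spaces, so the even and odd components of a root vector
are root vectors of the same weight. Hence `g ⊗ A` is spanned by homogeneous root vectors tensored
with elements of `A`. -/
theorem smul_mem_of_rootOps {M : SuperMod k (g ⊗[k] A)} {Z : Submodule k M}
    (hZ : ∀ f ∈ rootOps T M Set.univ, ∀ z ∈ Z, f z ∈ Z) (t : g ⊗[k] A) :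
    ∀ z ∈ Z, envι k t • z ∈ Z := by
  intro z hz
  induction t using TensorProduct.induction_on with
  | zero => rw [map_zero, zero_smul]; exact zero_mem _
  | add s t hs ht => rw [map_add, add_smul]; exact add_mem hs ht
  | tmul x a =>
    have hx : x ∈ ⨆ α, rootSpace T.h α := by rw [T.iSup_rootSpace]; trivial
    refine Submodule.iSup_induction _ (motive := fun x ↦ envι k (x ⊗ₜ[k] a) • z ∈ Z) hx
      (fun α x hx ↦ ?_) ?_ fun x y hx hy ↦ ?_
    · obtain ⟨p, hp, q, hq, h⟩ := exists_add_superPart (parity_parity (k := k)) x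
      have e : parity (k := k) x = p - q := by
        rw [h, map_add, mem_superPart.1 hp, mem_superPart.1 hq]
        simp [ZMod.val_one, sub_eq_add_neg]
      have h1 := T.parity_mem_rootSpace hx
      have hp' : (2 : k) • p ∈ rootSpace T.h α := by
        have : (2 : k) • p = x + parity (k := k) x := by rw [e, h, two_smul]; abel
        rw [this]
        exact add_mem hx h1
      have hq' : (2 : k) • q ∈ rootSpace T.h α := by
        have : (2 : k) • q = x - parity (k := k) x := by rw [e, h, two_smul]; abel
        rw [this]
        exact sub_mem hx h1
      rw [Submodule.smul_mem_iff _ two_ne_zero] at hp' hq'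
      rw [h, TensorProduct.add_tmul, map_add, add_smul]
      exact add_mem (hZ _ ⟨α, trivial, 0, p, hp', hp, a, rfl⟩ z hz)
        (hZ _ ⟨α, trivial, 1, q, hq', hq, a, rfl⟩ z hz)
    · rw [TensorProduct.zero_tmul, map_zero, zero_smul]
      exact zero_mem _
    · rw [TensorProduct.add_tmul, map_add, add_smul]
      exact add_mem hx hy

theorem sbracket_mem_rootSpace {α β : Dual k T.h} {x y : g} (hx : x ∈ rootSpace T.h α)
    (hy : y ∈ rootSpace T.h β) : sbracket (k := k) x y ∈ rootSpace T.h (α + β) := by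
  rw [mem_rootSpace] at *
  intro z
  obtain ⟨p, hp, q, hq, h⟩ := exists_add_superPart (parity_parity (k := k)) x
  have h0 := jacobi (k := k) 0 0 (z : g) p y (T.h_even z.2) hp
  have h1 := jacobi (k := k) 0 1 (z : g) q y (T.h_even z.2) hq
  have hs : ∀ i, superSign k 0 i = 1 := fun i ↦ by simp [superSign]
  rw [hs, one_smul] at h0 h1
  have h2 : sbracket (k := k) (z : g) (sbracket (k := k) x y) =
      sbracket (k := k) (sbracket (k := k) (z : g) x) y +
        sbracket (k := k) x (sbracket (k := k) (z : g) y) := by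
    rw [h]
    simp only [map_add, LinearMap.add_apply, h0, h1]
    abel
  rw [h2, hx, hy, map_smul, map_smul, LinearMap.smul_apply, LinearMap.add_apply, add_smul]

/-- If the subspace `Z` is generated from `Z₀` by the operators in `n⁻ ⊗ A`, and `Z₀` is stable under
`𝔥 ⊗ A` and annihilated by `n⁺ ⊗ A`, then `Z` is stable under `g ⊗ A`. -/
theorem rootOps_stable {M : SuperMod k (g ⊗[k] A)} {Z₀ Z : Submodule k M} (hZ₀ : Z₀ ≤ Z)
    (hN : ∀ f ∈ rootOps T M T.negRoots, ∀ z ∈ Z, f z ∈ Z)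
    (hmin : ∀ Z' : Submodule k M, Z₀ ≤ Z' →
      (∀ f ∈ rootOps T M T.negRoots, ∀ z ∈ Z', f z ∈ Z') → Z ≤ Z')
    (hB : ∀ f ∈ rootOps T M (insert 0 T.posRoots), ∀ z ∈ Z₀, f z ∈ Z) :
    ∀ f ∈ rootOps T M Set.univ, ∀ z ∈ Z, f z ∈ Z := by
  have hcase : ∀ f ∈ rootOps T M Set.univ, f ∈ Submodule.span k
      (rootOps T M T.negRoots ∪ rootOps T M (insert 0 T.posRoots)) := by
    rintro _ ⟨α, -, i, x, hx, hi, a, rfl⟩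
    by_cases hx0 : x = 0
    · rw [hx0, TensorProduct.zero_tmul, map_zero, map_zero]
      exact zero_mem _
    refine Submodule.subset_span ?_
    by_cases hα : α = 0
    · exact Or.inr ⟨α, Or.inl hα, i, x, hx, hi, a, rfl⟩
    have hne : rootSpace T.h α ≠ ⊥ := fun h ↦ hx0 (by rwa [h, Submodule.mem_bot] at hx)
    rcases lt_or_gt_of_ne (T.regular α hα hne) with h | h
    · exact Or.inl ⟨α, ⟨hα, hne, h⟩, i, x, hx, hi, a, rfl⟩
    · exact Or.inr ⟨α, Or.inr ⟨hα, hne, h⟩, i, x, hx, hi, a, rfl⟩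
  -- The scalar in `stable_of_commute` is here the supercommutation sign, and the bracket of two
  -- homogeneous root vectors is again one.
  have h1 := stable_of_commute (N := rootOps T M T.negRoots)
    (B := rootOps T M (insert 0 T.posRoots)) hZ₀ hN hmin hB (by
      rintro _ ⟨α, -, i, x, hx, hi, a, rfl⟩ _ ⟨β, -, j, y, hy, hj, b, rfl⟩
      refine ⟨superSign k i j, hcase _ ⟨α + β, trivial, i + j, sbracket (k := k) x y,
        sbracket_mem_rootSpace T hx hy, ?_, a * b, ?_⟩⟩
      · rw [mem_superPart] at *
        rw [parity_sbracket, hi, hj, map_smul, map_smul, LinearMap.smul_apply, smul_smul,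
          neg_one_pow_val, mul_comm]
      · have e := congrArg (Algebra.lsmul k k M.carrier)
          (envι_mul k (tmul_mem_part hi a) (tmul_mem_part hj b))
        rw [map_mul, map_add, map_smul, map_mul, sbracket_tmul] at e
        rw [e]
        abel)
  intro f hf z hz
  have h2 : Submodule.span k (rootOps T M T.negRoots ∪ rootOps T M (insert 0 T.posRoots)) ≤
      Z.comap (LinearMap.applyₗ z) := by
    refine Submodule.span_le.2 ?_
    rintro f (hf | hf)
    exacts [hN f hf z hz, h1 f hf z hz]
  exact h2 (hcase f hf)

end Action

end WeylSuper

namespace WeylSuper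

open Module LieSuperalgebra

/-! ### Finite semisimplicity over the reductive part -/

section WeightVector

variable {k L V : Type*} [Field k] [IsAlgClosed k] [CharZero k] [LieRing L] [LieAlgebra k L]
  [AddCommGroup V] [Module k V] [LieRingModule L V] [LieModule k L V]

/-- A commuting family of operators has a joint eigenvector. -/
theorem exists_jointEig_ne_bot {H : Submodule k L} (hH : ∀ x ∈ H, ∀ y ∈ H, ⁅x, y⁆ = 0)
    [FiniteDimensional k V] [Nontrivial V] : ∃ μ, jointEig (opRep V H) μ ≠ ⊥ := by
  let C : LieSubalgebra k L :=
    { H with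
      lie_mem' := fun {x y} hx hy ↦ by
        rw [hH x hx y hy]
        exact H.zero_mem }
  have : IsLieAbelian C := ⟨fun x y ↦ Subtype.ext (hH x x.2 y y.2)⟩
  obtain ⟨χ, hχ⟩ := LieModule.exists_nontrivial_weightSpace_of_isSolvable k C V
  obtain ⟨⟨v, hv⟩, hv0⟩ := exists_ne (0 : LieModule.weightSpace V χ)
  refine ⟨χ, Submodule.ne_bot_iff _ |>.2 ⟨v, mem_weight.2 fun y ↦ ?_, fun h ↦ hv0 (Subtype.ext h)⟩⟩
  exact (LieModule.mem_weightSpace χ v).1 hv y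

end WeightVector

section Semisimple

variable {k g A : Type u} [Field k] [CharZero k] [AddCommGroup g] [Module k g]
  [LieSuperalgebra k g] [CommRing A] [Algebra k A] {r : Submodule k g}
  (hr : IsEvenSubalgebra r) (T : TriangularDecomposition r)

/-- The sum of the weight spaces of a Lie module. -/
def weightSum {L : Type*} [LieRing L] [LieAlgebra k L] (V : Type*) [AddCommGroup V] [Module k V]
    [LieRingModule L V] [LieModule k L V] {H : Submodule k L} (hH : IsSplit H) :
    LieSubmodule k L V where
  toSubmodule := ⨆ μ, jointEig (opRep V H) μ
  lie_mem {x v} hv := by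
    refine Submodule.iSup_induction _ (motive := fun v ↦ ⁅x, v⁆ ∈ ⨆ μ, jointEig (opRep V H) μ) hv
      (fun μ v hv ↦ ?_) (by rw [lie_zero]; exact zero_mem _) fun v w hv hw ↦ by
        rw [lie_add]; exact add_mem hv hw
    have hx : x ∈ ⨆ α, jointEig (opRep L H) α := hH.diag.ge trivial
    refine Submodule.iSup_induction _ (motive := fun x ↦ ⁅x, v⁆ ∈ ⨆ μ, jointEig (opRep V H) μ) hx
      (fun α x hx ↦ ?_) (by rw [zero_lie]; exact zero_mem _) fun x y hx hy ↦ by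
        rw [add_lie]; exact add_mem hx hy
    exact Submodule.mem_iSup_of_mem _ (lie_mem_weight hx hv)

theorem FinitelySemisimple.exists_lieSubmodule {M : SuperMod k (g ⊗[k] A)}
    (hM : FinitelySemisimple r M) (m : M) :
    ∃ P : LieSubmodule k (EvenSub hr) M, Module.Finite k P ∧ m ∈ P := by
  obtain ⟨S, hS, hf, hm⟩ := exists_finite_stable hM m
  exact ⟨hS.toLieSubmodule hr, hf, hm⟩

variable {hr T}

/-- Every irreducible finite-dimensional `r`-submodule contains a joint eigenvector of the Cartan
subalgebra. Its intersection with the `r`-stable sum of weight spaces is therefore nonzero, hence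
all of it. -/
theorem FinitelySemisimple.isDiag [IsAlgClosed k] (hH : IsSplit (cartanSub T hr))
    {M : SuperMod k (g ⊗[k] A)} (hM : FinitelySemisimple r M) :
    IsDiag (opRep M (cartanSub T hr)) := by
  have key : (⊤ : Submodule k M) ≤ weightSum M hH := by
    rw [← hM]
    refine sSup_le ?_
    rintro S ⟨hS, hf, hne, hmin⟩
    have := hf
    let P := hS.toLieSubmodule hr
    have hP : Module.Finite k P := hf
    have : Nontrivial P := (Submodule.nontrivial_iff_ne_bot (p := S)).2 hne
    obtain ⟨μ, hμ⟩ := exists_jointEig_ne_bot (V := P) hH.lie_eq_zero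
    obtain ⟨v, hv, hv0⟩ := Submodule.exists_mem_ne_zero_of_ne_bot hμ
    have h1 : IsStable r (S ⊓ (weightSum M hH : Submodule k M)) := fun x hx m hm ↦
      ⟨hS x hx m hm.1, isStable_lieSubmodule hr _ x hx m hm.2⟩
    have hv' : (v : M) ∈ S ⊓ (weightSum M hH : Submodule k M) := by
      refine ⟨v.2, Submodule.mem_iSup_of_mem μ (mem_weight.2 fun y ↦ ?_)⟩
      exact congrArg Subtype.val (mem_weight.1 hv y)
    rcases hmin _ inf_le_left h1 with h | h
    · rw [h, Submodule.mem_bot] at hv'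
      exact absurd (Subtype.ext hv') hv0
    · exact inf_eq_left.1 h
  exact eq_top_iff.2 key

/-- Weyl's theorem is applied to a finite-dimensional `r`-submodule containing the given vector;
complements make its lattice of submodules atomistic, and the atoms are the irreducible summands
sought. -/
theorem finitelySemisimple_of_isDiag [IsAlgClosed k] (hH : IsSplit (cartanSub T hr))
    {M : SuperMod k (g ⊗[k] A)} (hd : IsDiag (opRep M (cartanSub T hr)))
    (hf : ∀ m : M, ∃ P : LieSubmodule k (EvenSub hr) M, Module.Finite k P ∧ m ∈ P) :
    FinitelySemisimple r M := by
  refine eq_top_iff.2 fun m _ ↦ ?_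
  obtain ⟨P, hP, hm⟩ := hf m
  have hPd : IsDiag (opRep P (cartanSub T hr)) :=
    hd.of_injective (P : Submodule k M).subtype Subtype.val_injective fun _ _ ↦ rfl
  have := hH.complementedLattice hPd
  have : IsAtomistic (LieSubmodule k (EvenSub hr) P) := isAtomistic_of_complementedLattice
  have h1 : (⟨m, hm⟩ : P) ∈ sSup {Q : LieSubmodule k (EvenSub hr) P | IsAtom Q} := by
    rw [sSup_atoms_eq_top]
    trivial
  rw [← LieSubmodule.mem_toSubmodule, LieSubmodule.sSup_toSubmodule] at h1
  have h2 : m ∈ (sSup {s : Submodule k P | ∃ Q : LieSubmodule k (EvenSub hr) P, IsAtom Q ∧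
      (Q : Submodule k P) = s}).map (P : Submodule k M).subtype := ⟨⟨m, hm⟩, h1, rfl⟩
  refine Submodule.map_le_iff_le_comap.2 (sSup_le ?_) h2
  rintro _ ⟨Q, hQ, rfl⟩
  rw [← Submodule.map_le_iff_le_comap]
  refine le_sSup ⟨?_, inferInstance, ?_, ?_⟩
  · rintro x hx _ ⟨q, hq, rfl⟩
    obtain ⟨x, rfl⟩ := exists_evenIncl hr hx
    exact ⟨⁅x, q⁆, Q.lie_mem hq, rfl⟩
  · intro h
    have := Submodule.map_injective_of_injective (f := (P : Submodule k M).subtype)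
      Subtype.val_injective (h.trans (Submodule.map_bot _).symm)
    exact hQ.1 (by simpa using this)
  · intro S hS hSt
    let R : LieSubmodule k (EvenSub hr) P := (hSt.toLieSubmodule hr).comap P.incl
    have hR : (R : Submodule k P).map (P : Submodule k M).subtype = S := by
      refine le_antisymm ?_ fun s hs ↦ ?_
      · rintro _ ⟨q, hq, rfl⟩
        exact hq
      · obtain ⟨q, -, rfl⟩ := hS hs
        exact ⟨q, hs, rfl⟩
    have hRQ : R ≤ Q := fun q hq ↦ by
      obtain ⟨q', hq', h⟩ := hS (show (q : M) ∈ S from hq)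
      have : q' = q := Subtype.ext h
      exact this ▸ hq'
    rcases hQ.le_iff.1 hRQ with h | h
    · left
      rw [← hR, h]
      simp
    · right
      rw [← hR, h]

/-- The vectors contained in finite-dimensional `r`-submodules. -/
def locallyFinite (hr : IsEvenSubalgebra r) (M : SuperMod k (g ⊗[k] A)) : Submodule k M where
  carrier := {m | ∃ P : LieSubmodule k (EvenSub hr) M, Module.Finite k P ∧ m ∈ P}
  zero_mem' := ⟨⊥, inferInstance, zero_mem _⟩
  add_mem' := by
    rintro m n ⟨P, hP, hm⟩ ⟨Q, hQ, hn⟩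
    refine ⟨P ⊔ Q, ?_, add_mem ((le_sup_left : P ≤ P ⊔ Q) hm) ((le_sup_right : Q ≤ P ⊔ Q) hn)⟩
    have : Module.Finite k ↥((P : Submodule k M) ⊔ (Q : Submodule k M)) := by
      have : Module.Finite k (P : Submodule k M) := hP
      have : Module.Finite k (Q : Submodule k M) := hQ
      infer_instance
    rw [← LieSubmodule.sup_toSubmodule] at this
    exact this
  smul_mem' := by
    rintro c m ⟨P, hP, hm⟩
    exact ⟨P, hP, P.smul_mem c hm⟩

/-- For a finite-dimensional `r`-submodule `P`, the span of `(g ⊗ a) P` is finite dimensional, and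
it is `r`-stable because bracketing with `z ⊗ 1` preserves `g ⊗ a`. -/
theorem smul_mem_locallyFinite [FiniteDimensional k g] {M : SuperMod k (g ⊗[k] A)} (t : g ⊗[k] A) {m : M}
    (hm : m ∈ locallyFinite hr M) : envι k t • m ∈ locallyFinite hr M := by
  induction t using TensorProduct.induction_on with
  | zero => rw [map_zero, zero_smul]; exact zero_mem _
  | add s t hs ht => rw [map_add, add_smul]; exact add_mem hs ht
  | tmul x a =>
    obtain ⟨P, hP, hm⟩ := hm
    let f : g →ₗ[k] M →ₗ[k] M := (Algebra.lsmul k k M.carrier).toLinearMap ∘ₗ envι k ∘ₗ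
      (TensorProduct.mk k g A).flip a
    have hfg : (Submodule.map₂ f ⊤ (P : Submodule k M)).FG :=
      Submodule.FG.map₂ _ (Module.finite_def.1 inferInstance) ((Submodule.fg_iff_finiteDimensional _).2 hP)
    have hst : IsStable r (Submodule.map₂ f ⊤ (P : Submodule k M)) := by
      intro z hz n hn
      rw [Submodule.map₂_eq_span_image2] at hn
      induction hn using Submodule.span_induction with
      | zero => rw [smul_zero]; exact zero_mem _
      | add p q _ _ hp hq => rw [smul_add]; exact add_mem hp hq
      | smul c p _ hp => rw [smul_comm]; exact Submodule.smul_mem _ c hp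
      | mem n hn =>
        obtain ⟨y, -, p, hp, rfl⟩ := hn
        change envOne k A z • envι k (y ⊗ₜ[k] a) • p ∈ _
        rw [← mul_smul, envOne_mul_envι (hr.even hz), add_smul, mul_smul]
        exact add_mem (Submodule.apply_mem_map₂ f (m := y) trivial (isStable_lieSubmodule hr P z hz p hp))
          (Submodule.apply_mem_map₂ f (m := sbracket (k := k) z y) trivial hp)
    exact ⟨hst.toLieSubmodule hr, Module.Finite.iff_fg.2 hfg,
      Submodule.apply_mem_map₂ f (m := x) trivial hm⟩

theorem map_mem_locallyFinite {M N : SuperMod k (g ⊗[k] A)} (f : M →ₗ[SuperEnv k (g ⊗[k] A)] N) {m : M}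
    (hm : m ∈ locallyFinite hr M) : f m ∈ locallyFinite hr N := by
  obtain ⟨P, hP, hm⟩ := hm
  have : Module.Finite k (P : Submodule k M) := hP
  have hst : IsStable r ((P : Submodule k M).map (f.restrictScalars k)) := by
    rintro x hx _ ⟨p, hp, rfl⟩
    exact ⟨envOne k A x • p, isStable_lieSubmodule hr P x hx p hp, map_smul f _ _⟩
  refine ⟨hst.toLieSubmodule hr, ?_, ⟨m, hm, rfl⟩⟩
  exact (inferInstance : Module.Finite k ((P : Submodule k M).map (f.restrictScalars k)))

theorem map_mem_weightSpace {M N : SuperMod k (g ⊗[k] A)} (f : M →ₗ[SuperEnv k (g ⊗[k] A)] N)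
    {μ : Dual k T.h} {m : M} (hm : m ∈ weightSpace T M μ) : f m ∈ weightSpace T N μ := fun x ↦ by
  rw [← map_smul, hm x, smul_map_of_linear]

theorem isDiag_iff {M : SuperMod k (g ⊗[k] A)} :
    IsDiag (opRep M (cartanSub T hr)) ↔ ⨆ μ, weightSpace T M μ = ⊤ := by
  rw [IsDiag, ← (weightEquiv T hr).surjective.iSup_comp]
  have : ∀ μ, weightSpace T M (weightEquiv T hr μ) = jointEig (opRep M (cartanSub T hr)) μ :=
    fun μ ↦ Submodule.ext fun m ↦ mem_weightSpace_weightEquiv hr T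
  simp only [this]

/-- Both conditions on the right pass readily to quotients and direct sums and can be verified on
generators, unlike semisimplicity itself. -/
theorem finitelySemisimple_iff [IsAlgClosed k] (hH : IsSplit (cartanSub T hr)) {M : SuperMod k (g ⊗[k] A)} :
    FinitelySemisimple r M ↔ ⨆ μ, weightSpace T M μ = ⊤ ∧ locallyFinite hr M = ⊤ := by
  refine ⟨fun h ↦ ⟨isDiag_iff.1 (h.isDiag hH), eq_top_iff.2 fun m _ ↦ h.exists_lieSubmodule hr m⟩,
    fun h ↦ finitelySemisimple_of_isDiag hH (isDiag_iff.2 h.1) fun m ↦ ?_⟩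
  exact h.2.ge (trivial : m ∈ ⊤)

theorem locallyFinite_eq_top_of_span [FiniteDimensional k g]
    {M : SuperMod k (g ⊗[k] A)} {s : Set M} (hs : Submodule.span (SuperEnv k (g ⊗[k] A)) s = ⊤)
    (hf : ∀ m ∈ s, m ∈ locallyFinite hr M) : locallyFinite hr M = ⊤ := by
  have hst : ∀ t : g ⊗[k] A, ∀ m ∈ locallyFinite hr M, envι k t • m ∈ locallyFinite hr M :=
    fun t m hm ↦ smul_mem_locallyFinite t hm
  refine eq_top_iff.2 fun m _ ↦ ?_
  have h : Submodule.span (SuperEnv k (g ⊗[k] A)) s ≤ stableSubmodule M _ hst :=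
    Submodule.span_le.2 hf
  exact h (hs.ge trivial)

end Semisimple

end WeylSuper

namespace WeylSuper

open Module LieSuperalgebra

/-! ### Weights of modules -/

section Weights

variable {k g A : Type u} [Field k] [CharZero k] [AddCommGroup g] [Module k g]
  [LieSuperalgebra k g] [CommRing A] [Algebra k A] {r : Submodule k g}
  {T : TriangularDecomposition r}

theorem iSup_weightSpace_of_span {M : SuperMod k (g ⊗[k] A)} {s : Set M}
    (hs : Submodule.span (SuperEnv k (g ⊗[k] A)) s = ⊤)
    (hw : ∀ m ∈ s, m ∈ ⨆ μ, weightSpace T M μ) : ⨆ μ, weightSpace T M μ = ⊤ := by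
  have hst := smul_mem_of_rootOps T (Z := ⨆ μ, weightSpace T M μ) (by
    rintro _ ⟨α, -, i, x, hx, -, a, rfl⟩ z hz
    refine Submodule.iSup_induction _
      (motive := fun z ↦ envι k (x ⊗ₜ[k] a) • z ∈ ⨆ μ, weightSpace T M μ) hz
      (fun μ z hz ↦ Submodule.mem_iSup_of_mem _ (smul_mem_weightSpace T hx a hz)) ?_
      fun z w hz hw ↦ ?_
    · rw [smul_zero]; exact zero_mem _
    · rw [smul_add]; exact add_mem hz hw)
  refine eq_top_iff.2 fun m _ ↦ ?_
  have h : Submodule.span (SuperEnv k (g ⊗[k] A)) s ≤ stableSubmodule M _ hst :=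
    Submodule.span_le.2 hw
  exact h (hs.ge trivial)

/-- If `M` is generated by a subspace that is stable under `𝔥 ⊗ A` and annihilated by `n⁺ ⊗ A`, it is
generated by this subspace under the action of `n⁻ ⊗ A`. -/
theorem eq_top_of_lowering {M : SuperMod k (g ⊗[k] A)} {Z₀ Z : Submodule k M}
    (hs : Submodule.span (SuperEnv k (g ⊗[k] A)) (Z₀ : Set M) = ⊤) (hZ₀ : Z₀ ≤ Z)
    (hN : ∀ f ∈ rootOps T M T.negRoots, ∀ z ∈ Z, f z ∈ Z)
    (hB : ∀ f ∈ rootOps T M (insert 0 T.posRoots), ∀ z ∈ Z₀, f z ∈ Z₀) : Z = ⊤ := by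
  -- `Y` is the subspace generated from `Z₀` by the negative root operators; it is contained in `Z`,
  -- and moving the other operators past the negative ones shows that it is a submodule.
  set Y : Submodule k M := sInf {Z' | Z₀ ≤ Z' ∧ ∀ f ∈ rootOps T M T.negRoots, ∀ z ∈ Z', f z ∈ Z'}
  have hY₀ : Z₀ ≤ Y := le_sInf fun Z' hZ' ↦ hZ'.1
  have hst := smul_mem_of_rootOps T (rootOps_stable T (Z := Y) hY₀ (fun f hf z hz ↦
    (Submodule.mem_sInf).2 fun Z' hZ' ↦ hZ'.2 f hf z (Submodule.mem_sInf.1 hz Z' hZ'))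
    (fun Z' h1 h2 ↦ sInf_le ⟨h1, h2⟩) fun f hf z hz ↦ hY₀ (hB f hf z hz))
  refine eq_top_iff.2 fun m _ ↦ (sInf_le ⟨hZ₀, hN⟩ : Y ≤ Z) ?_
  have h : Submodule.span (SuperEnv k (g ⊗[k] A)) (Z₀ : Set M) ≤ stableSubmodule M Y hst :=
    Submodule.span_le.2 hY₀
  exact h (hs.ge trivial)

/-- Weight spaces are independent. -/
theorem eq_zero_of_mem_iSup_weightSpace {M : SuperMod k (g ⊗[k] A)} {P : Dual k T.h → Prop}
    {ν : Dual k T.h} (hν : ¬ P ν) {m : M} (hm : m ∈ weightSpace T M ν)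
    (hm' : m ∈ ⨆ (μ) (_ : P μ), weightSpace T M μ) : m = 0 := by
  let ρ : T.h →ₗ[k] End k M :=
    (Algebra.lsmul k k M.carrier).toLinearMap ∘ₗ envOne k A ∘ₗ T.h.subtype
  have h : ∀ μ, weightSpace T M μ = jointEig ρ μ := fun μ ↦ Submodule.ext fun m ↦
    (mem_jointEig (ρ := ρ)).symm
  simp only [h] at hm hm'
  exact eq_zero_of_mem_iSup hν hm hm'

theorem exists_weight_preimage {M N : SuperMod k (g ⊗[k] A)} (hM : ⨆ μ, weightSpace T M μ = ⊤)
    (f : M →ₗ[SuperEnv k (g ⊗[k] A)] N) {μ : Dual k T.h} {m : M}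
    (hm : f m ∈ weightSpace T N μ) : ∃ m' ∈ weightSpace T M μ, f m' = f m := by
  let ρ : ∀ M : SuperMod k (g ⊗[k] A), T.h →ₗ[k] End k M := fun M ↦
    (Algebra.lsmul k k M.carrier).toLinearMap ∘ₗ envOne k A ∘ₗ T.h.subtype
  have h : ∀ (M : SuperMod k (g ⊗[k] A)) μ, weightSpace T M μ = jointEig (ρ M) μ :=
    fun M μ ↦ Submodule.ext fun m ↦ (mem_jointEig (ρ := ρ M)).symm
  simp only [h] at hm hM ⊢
  exact IsDiag.exists_preimage (ρ := ρ M) (ρ' := ρ N) (f := f.restrictScalars k) hM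
    (fun y v ↦ map_smul f _ _) hm

/-- A module whose weights are bounded by `ν` coincides with its truncation. -/
theorem truncSubmodule_eq_bot {M : SuperMod k (g ⊗[k] A)} {ν : Dual k T.h}
    (h : ⨆ (μ) (_ : T.WLe μ ν), weightSpace T M μ = ⊤) : truncSubmodule T M ν = ⊥ := by
  refine eq_bot_iff.2 (iSup₂_le fun μ hμ ↦ Submodule.span_le.2 fun m hm ↦ ?_)
  exact eq_zero_of_mem_iSup_weightSpace (P := (T.WLe · ν)) hμ hm (h.ge trivial)

theorem iSup_weightSpace_le {M : SuperMod k (g ⊗[k] A)} {ν : Dual k T.h}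
    (hM : ⨆ μ, weightSpace T M μ = ⊤) (h : truncSubmodule T M ν = ⊥) :
    ⨆ (μ) (_ : T.WLe μ ν), weightSpace T M μ = ⊤ := by
  rw [← top_le_iff, ← hM]
  refine iSup_le fun μ m hm ↦ ?_
  by_cases hμ : T.WLe μ ν
  · exact Submodule.mem_iSup_of_mem μ (Submodule.mem_iSup_of_mem hμ hm)
  · have h1 : m ∈ truncSubmodule T M ν :=
      Submodule.mem_iSup_of_mem μ (Submodule.mem_iSup_of_mem hμ (Submodule.subset_span hm))
    rw [h, Submodule.mem_bot] at h1
    rw [h1]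
    exact zero_mem _

theorem map_mem_iSup_weightSpace {M N : SuperMod k (g ⊗[k] A)} (f : M →ₗ[SuperEnv k (g ⊗[k] A)] N)
    {P : Dual k T.h → Prop} {m : M} (hm : m ∈ ⨆ (μ) (_ : P μ), weightSpace T M μ) :
    f m ∈ ⨆ (μ) (_ : P μ), weightSpace T N μ := by
  have : ⨆ (μ) (_ : P μ), weightSpace T M μ ≤
      (⨆ (μ) (_ : P μ), weightSpace T N μ).comap (f.restrictScalars k) :=
    iSup₂_le fun μ hμ m hm ↦ Submodule.mem_iSup_of_mem μ (Submodule.mem_iSup_of_mem hμ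
      (map_mem_weightSpace f hm))
  exact this hm

end Weights

/-! ### Constructions in the category -/

section Constructions

variable {k L : Type u} [Field k] [AddCommGroup L] [Module k L] [LieSuperalgebra k L]

/-- A graded submodule. -/
def SuperMod.sub (M : SuperMod k L) (S : Submodule (SuperEnv k L) M) (hS : ∀ m ∈ S, M.parity m ∈ S) :
    SuperMod k L where
  carrier := S
  parity :=
    { toFun := fun m ↦ ⟨M.parity m, hS m m.2⟩
      map_add' := fun _ _ ↦ Subtype.ext (map_add M.parity _ _)
      map_smul' := fun c _ ↦ Subtype.ext (map_smul M.parity c _) }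
  parity_parity m := Subtype.ext (M.parity_parity m)
  parity_smul a m := Subtype.ext (M.parity_smul a m)

/-- The direct sum of two modules. -/
def SuperMod.prod (M N : SuperMod k L) : SuperMod k L where
  carrier := M × N
  parity := M.parity.prodMap N.parity
  parity_parity _ := Prod.ext (M.parity_parity _) (N.parity_parity _)
  parity_smul _ _ := Prod.ext (M.parity_smul _ _) (N.parity_smul _ _)

/-- The range of a homomorphism is graded. -/
theorem SuperMod.Hom.parity_mem_range {M N : SuperMod k L} (f : SuperMod.Hom M N) :
    ∀ n ∈ LinearMap.range f.toLin, N.parity n ∈ LinearMap.range f.toLin := by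
  rintro _ ⟨m, rfl⟩
  exact ⟨M.parity m, f.map_parity m⟩

theorem SuperMod.Hom.parity_mem_ker {M N : SuperMod k L} (f : SuperMod.Hom M N) :
    ∀ m ∈ LinearMap.ker f.toLin, M.parity m ∈ LinearMap.ker f.toLin := by
  intro m hm
  rw [LinearMap.mem_ker] at *
  rw [f.map_parity, hm, map_zero]

end Constructions

/-! ### Closure of the category under quotients, submodules and direct sums. -/

section CatObj

variable {k g A : Type u} [Field k] [IsAlgClosed k] [CharZero k] [AddCommGroup g] [Module k g]
  [LieSuperalgebra k g] [CommRing A] [Algebra k A] {r : Submodule k g}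
  {hr : IsEvenSubalgebra r} {T : TriangularDecomposition r} {ν : Dual k T.h}

theorem CatObj.iSup_weightSpace (hH : IsSplit (cartanSub T hr)) (M : CatObj T A ν) : ⨆ μ, weightSpace T M.obj μ = ⊤ :=
  ((finitelySemisimple_iff hH).1 M.finitelySemisimple).1

/-- The category is closed under quotients. -/
theorem CatObj.of_surjective (hH : IsSplit (cartanSub T hr)) (M : CatObj T A ν) {N : SuperMod k (g ⊗[k] A)}
    (f : M.obj →ₗ[SuperEnv k (g ⊗[k] A)] N) (hf : Function.Surjective f) :
    FinitelySemisimple r N ∧ truncSubmodule T N ν = ⊥ := by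
  have h := (finitelySemisimple_iff hH).1 M.finitelySemisimple
  have hw : ⨆ (μ) (_ : T.WLe μ ν), weightSpace T N μ = ⊤ := by
    refine eq_top_iff.2 fun n _ ↦ ?_
    obtain ⟨m, rfl⟩ := hf n
    exact map_mem_iSup_weightSpace f ((iSup_weightSpace_le h.1 M.trunc_eq).ge trivial)
  refine ⟨(finitelySemisimple_iff hH).2 ⟨?_, ?_⟩, truncSubmodule_eq_bot hw⟩
  · exact top_le_iff.1 (hw.ge.trans (iSup_mono fun μ ↦ iSup_le fun _ ↦ le_rfl))
  · refine eq_top_iff.2 fun n _ ↦ ?_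
    obtain ⟨m, rfl⟩ := hf n
    exact map_mem_locallyFinite f (h.2.ge trivial)

/-- The category is closed under submodules. -/
theorem CatObj.of_injective (hH : IsSplit (cartanSub T hr)) (M : CatObj T A ν) {N : SuperMod k (g ⊗[k] A)}
    (f : N →ₗ[SuperEnv k (g ⊗[k] A)] M.obj) (hf : Function.Injective f) :
    FinitelySemisimple r N ∧ truncSubmodule T N ν = ⊥ := by
  have h := M.finitelySemisimple.isDiag hH
  refine ⟨finitelySemisimple_of_isDiag hH
    (h.of_injective (f.restrictScalars k) hf fun y v ↦ map_smul f _ _) fun n ↦ ?_, ?_⟩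
  · obtain ⟨P, hP, hn⟩ := M.finitelySemisimple.exists_lieSubmodule hr (f n)
    have hst : IsStable r ((P : Submodule k M.obj).comap (f.restrictScalars k)) := by
      intro x hx m hm
      change f (envOne k A x • m) ∈ P
      rw [map_smul]
      exact isStable_lieSubmodule hr P x hx _ hm
    refine ⟨hst.toLieSubmodule hr, ?_, hn⟩
    have : Module.Finite k (P : Submodule k M.obj) := hP
    exact Module.Finite.of_injective ((f.restrictScalars k).restrict (fun _ hx ↦ hx) :
      (P : Submodule k M.obj).comap (f.restrictScalars k) →ₗ[k] (P : Submodule k M.obj))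
      fun x y hxy ↦ Subtype.ext (hf (congrArg Subtype.val hxy))
  · refine eq_bot_iff.2 (iSup₂_le fun μ hμ ↦ Submodule.span_le.2 fun n hn ↦ hf ?_)
    rw [map_zero]
    exact weightSpace_eq_bot T M hμ (map_mem_weightSpace f hn)

/-- The quotient of an object by a graded submodule. -/
def CatObj.quot (hH : IsSplit (cartanSub T hr)) (M : CatObj T A ν) (S : Submodule (SuperEnv k (g ⊗[k] A)) M.obj)
    (hS : ∀ m ∈ S, M.obj.parity m ∈ S) : CatObj T A ν where
  obj := M.obj.quot S hS
  finitelySemisimple := (CatObj.of_surjective hH M (N := M.obj.quot S hS) S.mkQ S.mkQ_surjective).1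
  trunc_eq := (CatObj.of_surjective hH M (N := M.obj.quot S hS) S.mkQ S.mkQ_surjective).2

/-- A graded submodule of an object. -/
def CatObj.sub (hH : IsSplit (cartanSub T hr)) (M : CatObj T A ν) (S : Submodule (SuperEnv k (g ⊗[k] A)) M.obj)
    (hS : ∀ m ∈ S, M.obj.parity m ∈ S) : CatObj T A ν where
  obj := M.obj.sub S hS
  finitelySemisimple := (CatObj.of_injective hH M (N := M.obj.sub S hS) S.subtype S.injective_subtype).1
  trunc_eq := (CatObj.of_injective hH M (N := M.obj.sub S hS) S.subtype S.injective_subtype).2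

theorem CatObj.prod_aux (hH : IsSplit (cartanSub T hr)) (M N : CatObj T A ν) :
    FinitelySemisimple r (M.obj.prod N.obj) ∧ truncSubmodule T (M.obj.prod N.obj) ν = ⊥ := by
  have hM := (finitelySemisimple_iff hH).1 M.finitelySemisimple
  have hN := (finitelySemisimple_iff hH).1 N.finitelySemisimple
  let i : M.obj →ₗ[SuperEnv k (g ⊗[k] A)] M.obj.prod N.obj := LinearMap.inl _ _ _
  let j : N.obj →ₗ[SuperEnv k (g ⊗[k] A)] M.obj.prod N.obj := LinearMap.inr _ _ _
  have hij : ∀ p : M.obj.prod N.obj, p = i p.1 + j p.2 := fun p ↦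
    (Prod.fst_add_snd p).symm
  have hw : ⨆ (μ) (_ : T.WLe μ ν), weightSpace T (M.obj.prod N.obj) μ = ⊤ := by
    refine eq_top_iff.2 fun p _ ↦ ?_
    rw [hij p]
    exact add_mem (map_mem_iSup_weightSpace i ((iSup_weightSpace_le hM.1 M.trunc_eq).ge trivial))
      (map_mem_iSup_weightSpace j ((iSup_weightSpace_le hN.1 N.trunc_eq).ge trivial))
  refine ⟨(finitelySemisimple_iff hH).2 ⟨?_, ?_⟩, truncSubmodule_eq_bot hw⟩
  · exact top_le_iff.1 (hw.ge.trans (iSup_mono fun μ ↦ iSup_le fun _ ↦ le_rfl))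
  · refine eq_top_iff.2 fun p _ ↦ ?_
    rw [hij p]
    exact add_mem (map_mem_locallyFinite i (hM.2.ge trivial)) (map_mem_locallyFinite j (hN.2.ge trivial))

/-- The direct sum of two objects. -/
def CatObj.prod (hH : IsSplit (cartanSub T hr)) (M N : CatObj T A ν) : CatObj T A ν where
  obj := M.obj.prod N.obj
  finitelySemisimple := (CatObj.prod_aux hH M N).1
  trunc_eq := (CatObj.prod_aux hH M N).2

end CatObj

end WeylSuper

namespace WeylSuper

open Module LieSuperalgebra

/-! ### The Weyl functor -/

section Dominant

variable {k g : Type u} [Field k] [AddCommGroup g] [Module k g]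
  [LieSuperalgebra k g] {r : Submodule k g} {T : TriangularDecomposition r} {ν : Dual k T.h}

/-- A dominant weight takes natural values on the coroots of `r`. -/
theorem exists_nat_of_dominant [CharZero k] (hν : ν ∈ T.dominant) {α : Dual k T.h} (hα : α ∈ T.posRoots)
    {x y : g} {h : T.h} (ht : T.IsTriple α x y h) : ∃ m : ℕ, ν h = m := by
  obtain ⟨V, hV, -, v, hv0, hpos, hv⟩ := hν
  let _ : LieRing (End k V) := LieRing.ofAssociativeRing
  let _ : LieAlgebra k (End k V) := LieAlgebra.ofAssociativeAlgebra
  have hbr : ∀ z ∈ part k g 0, ∀ w ∈ part k g 0,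
      ⁅Algebra.lsmul k k V.carrier (envι k z), Algebra.lsmul k k V.carrier (envι k w)⁆ =
        Algebra.lsmul k k V.carrier (envι k (sbracket (k := k) z w)) := by
    intro z hz w hw
    have e := congrArg (Algebra.lsmul k k V.carrier) (envι_mul k hz hw)
    have hs : superSign k 0 0 = 1 := by simp [superSign]
    rw [hs, one_smul, map_add, map_mul, map_mul] at e
    rw [Ring.lie_def, e, add_sub_cancel_left]
  have hxe := T.r_even ht.x_mem.2
  have hye := T.r_even ht.y_mem.2
  have hhe := T.h_even h.2
  -- If the coroot acts by zero on `V`, the operators form no `sl(2)`-triple, but then its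
  -- eigenvalue on the highest weight vector is zero.
  by_cases hH0 : Algebra.lsmul k k V.carrier (envι k (h : g)) = 0
  · refine ⟨0, ?_⟩
    have h1 : envι k (h : g) • v = 0 := LinearMap.congr_fun hH0 v
    rw [hv, smul_eq_zero_iff_left hv0] at h1
    rw [h1, Nat.cast_zero]
  have t : IsSl2Triple (Algebra.lsmul k k V.carrier (envι k (h : g)))
      (Algebra.lsmul k k V.carrier (envι k x)) (Algebra.lsmul k k V.carrier (envι k y)) := by
    refine ⟨hH0, ?_, ?_, ?_⟩
    · rw [hbr x hxe y hye, ht.xy]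
    · rw [hbr _ hhe x hxe, ht.hx, map_smul, map_smul, ofNat_smul_eq_nsmul]
    · rw [hbr _ hhe y hye, ht.hy, map_neg, map_neg, map_smul, map_smul, ofNat_smul_eq_nsmul]
  have P : t.HasPrimitiveVectorWith v (ν h) :=
    { ne_zero := hv0
      lie_h := hv h
      lie_e := hpos x (le_iSup₂_of_le (f := fun α (_ : α ∈ T.posRoots) ↦ rootSpace T.h α) α hα le_rfl
        ht.x_mem.1) }
  exact P.exists_nat

end Dominant

/-! ### Generators, weights and local finiteness of `𝐖 V`. -/

section Weyl

variable {k g A : Type u} [Field k] [CharZero k] [AddCommGroup g] [Module k g]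
  [LieSuperalgebra k g] [CommRing A] [Algebra k A] {r : Submodule k g}
  {T : TriangularDecomposition r} {ν : Dual k T.h}

/-- The projection `P_A(K(ν)) → W_A(ν)`. -/
def weylProj (T : TriangularDecomposition r) (A : Type u) [CommRing A] [Algebra k A] (ν : Dual k T.h) :
    inducedKac T A ν →ₗ[SuperEnv k (g ⊗[k] A)] globalWeyl T A ν :=
  (truncSubmodule T (inducedKac T A ν) ν).mkQ

theorem weylProj_surjective : Function.Surjective (weylProj T A ν) :=
  Submodule.mkQ_surjective _

theorem weylProj_gen : weylProj T A ν (inducedKacGen T A ν) = weylGen T A ν := rfl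

theorem smul_inducedKacGen (u : SuperEnv k (g ⊗[k] A)) :
    u • inducedKacGen T A ν = (kacIdeal T A ν).mkQ u :=
  congrArg (fun z : SuperEnv k (g ⊗[k] A) ↦ (kacIdeal T A ν).mkQ z) (mul_one u)

theorem smul_inducedKacGen_eq_zero {u : SuperEnv k (g ⊗[k] A)} (hu : u ∈ kacRelations T A ν) :
    u • inducedKacGen T A ν = 0 := by
  rw [smul_inducedKacGen]
  exact (Submodule.Quotient.mk_eq_zero _).2 (Submodule.subset_span hu)

theorem exists_smul_inducedKacGen (p : inducedKac T A ν) :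
    ∃ u : SuperEnv k (g ⊗[k] A), u • inducedKacGen T A ν = p := by
  obtain ⟨u, rfl⟩ := (kacIdeal T A ν).mkQ_surjective p
  exact ⟨u, smul_inducedKacGen u⟩

theorem exists_smul_weylGen (w : globalWeyl T A ν) :
    ∃ u : SuperEnv k (g ⊗[k] A), u • weylGen T A ν = w := by
  obtain ⟨p, rfl⟩ := weylProj_surjective w
  obtain ⟨u, rfl⟩ := exists_smul_inducedKacGen p
  exact ⟨u, by rw [map_smul, weylProj_gen]⟩

theorem inducedKacGen_mem_weightSpace :
    inducedKacGen T A ν ∈ weightSpace T (inducedKac T A ν) ν := by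
  intro x
  have h := smul_inducedKacGen_eq_zero (T := T) (A := A) (ν := ν) (Or.inl (Or.inr ⟨x, rfl⟩))
  rw [sub_smul, sub_eq_zero, algebraMap_smul] at h
  exact h

theorem weylGen_mem_weightSpace : weylGen T A ν ∈ weightSpace T (globalWeyl T A ν) ν :=
  map_mem_weightSpace (weylProj T A ν) inducedKacGen_mem_weightSpace

/-- The relations of `K(ν)` concern only `n⁺ ⊗ 1`. For general `a` the vector vanishes because it
comes from weight `ν + α`, which is not below `ν` and is killed by truncation. -/
theorem posRoot_smul_weylGen {α : Dual k T.h} (hα : α ∈ T.posRoots) {x : g}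
    (hx : x ∈ rootSpace T.h α) (a : A) : envι k (x ⊗ₜ[k] a) • weylGen T A ν = 0 := by
  rw [← weylProj_gen, ← map_smul]
  refine (Submodule.Quotient.mk_eq_zero _).2 ?_
  exact Submodule.mem_iSup_of_mem (ν + α) (Submodule.mem_iSup_of_mem (T.not_wLe_add hα ν)
    (Submodule.subset_span (smul_mem_weightSpace T hx a inducedKacGen_mem_weightSpace)))

theorem pow_smul_weylGen {α : Dual k T.h} (hα : α ∈ T.simpleRootsR) {x y : g} {h : T.h}
    (ht : T.IsTriple α x y h) {m : ℕ} (hm : ν h = m) :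
    envOne k A y ^ (m + 1) • weylGen T A ν = 0 := by
  rw [← weylProj_gen, ← map_smul,
    smul_inducedKacGen_eq_zero (Or.inr ⟨α, hα, x, y, h, m, ht, hm, rfl⟩), map_zero]

/-- The weights of the global Weyl module are bounded by `ν`. -/
theorem globalWeyl_weights :
    ⨆ (μ) (_ : T.WLe μ ν), weightSpace T (globalWeyl T A ν) μ = ⊤ := by
  have h : ⨆ μ, weightSpace T (inducedKac T A ν) μ = ⊤ := by
    refine iSup_weightSpace_of_span (s := {inducedKacGen T A ν}) ?_ ?_
    · refine eq_top_iff.2 fun p _ ↦ ?_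
      obtain ⟨u, rfl⟩ := exists_smul_inducedKacGen p
      exact Submodule.smul_mem _ u (Submodule.subset_span rfl)
    · rintro _ rfl
      exact Submodule.mem_iSup_of_mem ν inducedKacGen_mem_weightSpace
  refine eq_top_iff.2 fun w _ ↦ ?_
  obtain ⟨p, rfl⟩ := weylProj_surjective w
  have hp : p ∈ ⨆ μ, weightSpace T (inducedKac T A ν) μ := h.ge trivial
  refine Submodule.iSup_induction _ (motive := fun p ↦ weylProj T A ν p ∈
    ⨆ (μ) (_ : T.WLe μ ν), weightSpace T (globalWeyl T A ν) μ) hp (fun μ p hp ↦ ?_) ?_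
    fun p q hp hq ↦ ?_
  · by_cases hμ : T.WLe μ ν
    · exact Submodule.mem_iSup_of_mem μ (Submodule.mem_iSup_of_mem hμ (map_mem_weightSpace _ hp))
    · have : weylProj T A ν p = 0 := (Submodule.Quotient.mk_eq_zero _).2
        (Submodule.mem_iSup_of_mem μ (Submodule.mem_iSup_of_mem hμ (Submodule.subset_span hp)))
      rw [this]
      exact zero_mem _
  · rw [map_zero]
    exact zero_mem _
  · rw [map_add]
    exact add_mem hp hq

variable (V : AMod T A ν)

/-- The map `w ↦ w ⊗ v`. -/
def weylTmul (v : V.carrier) : globalWeyl T A ν →ₗ[SuperEnv k (g ⊗[k] A)] weylFunctor T V where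
  toFun w := (balanced T V).mkQ (w ⊗ₜ[k] v : (globalWeyl T A ν).carrier ⊗[k] V.carrier)
  map_add' w w' := by
    rw [TensorProduct.add_tmul]
    exact map_add (balanced T V).mkQ _ _
  map_smul' u w := map_smul (balanced T V).mkQ u
    (w ⊗ₜ[k] v : (globalWeyl T A ν).carrier ⊗[k] V.carrier)

/-- The unit of the adjunction, `v ↦ w_ν ⊗ v`. -/
def weylUnit : V.carrier →ₗ[k] weylFunctor T V where
  toFun v := weylTmul V v (weylGen T A ν)
  map_add' v v' := by
    change (balanced T V).mkQ _ = (balanced T V).mkQ _ + (balanced T V).mkQ _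
    rw [TensorProduct.tmul_add]
    exact map_add (balanced T V).mkQ _ _
  map_smul' c v := by
    change (balanced T V).mkQ _ = c • (balanced T V).mkQ _
    rw [TensorProduct.tmul_smul]
    rfl

theorem weylTmul_weylGen (v : V.carrier) : weylTmul V v (weylGen T A ν) = weylUnit V v := rfl

theorem weylTmul_smul (v : V.carrier) (u : SuperEnv k (g ⊗[k] A)) :
    weylTmul V v (u • weylGen T A ν) = u • weylUnit V v := by
  rw [map_smul, weylTmul_weylGen]

theorem weylFunctor_induction {motive : weylFunctor T V → Prop}
    (tmul : ∀ w v, motive (weylTmul V v w)) (add : ∀ x y, motive x → motive y → motive (x + y))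
    (x : weylFunctor T V) : motive x := by
  obtain ⟨t, rfl⟩ := (balanced T V).mkQ_surjective x
  change (globalWeyl T A ν).carrier ⊗[k] V.carrier at t
  induction t using TensorProduct.induction_on with
  | zero =>
    have h := tmul 0 0
    rw [map_zero] at h
    exact (congrArg motive (map_zero (balanced T V).mkQ)).mpr h
  | tmul w v => exact tmul w v
  | add s t hs ht => exact (congrArg motive (map_add (balanced T V).mkQ s t)).mpr (add _ _ hs ht)

theorem span_range_weylUnit :
    Submodule.span (SuperEnv k (g ⊗[k] A)) (LinearMap.range (weylUnit V) : Set (weylFunctor T V)) = ⊤ := by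
  refine eq_top_iff.2 fun x _ ↦ ?_
  induction x using weylFunctor_induction with
  | tmul w v =>
    obtain ⟨u, rfl⟩ := exists_smul_weylGen w
    rw [weylTmul_smul]
    exact Submodule.smul_mem _ u (Submodule.subset_span ⟨v, rfl⟩)
  | add x y hx hy => exact add_mem (hx trivial) (hy trivial)

theorem weylUnit_mem_weightSpace (v : V.carrier) : weylUnit V v ∈ weightSpace T (weylFunctor T V) ν :=
  map_mem_weightSpace (weylTmul V v) weylGen_mem_weightSpace

theorem smul_weylUnit (u : cartanEnv T A) (v : V.carrier) :
    (u : SuperEnv k (g ⊗[k] A)) • weylUnit V v =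
      weylUnit V ((Ideal.Quotient.mk (cartanAnn T A ν) u : weylAlg T A ν) • v) := by
  rw [← weylTmul_smul]
  refine (Submodule.Quotient.eq (balanced T V)).2 (Submodule.subset_span ⟨1, u, v, ?_⟩)
  rw [one_mul, one_smul]
  rfl

theorem parity_weylUnit (v : V.carrier) :
    (weylFunctor T V).parity (weylUnit V v) = weylUnit V (V.parity v) := by
  refine (SuperMod.quot_parity_mk (tensorMod T V) (balanced T V) (parity_mem_balanced T V)
    (weylGen T A ν ⊗ₜ[k] v : (globalWeyl T A ν).carrier ⊗[k] V.carrier)).trans ?_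
  change (balanced T V).mkQ (TensorProduct.map (globalWeyl T A ν).parity V.parity
    (weylGen T A ν ⊗ₜ[k] v)) = _
  rw [TensorProduct.map_tmul, parity_weylGen]
  rfl

theorem weylFunctor_weights :
    ⨆ (μ) (_ : T.WLe μ ν), weightSpace T (weylFunctor T V) μ = ⊤ := by
  refine eq_top_iff.2 fun x _ ↦ ?_
  induction x using weylFunctor_induction with
  | tmul w v => exact map_mem_iSup_weightSpace (weylTmul V v) (globalWeyl_weights.ge trivial)
  | add x y hx hy => exact add_mem (hx trivial) (hy trivial)

/-- The `ν`-weight space of `𝐖 V` is the image of `V`. -/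
theorem mem_range_weylUnit {x : weylFunctor T V} (hx : x ∈ weightSpace T (weylFunctor T V) ν) :
    x ∈ LinearMap.range (weylUnit V) := by
  set Z₀ := LinearMap.range (weylUnit V)
  -- `Y` collects the weights of evaluation smaller than that of `ν`. Lowering operators carry the
  -- image of `V` into `Y`, so the two together span the module, and independence of weight spaces
  -- excludes a contribution of `Y` in weight `ν`.
  set Y : Submodule k (weylFunctor T V) :=
    ⨆ (μ) (_ : T.ev μ < T.ev ν), weightSpace T (weylFunctor T V) μ with hY
  have hlow : ∀ f ∈ rootOps T (weylFunctor T V) T.negRoots, ∀ μ, T.ev μ ≤ T.ev ν →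
      ∀ z ∈ weightSpace T (weylFunctor T V) μ, f z ∈ Y := by
    rintro _ ⟨α, hα, i, x, hx, -, a, rfl⟩ μ hμ z hz
    refine Submodule.mem_iSup_of_mem (μ + α) (Submodule.mem_iSup_of_mem ?_
      (smul_mem_weightSpace T hx a hz))
    rw [map_add]
    linarith [hα.2.2]
  have htop : Z₀ ⊔ Y = ⊤ := by
    refine eq_top_of_lowering (T := T) (span_range_weylUnit V) le_sup_left ?_ ?_
    · intro f hf z hz
      obtain ⟨p, ⟨v, rfl⟩, y, hy, rfl⟩ := Submodule.mem_sup.1 hz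
      rw [map_add]
      refine add_mem (Submodule.mem_sup_right (hlow f hf ν le_rfl _ (weylUnit_mem_weightSpace V v)))
        (Submodule.mem_sup_right ?_)
      have : Y ≤ Y.comap f := iSup₂_le fun μ hμ z hz ↦ hlow f hf μ hμ.le z hz
      exact this hy
    · rintro _ ⟨α, hα, i, x, hx, -, a, rfl⟩ _ ⟨v, rfl⟩
      change envι k (x ⊗ₜ[k] a) • weylUnit V v ∈ _
      rcases hα with rfl | hα
      · rw [T.rootSpace_zero] at hx
        have hu : envι k (x ⊗ₜ[k] a) ∈ cartanEnv T A := Algebra.subset_adjoin ⟨x, hx, a, rfl⟩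
        exact ⟨_, (smul_weylUnit V ⟨_, hu⟩ v).symm⟩
      · rw [← weylTmul_smul, posRoot_smul_weylGen hα hx, map_zero]
        exact zero_mem _
  obtain ⟨p, ⟨v, rfl⟩, y, hy, rfl⟩ := Submodule.mem_sup.1 (htop.ge trivial : x ∈ Z₀ ⊔ Y)
  have hyν : y ∈ weightSpace T (weylFunctor T V) ν := by
    have := sub_mem hx (weylUnit_mem_weightSpace V v)
    rwa [add_sub_cancel_left] at this
  rw [eq_zero_of_mem_iSup_weightSpace (P := fun μ ↦ T.ev μ < T.ev ν) (lt_irrefl _) hyν hy, add_zero]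
  exact ⟨v, rfl⟩

variable {hr : IsEvenSubalgebra r}

/-- The evaluation of weights of `r` at the regular element. -/
def evSub (T : TriangularDecomposition r) (hr : IsEvenSubalgebra r) : Dual k (cartanSub T hr) →+ ℝ :=
  T.ev.comp (weightEquiv T hr).toLinearMap.toAddMonoidHom

theorem mem_positive_iff {α : Dual k (cartanSub T hr)} :
    α ∈ positive (L := EvenSub hr) (evSub T hr) ↔ weightEquiv T hr α ∈ T.posRootsR := by
  have h : jointEig (opRep (EvenSub hr) (cartanSub T hr)) α ≠ ⊥ ↔
      rootSpace T.h (weightEquiv T hr α) ⊓ r ≠ ⊥ := by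
    rw [Submodule.ne_bot_iff, Submodule.ne_bot_iff]
    constructor
    · rintro ⟨x, hx, hx0⟩
      exact ⟨evenIncl hr x, ⟨(mem_rootSpace_weightEquiv T hr).2 hx, evenIncl_mem hr x⟩,
        fun h ↦ hx0 (evenIncl_injective hr (h.trans (map_zero _).symm))⟩
    · rintro ⟨x, ⟨hx, hxr⟩, hx0⟩
      obtain ⟨x, rfl⟩ := exists_evenIncl hr hxr
      exact ⟨x, (mem_rootSpace_weightEquiv T hr).1 hx, fun h ↦ hx0 (by rw [h, map_zero])⟩
  constructor
  · rintro ⟨h0, hne, hev⟩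
    refine ⟨⟨?_, ?_, hev⟩, h.1 hne⟩
    · rwa [Ne, LinearEquiv.map_eq_zero_iff]
    · exact fun e ↦ h.1 hne (by rw [e, bot_inf_eq])
  · rintro ⟨⟨h0, -, hev⟩, hne⟩
    refine ⟨?_, h.2 hne, hev⟩
    rwa [Ne, LinearEquiv.map_eq_zero_iff] at h0

theorem mem_simple_iff {α : Dual k (cartanSub T hr)} :
    α ∈ simple (L := EvenSub hr) (evSub T hr) ↔ weightEquiv T hr α ∈ T.simpleRootsR := by
  simp only [simple, TriangularDecomposition.simpleRootsR, Set.mem_ofPred_eq, mem_positive_iff]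
  rw [(weightEquiv T hr).surjective.forall]
  simp only [(weightEquiv T hr).surjective.forall (p := fun γ ↦ γ ∈ T.posRootsR → _), ← map_add,
    (weightEquiv T hr).injective.ne_iff]

/-- The vector `w_ν ⊗ v` is a highest weight vector for `r`. Dominance makes `ν(h_α)` a natural
number, so that the nilpotency relation of `K(ν)` is available for every simple root of `r`, as
integrability requires. -/
theorem weylUnit_mem_locallyFinite [FiniteDimensional k g] (hH : IsSplit (cartanSub T hr))
    (hν : ν ∈ T.dominant) (v : V.carrier) : weylUnit V v ∈ locallyFinite hr (weylFunctor T V) := by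
  have hpow : ∀ (y : EvenSub hr) (n : ℕ) (x : weylFunctor T V),
      (LieModule.toEnd k (EvenSub hr) (weylFunctor T V) y ^ n) x = envOne k A (evenIncl hr y) ^ n • x := by
    intro y n x
    induction n with
    | zero => rw [pow_zero, pow_zero, one_smul, End.one_apply]
    | succ n ih =>
      rw [pow_succ', End.mul_apply, ih, pow_succ', mul_smul, LieModule.toEnd_apply_apply, evenSub_lie]
  refine exists_finite_lieSubmodule (ev := evSub T hr) (ν := (weightEquiv T hr).symm ν) hH
    (fun α h0 hne ↦ ?_) ?_ (fun α hα x hx ↦ ?_) fun α hα ↦ ?_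
  · refine T.regular _ (fun h ↦ h0 ((weightEquiv T hr).map_eq_zero_iff.1 h)) ?_
    obtain ⟨x, hx, hx0⟩ := Submodule.exists_mem_ne_zero_of_ne_bot hne
    exact (Submodule.ne_bot_iff _).2 ⟨evenIncl hr x, (mem_rootSpace_weightEquiv T hr).2 hx,
      fun h ↦ hx0 (evenIncl_injective hr (h.trans (map_zero _).symm))⟩
  · rw [← mem_weightSpace_weightEquiv, LinearEquiv.apply_symm_apply]
    exact weylUnit_mem_weightSpace V v
  · rw [evenSub_lie, ← weylTmul_smul]
    have h := posRoot_smul_weylGen (ν := ν) (A := A) (mem_positive_iff.1 hα).1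
      ((mem_rootSpace_weightEquiv T hr).2 hx) 1
    change weylTmul V v (envι k (evenIncl hr x ⊗ₜ[k] 1) • _) = 0
    rw [h, map_zero]
  · have hα' := mem_simple_iff.1 hα
    obtain ⟨e, he, he0⟩ := Submodule.exists_mem_ne_zero_of_ne_bot hα.1.2.1
    obtain ⟨f, hf, c, t, hc⟩ := hH.exists_triple hα.1.1 he he0
    have ht : T.IsTriple (weightEquiv T hr α) (evenIncl hr e) (evenIncl hr f) (cartanEquiv T hr c) :=
      { h_ne_zero := fun h ↦ t.h_ne_zero (by
          rw [LinearEquiv.map_eq_zero_iff] at h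
          rw [h]
          rfl)
        x_mem := ⟨(mem_rootSpace_weightEquiv T hr).2 he, evenIncl_mem hr e⟩
        y_mem := ⟨by
          rw [← map_neg]
          exact (mem_rootSpace_weightEquiv T hr).2 hf, evenIncl_mem hr f⟩
        xy := by rw [coe_cartanEquiv, ← t.lie_e_f, evenIncl_lie]
        hx := by
          rw [coe_cartanEquiv, ← evenIncl_lie, t.lie_h_e_nsmul, map_nsmul]
          exact (ofNat_smul_eq_nsmul k 2 _).symm
        hy := by
          rw [coe_cartanEquiv, ← evenIncl_lie, t.lie_h_f_nsmul, map_neg, map_nsmul]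
          exact congrArg _ (ofNat_smul_eq_nsmul k 2 _).symm }
    obtain ⟨m, hm⟩ := exists_nat_of_dominant hν hα'.1.1 ht
    refine ⟨e, he, f, hf, c, t, hc, m + 1, ?_⟩
    rw [hpow, ← weylTmul_smul, pow_smul_weylGen hα' ht hm, map_zero]

/-- The functor `𝐖` takes values in the category `C_A^ν`. -/
def weylObj [IsAlgClosed k] [FiniteDimensional k g] (hH : IsSplit (cartanSub T hr))
    (hν : ν ∈ T.dominant) : CatObj T A ν where
  obj := weylFunctor T V
  finitelySemisimple := by
    refine (finitelySemisimple_iff hH).2 ⟨?_, ?_⟩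
    · exact top_le_iff.1 ((weylFunctor_weights V).ge.trans (iSup_mono fun μ ↦ iSup_le fun _ ↦ le_rfl))
    · refine locallyFinite_eq_top_of_span (span_range_weylUnit V) ?_
      rintro _ ⟨v, rfl⟩
      exact weylUnit_mem_locallyFinite V hH hν v
  trunc_eq := truncSubmodule_eq_bot (weylFunctor_weights V)

end Weyl

end WeylSuper

namespace WeylSuper

open Module LieSuperalgebra

/-! ### The universal property of the Weyl functor -/

section Lift

variable {k g A : Type u} [Field k] [CharZero k] [AddCommGroup g] [Module k g]
  [LieSuperalgebra k g] [CommRing A] [Algebra k A] {r : Submodule k g}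
  {T : TriangularDecomposition r} {ν : Dual k T.h}

/-- The homomorphism `W_A(ν) → M` sending `w_ν` to a given vector of weight `ν`. -/
theorem exists_weylGen_map (M : CatObj T A ν) {m : M.obj} (hm : m ∈ weightSpace T M.obj ν) :
    ∃ f : globalWeyl T A ν →ₗ[SuperEnv k (g ⊗[k] A)] M.obj, f (weylGen T A ν) = m := by
  let p := LinearMap.toSpanSingleton (SuperEnv k (g ⊗[k] A)) (globalWeyl T A ν) (weylGen T A ν)
  have hp : Function.Surjective p := exists_smul_weylGen
  have hker : LinearMap.ker p ≤
      LinearMap.ker (LinearMap.toSpanSingleton (SuperEnv k (g ⊗[k] A)) M.obj m) :=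
    fun u hu ↦ smul_eq_zero_of_smul_weylGen T M hm hu
  refine ⟨(LinearMap.ker p).liftQ _ hker ∘ₗ (p.quotKerEquivOfSurjective hp).symm.toLinearMap, ?_⟩
  have h1 : (p.quotKerEquivOfSurjective hp).symm (weylGen T A ν) = (LinearMap.ker p).mkQ 1 := by
    rw [LinearEquiv.symm_apply_eq]
    exact (one_smul (SuperEnv k (g ⊗[k] A)) (weylGen T A ν)).symm
  change (LinearMap.ker p).liftQ _ hker ((p.quotKerEquivOfSurjective hp).symm (weylGen T A ν)) = m
  rw [h1]
  exact one_smul (SuperEnv k (g ⊗[k] A)) m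

/-- This is the universal property of `𝐖 V`. For each `v` the map sending `w_ν` to `φ v` exists
because `Ann(w_ν)` kills weight `ν` vectors; these maps depend linearly on `v`, and compatibility
with `𝐀_ν` makes them factor through the balanced tensor product. -/
theorem exists_weylLift {V : AMod T A ν} (M : CatObj T A ν) (φ : V.carrier →ₗ[k] M.obj)
    (hφ : ∀ v, φ v ∈ weightSpace T M.obj ν)
    (hu : ∀ (u : cartanEnv T A) v,
      φ ((Ideal.Quotient.mk (cartanAnn T A ν) u : weylAlg T A ν) • v) =
        (u : SuperEnv k (g ⊗[k] A)) • φ v)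
    (hp : ∀ v, φ (V.parity v) = M.obj.parity (φ v)) :
    ∃ f : SuperMod.Hom (weylFunctor T V) M.obj, ∀ v, f.toLin (weylUnit V v) = φ v := by
  choose ψ hψ using fun v ↦ exists_weylGen_map M (hφ v)
  have hψu : ∀ v (u : SuperEnv k (g ⊗[k] A)), ψ v (u • weylGen T A ν) = u • φ v := fun v u ↦ by
    rw [map_smul, hψ]
  let B : (globalWeyl T A ν).carrier →ₗ[k] V.carrier →ₗ[k] M.obj :=
    LinearMap.mk₂ k (fun w v ↦ ψ v w) (fun w w' v ↦ map_add _ _ _)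
      (fun c w v ↦ smul_map_of_linear _ _ _)
      (fun w v v' ↦ by
        obtain ⟨u, rfl⟩ := exists_smul_weylGen w
        rw [hψu, hψu, hψu, map_add, smul_add])
      (fun c w v ↦ by
        obtain ⟨u, rfl⟩ := exists_smul_weylGen w
        rw [hψu, hψu, map_smul, smul_comm])
  have hB : ∀ w v, B w v = ψ v w := fun _ _ ↦ rfl
  let F : tensorMod T V →ₗ[SuperEnv k (g ⊗[k] A)] M.obj :=
    { toFun := fun t ↦ TensorProduct.lift B t
      map_add' := fun s t ↦ map_add (TensorProduct.lift B) s t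
      map_smul' := fun u t ↦ by
        change (globalWeyl T A ν).carrier ⊗[k] V.carrier at t
        change TensorProduct.lift B (u • t) = u • TensorProduct.lift B t
        induction t using TensorProduct.induction_on with
        | zero => rw [smul_zero, map_zero, smul_zero]
        | tmul w v =>
          rw [TensorProduct.smul_tmul', TensorProduct.lift.tmul, TensorProduct.lift.tmul, hB, hB,
            map_smul]
        | add s t hs ht => rw [smul_add, map_add, hs, ht, map_add, smul_add] }
  have hF : balanced T V ≤ LinearMap.ker F := by
    refine Submodule.span_le.2 ?_
    rintro _ ⟨a, u, v, rfl⟩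
    change TensorProduct.lift B (_ - _) = 0
    rw [map_sub, TensorProduct.lift.tmul, TensorProduct.lift.tmul, hB, hB, hψu, hψu, hu, mul_smul,
      sub_self]
  let f : weylFunctor T V →ₗ[SuperEnv k (g ⊗[k] A)] M.obj := (balanced T V).liftQ F hF
  have hf : ∀ v, f (weylUnit V v) = φ v := fun v ↦ by
    change TensorProduct.lift B (weylGen T A ν ⊗ₜ[k] v) = φ v
    rw [TensorProduct.lift.tmul, hB, hψ]
  refine ⟨⟨f, fun x ↦ ?_⟩, hf⟩
  induction x using weylFunctor_induction with
  | tmul w v =>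
    obtain ⟨u, rfl⟩ := exists_smul_weylGen w
    rw [weylTmul_smul, SuperMod.parity_smul, parity_weylUnit, map_smul, map_smul, hf, hf, hp,
      SuperMod.parity_smul]
  | add x y hx hy => rw [map_add, map_add, hx, hy, map_add, map_add]

theorem weylFunctor_hom_ext {V : AMod T A ν} {M : SuperMod k (g ⊗[k] A)}
    {f f' : weylFunctor T V →ₗ[SuperEnv k (g ⊗[k] A)] M}
    (h : ∀ v, f (weylUnit V v) = f' (weylUnit V v)) : f = f' := by
  refine LinearMap.ext_on (span_range_weylUnit V) ?_
  rintro _ ⟨v, rfl⟩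
  exact h v

/-- A module without weight `ν` receives no nonzero maps from `𝐖 V`. -/
theorem weylFunctor_hom_eq_zero {V : AMod T A ν} {N : SuperMod k (g ⊗[k] A)}
    (hN : weightSpace T N ν = ⊥) (f : weylFunctor T V →ₗ[SuperEnv k (g ⊗[k] A)] N) : f = 0 :=
  weylFunctor_hom_ext fun v ↦ by
    have h := map_mem_weightSpace f (weylUnit_mem_weightSpace V v)
    rw [hN, Submodule.mem_bot] at h
    rw [h, LinearMap.zero_apply]

/-- The counit of the adjunction. -/
theorem exists_counit (M : CatObj T A ν) :
    ∃ f : SuperMod.Hom (weylFunctor T (resFunctor T M)) M.obj,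
      ∀ m : cartanWeight T M.obj ν, f.toLin (weylUnit (resFunctor T M) m) = m :=
  exists_weylLift M (V := resFunctor T M)
    ({ toFun := fun m : cartanWeight T M.obj ν ↦ (m : M.obj)
       map_add' := fun _ _ ↦ rfl
       map_smul' := fun _ _ ↦ rfl } : cartanWeight T M.obj ν →ₗ[k] M.obj)
    (fun m ↦ (m : cartanWeight T M.obj ν).2) (fun _ _ ↦ rfl) fun _ ↦ rfl

/-! ### Extensions -/

/-- Split extensions are equivalent. -/
theorem Extension.equiv_of_section {M N : CatObj T A ν} {E F : Extension T M N}
    {s : SuperMod.Hom M.obj E.mid.obj} (hs : ∀ m, E.proj.toLin (s.toLin m) = m)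
    {t : SuperMod.Hom M.obj F.mid.obj} (ht : ∀ m, F.proj.toLin (t.toLin m) = m) :
    Extension.Equiv T E F := by
  -- A section identifies the middle term with `N × M`, compatibly with the inclusion and the
  -- projection.
  have key : ∀ (E : Extension T M N) (s : SuperMod.Hom M.obj E.mid.obj),
      (∀ m, E.proj.toLin (s.toLin m) = m) →
        ∃ e : (N.obj × M.obj) ≃ₗ[SuperEnv k (g ⊗[k] A)] E.mid.obj,
          ∀ p, e p = E.incl.toLin p.1 + s.toLin p.2 := by
    intro E s hs
    have h0 : ∀ n, E.proj.toLin (E.incl.toLin n) = 0 := fun n ↦ (E.exact _).2 ⟨n, rfl⟩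
    refine ⟨LinearEquiv.ofBijective (E.incl.toLin.coprod s.toLin) ⟨?_, fun x ↦ ?_⟩, fun p ↦ rfl⟩
    · rw [← LinearMap.ker_eq_bot, LinearMap.ker_eq_bot']
      rintro ⟨n, m⟩ h
      rw [LinearMap.coprod_apply] at h
      have h1 := congrArg E.proj.toLin h
      rw [map_add, h0, zero_add, hs, map_zero] at h1
      subst h1
      rw [map_zero, add_zero] at h
      have h2 : n = 0 := E.injective (h.trans (map_zero _).symm)
      rw [h2]
      rfl
    · obtain ⟨n, hn⟩ := (E.exact (x - s.toLin (E.proj.toLin x))).1 (by rw [map_sub, hs, sub_self])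
      refine ⟨(n, E.proj.toLin x), ?_⟩
      rw [LinearMap.coprod_apply, hn, sub_add_cancel]
  obtain ⟨e, he⟩ := key E s hs
  obtain ⟨f, hf⟩ := key F t ht
  have h0 : ∀ n, E.proj.toLin (E.incl.toLin n) = 0 := fun n ↦ (E.exact _).2 ⟨n, rfl⟩
  have h1 : ∀ n, F.proj.toLin (F.incl.toLin n) = 0 := fun n ↦ (F.exact _).2 ⟨n, rfl⟩
  refine ⟨⟨e.symm.trans f, fun x ↦ ?_⟩, fun n ↦ ?_, fun x ↦ ?_⟩
  · obtain ⟨⟨n, m⟩, rfl⟩ := e.surjective x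
    have h : E.mid.obj.parity (e (n, m)) = e (N.obj.parity n, M.obj.parity m) := by
      rw [he, he, map_add, ← E.incl.map_parity, ← s.map_parity]
    rw [h, LinearEquiv.trans_apply, LinearEquiv.symm_apply_apply, LinearEquiv.trans_apply,
      LinearEquiv.symm_apply_apply, hf, hf, map_add, ← F.incl.map_parity, ← t.map_parity]
  · have h : E.incl.toLin n = e (n, 0) := by rw [he, map_zero, add_zero]
    rw [h, LinearEquiv.trans_apply, LinearEquiv.symm_apply_apply, hf, map_zero, add_zero]
  · obtain ⟨⟨n, m⟩, rfl⟩ := e.surjective x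
    rw [LinearEquiv.trans_apply, LinearEquiv.symm_apply_apply, hf, he, map_add, map_add, h0, h1, hs,
      ht]

end Lift

/-! ### Splitting of extensions and the isomorphism criterion. -/

section Main

variable {k g A : Type u} [Field k] [IsAlgClosed k] [CharZero k] [AddCommGroup g] [Module k g]
  [LieSuperalgebra k g] [CommRing A] [Algebra k A] {r : Submodule k g}
  {T : TriangularDecomposition r} {ν : Dual k T.h} {hr : IsEvenSubalgebra r}

/-- An extension of a module in the image of `𝐖` by a module without weight `ν` splits. -/
theorem exists_section (hH : IsSplit (cartanSub T hr)) {M N : CatObj T A ν}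
    (hN : weightSpace T N.obj ν = ⊥) (E : Extension T M N) {V : AMod T A ν}
    (e : SuperMod.Iso M.obj (weylFunctor T V)) :
    ∃ s : SuperMod.Hom M.obj E.mid.obj, ∀ m, E.proj.toLin (s.toLin m) = m := by
  -- Two lifts of weight `ν` differ by an element of `N_ν = 0`.
  have hinj : ∀ x ∈ weightSpace T E.mid.obj ν, ∀ y ∈ weightSpace T E.mid.obj ν,
      E.proj.toLin x = E.proj.toLin y → x = y := by
    intro x hx y hy h
    obtain ⟨n, hn⟩ := (E.exact (x - y)).1 (by rw [map_sub, h, sub_self])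
    have hnν : n ∈ weightSpace T N.obj ν := fun z ↦ E.injective (by
      rw [map_smul, hn, smul_map_of_linear, hn]
      exact sub_mem hx hy z)
    rw [hN, Submodule.mem_bot] at hnν
    rw [← sub_eq_zero, ← hn, hnν, map_zero]
  have hw : ∀ v, e.toEquiv.symm (weylUnit V v) ∈ weightSpace T M.obj ν := fun v ↦
    map_mem_weightSpace e.toEquiv.symm.toLinearMap (weylUnit_mem_weightSpace V v)
  have hex : ∀ v, ∃ x ∈ weightSpace T E.mid.obj ν, E.proj.toLin x = e.toEquiv.symm (weylUnit V v) := by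
    intro v
    obtain ⟨y, hy⟩ := E.surjective (e.toEquiv.symm (weylUnit V v))
    obtain ⟨x, hx, hxy⟩ := exists_weight_preimage (CatObj.iSup_weightSpace hH E.mid) E.proj.toLin
      (m := y) (by rw [hy]; exact hw v)
    exact ⟨x, hx, hxy.trans hy⟩
  choose q hq hqe using hex
  have hpar : ∀ x, e.toEquiv.symm ((weylFunctor T V).parity x) = M.obj.parity (e.toEquiv.symm x) := by
    intro x
    rw [LinearEquiv.symm_apply_eq, e.map_parity, LinearEquiv.apply_symm_apply]
  -- Uniqueness of weight `ν` lifts forces the pointwise choice `q` to be linear, compatible with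
  -- `𝐀_ν` and even.
  obtain ⟨σ, hσ⟩ := exists_weylLift (V := V) E.mid
    { toFun := q
      map_add' := fun v v' ↦ hinj _ (hq _) _ (add_mem (hq _) (hq _)) (by
        rw [hqe, map_add, map_add, map_add, hqe, hqe])
      map_smul' := fun c v ↦ hinj _ (hq _) _ (Submodule.smul_mem _ _ (hq _)) (by
        rw [hqe, map_smul, RingHom.id_apply, smul_map_of_linear, hqe]
        exact smul_map_of_linear e.toEquiv.symm.toLinearMap _ _) } hq
    (fun u v ↦ hinj _ (hq _) _ ((cartanWeight T E.mid.obj ν).smul_mem u (hq v)) (by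
      change E.proj.toLin (q _) = E.proj.toLin (_ • q v)
      rw [hqe, ← smul_weylUnit, map_smul e.toEquiv.symm, map_smul E.proj.toLin, hqe]))
    (fun v ↦ hinj _ (hq _) _ (parity_mem_weightSpace T _ (hq _)) (by
      change E.proj.toLin (q _) = E.proj.toLin (E.mid.obj.parity (q v))
      rw [hqe, E.proj.map_parity, hqe, ← hpar, parity_weylUnit]))
  have hσ' : E.proj.toLin ∘ₗ σ.toLin = e.toEquiv.symm.toLinearMap :=
    weylFunctor_hom_ext fun v ↦ by
      rw [LinearMap.comp_apply, hσ]
      exact hqe v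
  refine ⟨⟨σ.toLin ∘ₗ e.toEquiv.toLinearMap, fun m ↦ ?_⟩, fun m ↦ ?_⟩
  · rw [LinearMap.comp_apply, LinearMap.comp_apply, LinearEquiv.coe_coe, e.map_parity, σ.map_parity]
  · rw [LinearMap.comp_apply, ← LinearMap.comp_apply, hσ']
    exact e.toEquiv.symm_apply_apply m

/-- The split extension. -/
def Extension.split (hH : IsSplit (cartanSub T hr)) (M N : CatObj T A ν) : Extension T M N where
  mid := CatObj.prod hH N M
  incl := ⟨LinearMap.inl _ N.obj M.obj, fun _ ↦ Prod.ext rfl (map_zero M.obj.parity).symm⟩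
  proj := ⟨LinearMap.snd _ N.obj M.obj, fun _ ↦ rfl⟩
  injective := LinearMap.inl_injective
  surjective := LinearMap.snd_surjective
  exact := Function.Exact.inl_snd

/-- The counit is the isomorphism: vanishing of `Hom` into its cokernel gives surjectivity, and
vanishing of `Ext¹` into its kernel gives injectivity. -/
theorem exists_iso_of_ext [FiniteDimensional k g] (hH : IsSplit (cartanSub T hr)) (hν : ν ∈ T.dominant)
    (M : CatObj T A ν)
    (h : ∀ N : CatObj T A ν, weightSpace T N.obj ν = ⊥ →
      (∀ f : SuperMod.Hom M.obj N.obj, f.toLin = 0) ∧ Subsingleton (Ext1 T M N)) :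
    Nonempty (SuperMod.Iso M.obj (weylFunctor T (resFunctor T M))) := by
  obtain ⟨ε, hε⟩ := exists_counit M
  have hsurj : Function.Surjective ε.toLin := by
    let Q := CatObj.quot hH M (LinearMap.range ε.toLin) ε.parity_mem_range
    -- A weight `ν` vector of the cokernel lifts to `M_ν`, which lies in the image of the counit.
    have hQ : weightSpace T Q.obj ν = ⊥ := by
      refine (Submodule.eq_bot_iff _).2 fun q hq ↦ ?_
      obtain ⟨m, rfl⟩ := (LinearMap.range ε.toLin).mkQ_surjective q
      obtain ⟨m', hm', e⟩ := exists_weight_preimage (N := Q.obj) (CatObj.iSup_weightSpace hH M)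
        (LinearMap.range ε.toLin).mkQ hq
      refine e.symm.trans ?_
      exact (Submodule.Quotient.mk_eq_zero _).2 ⟨weylUnit (resFunctor T M) ⟨m', hm'⟩, hε ⟨m', hm'⟩⟩
    have h0 := (h Q hQ).1 ⟨(LinearMap.range ε.toLin).mkQ, fun _ ↦ rfl⟩
    intro m
    exact (Submodule.Quotient.mk_eq_zero _).1 (LinearMap.congr_fun h0 m)
  let X := weylObj (resFunctor T M) hH hν
  let K := CatObj.sub hH X (LinearMap.ker ε.toLin) ε.parity_mem_ker
  -- Weight `ν` vectors of `𝐖 𝐑 M` are of the form `w_ν ⊗ v`, and the counit sends such a vector to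
  -- `v`.
  have hK : weightSpace T K.obj ν = ⊥ := by
    refine (Submodule.eq_bot_iff _).2 fun x hx ↦ ?_
    have h1 := map_mem_weightSpace (N := X.obj) (LinearMap.ker ε.toLin).subtype hx
    obtain ⟨v, hv⟩ := mem_range_weylUnit _ h1
    have h2 : ε.toLin (weylUnit (resFunctor T M) v) = 0 := by
      rw [hv]
      exact x.2
    have h3 : v = 0 := Subtype.ext ((hε v).symm.trans h2)
    rw [h3, map_zero] at hv
    exact Subtype.ext hv.symm
  let E : Extension T M K :=
    { mid := X
      incl := ⟨(LinearMap.ker ε.toLin).subtype, fun _ ↦ rfl⟩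
      proj := ε
      injective := Subtype.val_injective
      surjective := hsurj
      exact := LinearMap.exact_subtype_ker_map ε.toLin }
  obtain ⟨e, he, -⟩ : Extension.Equiv T E (Extension.split hH M K) :=
    Quotient.exact (s := extSetoid T M K) ((h K hK).2.elim _ _)
  -- The equivalence with the split extension yields a retraction of `𝐖 𝐑 M` onto `K`, which must be
  -- zero as `K` has no weight `ν`; on `K` it is the identity.
  have h1 := weylFunctor_hom_eq_zero hK
    (LinearMap.fst (SuperEnv k (g ⊗[k] A)) K.obj M.obj ∘ₗ e.toEquiv.toLinearMap)
  have hinj : Function.Injective ε.toLin := by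
    rw [← LinearMap.ker_eq_bot, LinearMap.ker_eq_bot']
    intro x hx
    have h2 := LinearMap.congr_fun h1 x
    have h3 : e.toEquiv x = ((⟨x, hx⟩ : LinearMap.ker ε.toLin), (0 : M.obj)) := he ⟨x, hx⟩
    have h4 : (e.toEquiv x).1 = (0 : K.obj) := h2
    rw [h3] at h4
    exact congrArg Subtype.val h4
  refine ⟨⟨(LinearEquiv.ofBijective ε.toLin ⟨hinj, hsurj⟩).symm, fun m ↦ ?_⟩⟩
  rw [LinearEquiv.symm_apply_eq]
  change _ = ε.toLin _
  rw [ε.map_parity]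
  exact congrArg _ ((LinearEquiv.ofBijective ε.toLin ⟨hinj, hsurj⟩).apply_symm_apply m).symm

end Main

end WeylSuper

theorem theoremA2 {k : Type u} [Field k] [IsAlgClosed k] [CharZero k]
    {g : Type u} [AddCommGroup g] [Module k g] [FiniteDimensional k g]
    [WeylSuper.LieSuperalgebra k g]
    (r : Submodule k g) (hr : WeylSuper.IsReductivePart r)
    (T : WeylSuper.TriangularDecomposition r) (hT : T.CondC1)
    (A : Type u) [CommRing A] [Algebra k A]
    (ν : Module.Dual k T.h) (hν : ν ∈ T.dominant) (M : WeylSuper.CatObj T A ν) :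
    Nonempty (WeylSuper.SuperMod.Iso M.obj
        (WeylSuper.weylFunctor T (WeylSuper.resFunctor T M))) ↔
      ∀ N : WeylSuper.CatObj T A ν, WeylSuper.weightSpace T N.obj ν = ⊥ →
        (∀ f : WeylSuper.SuperMod.Hom M.obj N.obj, f.toLin = 0) ∧
          Subsingleton (WeylSuper.Ext1 T M N) := by
  obtain ⟨he, hH⟩ := WeylSuper.exists_isSplit hr T
  refine ⟨?_, WeylSuper.exists_iso_of_ext hH hν M⟩
  rintro ⟨e⟩ N hN
  refine ⟨fun f ↦ ?_, ⟨fun E F ↦ ?_⟩⟩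
  · have h := WeylSuper.weylFunctor_hom_eq_zero hN (f.toLin ∘ₗ e.toEquiv.symm.toLinearMap)
    ext m
    have h1 := LinearMap.congr_fun h (e.toEquiv m)
    rw [LinearMap.comp_apply, LinearEquiv.coe_coe, LinearEquiv.symm_apply_apply] at h1
    exact h1
  · induction E using Quotient.inductionOn with | _ E
    induction F using Quotient.inductionOn with | _ F
    obtain ⟨s, hs⟩ := WeylSuper.exists_section hH hN E e
    obtain ⟨t, ht⟩ := WeylSuper.exists_section hH hN F e
    exact Quotient.sound (WeylSuper.Extension.equiv_of_section hs ht)
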